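/- Work in the language of second order arithmetic. For $n\in\mathbb N$ let $[n]=\{j : j\le n\}$. Let $\mathrm{Seq}$ be the set of codes of finite sequences of natural numbers, and for $l\in\mathrm{Seq}$ let $A_l=\{l(i): i<\mathrm{lh}\,l\}$ be the finite set encoded by $l$. "$|A|=m$" means that there is a one-to-one function from $\{j:j<m\}$ onto $A$, and "$|A|>m$" means that $|A|=m'$ for some $m'>m$. A sequence $(l_m)$ of elements of $\mathrm{Seq}$ is a *nested sequence with union* if $A_{l_m}\subseteq A_{l_{m+1}}$ for all $m$ and the set $\bigcup_m A_{l_m}$ exists. A sequence $(l_m)$ of elements of $\mathrm{Seq}$ is *weakly convergent* if there is an infinite set $A$ such that for every finite set $B$ there is an $i$ with $A_{l_j}\cap B=A\cap B$ for all $j\ge i$. A function $F:\mathbb N\to\mathbb N$ is *extensional* if $A_l=A_{l'}$ implies $F(l)=F(l')$ for all $l,l'\in\mathrm{Seq}$. Write $F\in AS$ if $F$ is extensional and for every nested sequence with union $(l_m)$ there is an $i$ with $F(l_i)=F(l_j)$ for all $j\ge i$; write $F\in ASNIS$ if $F$ is extensional and the same holds for every weakly convergent sequence $(l_m)$. Consider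 the principles - $\mathsf{IPP}$: $\forall n\ \forall f:\mathbb N\to[n]\ \exists c\in[n]\ [f^{-1}(c)\text{ is infinite}]$; - $\mathsf{FIPP}_2$: $\forall n\ \forall F\in AS\ \exists k\ \forall f:[k]\to[n]\ \exists l\in\mathrm{Seq}\ [A_l\subseteq[k]\ \wedge\ |A_l|>F(l)\ \wedge\ f|_{A_l}\text{ is constant}]$; - $\mathsf{FIPP}_3$: $\forall n\ \forall F\in ASNIS\ \exists k\ \forall f:[k]\to[n]\ \exists l\in\mathrm{Seq}\ \exists c\in[n]\ [A_l=f^{-1}(c)\ \wedge\ |A_l|>F(l)]$. Then: 1. $\mathsf{WKL}_0$ proves $\mathsf{IPP}\leftrightarrow\mathsf{FIPP}_2$. 2. $\mathsf{ACA}_0$ proves $\mathsf{IPP}\leftrightarrow\mathsf{FIPP}_3$. -/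

import Mathlib

/-!
Second order arithmetic: its two-sorted language, classical first order provability for this
language, the systems `RCA0`, `WKL0`, `ACA0`, and the infinite pigeonhole principle together with
two of its finitary versions, as sentences of the language.
-/

namespace SecondOrderArithmetic

/-! ### Terms and formulas

Bound and free variables are de Bruijn indices, separately for number and for set variables. -/

/-- Number terms. -/
inductive Tm : Type
  | var : ℕ → Tm
  | zero : Tm
  | one : Tm
  | add : Tm → Tm → Tm
  | mul : Tm → Tm → Tm

/-- Formulas: `allN` quantifies over numbers, `allS` over sets of numbers.
The other connectives and the existential quantifiers are defined classically. -/
inductive Fm : Type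
  | eq : Tm → Tm → Fm
  | lt : Tm → Tm → Fm
  | mem : Tm → ℕ → Fm
  | bot : Fm
  | imp : Fm → Fm → Fm
  | allN : Fm → Fm
  | allS : Fm → Fm

namespace Tm

/-- Simultaneous substitution. -/
def subst (σ : ℕ → Tm) : Tm → Tm
  | var i => σ i
  | zero => zero
  | one => one
  | add s t => add (s.subst σ) (t.subst σ)
  | mul s t => mul (s.subst σ) (t.subst σ)

/-- All variables are raised by one. -/
def shift (t : Tm) : Tm := t.subst (fun i => var (i + 1))

/-- The substitution `σ` under a number quantifier. -/
def up (σ : ℕ → Tm) : ℕ → Tm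
  | 0 => var 0
  | i + 1 => (σ i).shift

/-- The substitution that replaces the variable `0` by `t` and lowers all others by one. -/
def inst (t : Tm) : ℕ → Tm
  | 0 => t
  | i + 1 => var i

end Tm

/-- The renaming `ρ` of set variables under a set quantifier. -/
def upS (ρ : ℕ → ℕ) : ℕ → ℕ
  | 0 => 0
  | i + 1 => ρ i + 1

/-- The renaming that replaces the set variable `0` by `X` and lowers all others by one. -/
def instVarS (X : ℕ) : ℕ → ℕ
  | 0 => X
  | i + 1 => i

namespace Fm

/-- Simultaneous (capture avoiding) substitution of terms for number variables and of
set variables for set variables. -/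
def subst : Fm → (ℕ → Tm) → (ℕ → ℕ) → Fm
  | eq s t, σ, _ => eq (s.subst σ) (t.subst σ)
  | lt s t, σ, _ => lt (s.subst σ) (t.subst σ)
  | mem t X, σ, ρ => mem (t.subst σ) (ρ X)
  | bot, _, _ => bot
  | imp φ ψ, σ, ρ => imp (φ.subst σ ρ) (ψ.subst σ ρ)
  | allN φ, σ, ρ => allN (φ.subst (Tm.up σ) ρ)
  | allS φ, σ, ρ => allS (φ.subst σ (upS ρ))

/-- All number variables are raised by one. -/
def shiftN (φ : Fm) : Fm := φ.subst (fun i => Tm.var (i + 1)) id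

/-- All set variables are raised by one. -/
def shiftS (φ : Fm) : Fm := φ.subst Tm.var (fun i => i + 1)

/-- `φ(t)`, for the number variable `0` of `φ`. -/
def instN (φ : Fm) (t : Tm) : Fm := φ.subst (Tm.inst t) id

/-- `φ(X)`, for the set variable `0` of `φ`. -/
def instS (φ : Fm) (X : ℕ) : Fm := φ.subst Tm.var (instVarS X)

/-- `φ(n + 1)`, where `n` is the number variable `0` of `φ`. -/
def atSucc (φ : Fm) : Fm :=
  φ.subst (fun i => if i = 0 then Tm.add (Tm.var 0) Tm.one else Tm.var i) id

def neg (φ : Fm) : Fm := imp φ bot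
def and (φ ψ : Fm) : Fm := neg (imp φ (neg ψ))
def or (φ ψ : Fm) : Fm := imp (neg φ) ψ
def iff (φ ψ : Fm) : Fm := and (imp φ ψ) (imp ψ φ)
def exN (φ : Fm) : Fm := neg (allN (neg φ))
def exS (φ : Fm) : Fm := neg (allS (neg φ))

end Fm

/-! ### Provability -/

/-- Natural deduction for two-sorted classical first order logic with equality between numbers:
`φ` is derivable from the axioms `T` and the assumptions `Γ`. An axiom with free variables stands
for its universal closure. -/
inductive Derivation (T : Set Fm) : List Fm → Fm → Prop
  | axm {Γ : List Fm} {φ : Fm} : φ ∈ T → Derivation T Γ φ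
  | hyp {Γ : List Fm} {φ : Fm} : φ ∈ Γ → Derivation T Γ φ
  | impI {Γ : List Fm} {φ ψ : Fm} : Derivation T (φ :: Γ) ψ → Derivation T Γ (φ.imp ψ)
  | impE {Γ : List Fm} {φ ψ : Fm} :
      Derivation T Γ (φ.imp ψ) → Derivation T Γ φ → Derivation T Γ ψ
  | raa {Γ : List Fm} {φ : Fm} : Derivation T (φ.neg :: Γ) Fm.bot → Derivation T Γ φ
  | allNI {Γ : List Fm} {φ : Fm} :
      Derivation T (Γ.map Fm.shiftN) φ → Derivation T Γ φ.allN
  | allNE {Γ : List Fm} {φ : Fm} (t : Tm) :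
      Derivation T Γ φ.allN → Derivation T Γ (φ.instN t)
  | allSI {Γ : List Fm} {φ : Fm} :
      Derivation T (Γ.map Fm.shiftS) φ → Derivation T Γ φ.allS
  | allSE {Γ : List Fm} {φ : Fm} (X : ℕ) :
      Derivation T Γ φ.allS → Derivation T Γ (φ.instS X)
  | eqRefl {Γ : List Fm} (t : Tm) : Derivation T Γ (Fm.eq t t)
  | eqSubst {Γ : List Fm} {s t : Tm} (φ : Fm) :
      Derivation T Γ (Fm.eq s t) → Derivation T Γ (φ.instN s) → Derivation T Γ (φ.instN t)

/-- The theory with axioms `T` proves `φ`. -/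
def Proves (T : Set Fm) (φ : Fm) : Prop := Derivation T [] φ

/-! ### Writing formulas with Lean variables

`NumB`, `SetB` and `FmB` are terms, set variables and formulas that are waiting to be told under
how many number quantifiers (first argument of `FmB`) and set quantifiers (second argument) they
stand. A variable bound at depth `d` has the index `d' - 1 - d` at a place of depth `d'`, so that
`allN fun x => …` and `allS fun X => …` bind variables without explicit index shifts. -/

def NumB : Type := ℕ → Tm
def SetB : Type := ℕ → ℕ
def FmB : Type := ℕ → ℕ → Fm

instance : Zero NumB := ⟨fun _ => Tm.zero⟩
instance : One NumB := ⟨fun _ => Tm.one⟩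
instance : Add NumB := ⟨fun s t d => Tm.add (s d) (t d)⟩
instance : Mul NumB := ⟨fun s t d => Tm.mul (s d) (t d)⟩

namespace FmB

def eq (s t : NumB) : FmB := fun d _ => Fm.eq (s d) (t d)
def lt (s t : NumB) : FmB := fun d _ => Fm.lt (s d) (t d)
def mem (t : NumB) (X : SetB) : FmB := fun d e => Fm.mem (t d) (X e)
def neg (φ : FmB) : FmB := fun d e => (φ d e).neg
def imp (φ ψ : FmB) : FmB := fun d e => (φ d e).imp (ψ d e)
def and (φ ψ : FmB) : FmB := fun d e => (φ d e).and (ψ d e)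
def or (φ ψ : FmB) : FmB := fun d e => (φ d e).or (ψ d e)
def iff (φ ψ : FmB) : FmB := fun d e => (φ d e).iff (ψ d e)

end FmB

def allN (φ : NumB → FmB) : FmB :=
  fun d e => Fm.allN (φ (fun d' => Tm.var (d' - 1 - d)) (d + 1) e)
def exN (φ : NumB → FmB) : FmB :=
  fun d e => Fm.exN (φ (fun d' => Tm.var (d' - 1 - d)) (d + 1) e)
def allS (φ : SetB → FmB) : FmB :=
  fun d e => Fm.allS (φ (fun e' => e' - 1 - e) d (e + 1))
def exS (φ : SetB → FmB) : FmB :=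
  fun d e => Fm.exS (φ (fun e' => e' - 1 - e) d (e + 1))

/-- The closed formula given by `φ`. -/
def FmB.close (φ : FmB) : Fm := φ 0 0

infix:50 " =ₒ " => FmB.eq
infix:50 " <ₒ " => FmB.lt
infix:50 " ∈ₒ " => FmB.mem
infixr:35 " ∧ₒ " => FmB.and
infixr:30 " ∨ₒ " => FmB.or
infixr:25 " →ₒ " => FmB.imp
infix:20 " ↔ₒ " => FmB.iff

def FmB.le (s t : NumB) : FmB := s <ₒ t ∨ₒ s =ₒ t

infix:50 " ≤ₒ " => FmB.le

/-! ### The axiom systems -/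

/-- Formulas with bounded quantifiers only (`Σ⁰₀` formulas). -/
inductive IsBounded : Fm → Prop
  | eq (s t : Tm) : IsBounded (Fm.eq s t)
  | lt (s t : Tm) : IsBounded (Fm.lt s t)
  | mem (t : Tm) (X : ℕ) : IsBounded (Fm.mem t X)
  | bot : IsBounded Fm.bot
  | imp {φ ψ : Fm} : IsBounded φ → IsBounded ψ → IsBounded (φ.imp ψ)
  | ball (t : Tm) {φ : Fm} :
      IsBounded φ → IsBounded (Fm.allN ((Fm.lt (Tm.var 0) t.shift).imp φ))

/-- `Σ⁰₁` formulas. -/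
def IsSigma01 (φ : Fm) : Prop := ∃ θ, IsBounded θ ∧ φ = Fm.exN θ

/-- `Π⁰₁` formulas. -/
def IsPi01 (φ : Fm) : Prop := ∃ θ, IsBounded θ ∧ φ = Fm.allN θ

/-- Arithmetical formulas: no set quantifiers (set parameters are allowed). -/
inductive IsArithmetical : Fm → Prop
  | eq (s t : Tm) : IsArithmetical (Fm.eq s t)
  | lt (s t : Tm) : IsArithmetical (Fm.lt s t)
  | mem (t : Tm) (X : ℕ) : IsArithmetical (Fm.mem t X)
  | bot : IsArithmetical Fm.bot
  | imp {φ ψ : Fm} : IsArithmetical φ → IsArithmetical ψ → IsArithmetical (φ.imp ψ)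
  | allN {φ : Fm} : IsArithmetical φ → IsArithmetical φ.allN

/-- The basic axioms. -/
def basicAxioms : Set Fm :=
  { (allN fun n => (n + 1 =ₒ 0).neg).close,
    (allN fun m => allN fun n => m + 1 =ₒ n + 1 →ₒ m =ₒ n).close,
    (allN fun m => m + 0 =ₒ m).close,
    (allN fun m => allN fun n => m + (n + 1) =ₒ (m + n) + 1).close,
    (allN fun m => m * 0 =ₒ 0).close,
    (allN fun m => allN fun n => m * (n + 1) =ₒ m * n + m).close,
    (allN fun m => (m <ₒ 0).neg).close,
    (allN fun m => allN fun n => m <ₒ n + 1 ↔ₒ m <ₒ n ∨ₒ m =ₒ n).close }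

/-- Induction for `φ(n)`, where `n` is the number variable `0`. -/
def inductionFor (φ : Fm) : Fm :=
  ((φ.instN Tm.zero).and (φ.imp φ.atSucc).allN).imp φ.allN

/-- Comprehension for `φ(n)`, where `n` is the number variable `0`:
`∃ X, ∀ n, n ∈ X ↔ φ(n)`. The shift ensures that `X` is not free in `φ`. -/
def comprehensionFor (φ : Fm) : Fm :=
  Fm.exS (Fm.allN ((Fm.mem (Tm.var 0) 0).iff φ.shiftS))

/-- The induction axiom, for sets. -/
def inductionAxiom : Fm :=
  (allS fun X => 0 ∈ₒ X ∧ₒ (allN fun n => n ∈ₒ X →ₒ n + 1 ∈ₒ X) →ₒ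
    allN fun n => n ∈ₒ X).close

/-- `RCA₀`: basic axioms, `Σ⁰₁` induction and `Δ⁰₁` comprehension. -/
def RCA0 : Set Fm :=
  basicAxioms ∪ {χ | ∃ φ, IsSigma01 φ ∧ χ = inductionFor φ} ∪
    {χ | ∃ φ ψ, IsSigma01 φ ∧ IsPi01 ψ ∧ χ = ((φ.iff ψ).allN).imp (comprehensionFor φ)}

/-- `ACA₀`: basic axioms, the induction axiom and arithmetical comprehension. -/
def ACA0 : Set Fm :=
  basicAxioms ∪ {inductionAxiom} ∪ {χ | ∃ φ, IsArithmetical φ ∧ χ = comprehensionFor φ}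

/-! ### Coding -/

/-- The pairing function `(x, y) = (x + y)² + x`. -/
def pair (x y : NumB) : NumB := (x + y) * (x + y) + x

/-- `c` has the form `(k, (m, n))`. -/
def isTriple (c : NumB) : FmB :=
  exN fun k => exN fun m => exN fun n => c =ₒ pair k (pair m n)

/-- `i` belongs to the finite set given by `c = (k, (m, n))`:
`i < k` and `m (i + 1) + 1` divides `n`. -/
def inCode (i c : NumB) : FmB :=
  exN fun k => exN fun m => exN fun n => c =ₒ pair k (pair m n) ∧ₒ i <ₒ k ∧ₒ
    exN fun q => (m * (i + 1) + 1) * q =ₒ n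

/-- `c` is the code of a finite set, namely the least triple that gives this set. -/
def isSetCode (c : NumB) : FmB :=
  isTriple c ∧ₒ allN fun c' => c' <ₒ c →ₒ isTriple c' →ₒ
    (allN fun i => inCode i c' ↔ₒ inCode i c).neg

/-- `s(i) = x`, for the code `s` of a finite sequence (which is a finite set of pairs). -/
def entry (s i x : NumB) : FmB := inCode (pair i x) s

/-- `lh s = m`. -/
def lhEq (s m : NumB) : FmB := allN fun i => i <ₒ m ↔ₒ exN fun x => entry s i x

/-- `s ∈ Seq`: `s` is the code of a finite sequence. -/
def isSeq (s : NumB) : FmB :=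
  isSetCode s ∧ₒ
  (allN fun p => inCode p s →ₒ exN fun i => exN fun x => p =ₒ pair i x) ∧ₒ
  (allN fun i => allN fun x => allN fun y => entry s i x →ₒ entry s i y →ₒ x =ₒ y) ∧ₒ
  exN fun m => lhEq s m

/-- Definable classes of numbers. -/
abbrev Cls : Type := NumB → FmB

/-- The class of all numbers. -/
def univC : Cls := fun x => x =ₒ x

/-- `[n] = {j : j ≤ n}`. -/
def seg (n : NumB) : Cls := fun j => j ≤ₒ n

/-- `{j : j < m}`, that is, `[m - 1]`. -/
def below (m : NumB) : Cls := fun j => j <ₒ m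

/-- The members of a set. -/
def ofSet (X : SetB) : Cls := fun x => x ∈ₒ X

/-- `A_l = {l(i) : i < lh l}`. -/
def range (l : NumB) : Cls := fun x => exN fun i => entry l i x

def subC (A B : Cls) : FmB := allN fun x => A x →ₒ B x
def eqC (A B : Cls) : FmB := allN fun x => A x ↔ₒ B x
def interC (A B : Cls) : Cls := fun x => A x ∧ₒ B x

/-- `A` is finite, i.e., bounded. -/
def isFinite (A : Cls) : FmB := exN fun k => allN fun i => A i →ₒ i <ₒ k

def isInfinite (A : Cls) : FmB := (isFinite A).neg

/-- `f(x) = y`. -/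
def val (f : SetB) (x y : NumB) : FmB := pair x y ∈ₒ f

/-- `f : A → B`. -/
def isFun (A B : Cls) (f : SetB) : FmB :=
  (allN fun p => p ∈ₒ f →ₒ exN fun x => exN fun y => A x ∧ₒ B y ∧ₒ p =ₒ pair x y) ∧ₒ
  allN fun x => A x →ₒ exN fun y => val f x y ∧ₒ allN fun z => val f x z →ₒ z =ₒ y

/-- The color class `f⁻¹(c)`. -/
def fiber (f : SetB) (c : NumB) : Cls := fun x => val f x c

/-- `|A| = m`: there is a one-to-one function from `[m - 1]` onto `A`. -/
def cardEq (A : Cls) (m : NumB) : FmB :=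
  exS fun g => isFun (below m) A g ∧ₒ
    (allN fun x => allN fun y => allN fun z => val g x z →ₒ val g y z →ₒ x =ₒ y) ∧ₒ
    allN fun z => A z →ₒ exN fun x => val g x z

/-- `|A| > m`. -/
def cardGt (A : Cls) (m : NumB) : FmB := exN fun m' => cardEq A m' ∧ₒ m <ₒ m'

/-! ### Weak König's lemma -/

/-- `s` is the code of `⟨g(0), …, g(m - 1)⟩`. -/
def isInitial (g : SetB) (m s : NumB) : FmB :=
  isSeq s ∧ₒ lhEq s m ∧ₒ allN fun i => i <ₒ m →ₒ exN fun x => entry s i x ∧ₒ val g i x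

/-- `T` is a tree of finite sequences of zeros and ones. -/
def isBinaryTree (T : SetB) : FmB :=
  (allN fun s => s ∈ₒ T →ₒ isSeq s ∧ₒ subC (range s) (seg 1)) ∧ₒ
  allN fun s => allN fun t => s ∈ₒ T →ₒ isSeq t →ₒ
    (allN fun i => allN fun x => entry t i x →ₒ entry s i x) →ₒ t ∈ₒ T

/-- Weak König's lemma: every infinite binary tree has an infinite path. -/
def WKL : Fm :=
  (allS fun T => isBinaryTree T →ₒ isInfinite (ofSet T) →ₒ
    exS fun g => isFun univC (seg 1) g ∧ₒ
      allN fun m => exN fun s => isInitial g m s ∧ₒ s ∈ₒ T).close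

/-- `WKL₀`. -/
def WKL0 : Set Fm := RCA0 ∪ {WKL}

/-! ### The pigeonhole principles

Sequences `(l_m)` of numbers are functions `L : ℕ → ℕ`. -/

/-- `A_{l_m}`, for the sequence `L`. -/
def rangeAt (L : SetB) (m : NumB) : Cls := fun x => exN fun l => val L m l ∧ₒ range l x

/-- `L` is a sequence of elements of `Seq`. -/
def isSeqOfSeq (L : SetB) : FmB :=
  isFun univC univC L ∧ₒ allN fun m => allN fun l => val L m l →ₒ isSeq l

/-- `L` is a nested sequence with union. -/
def isNested (L : SetB) : FmB :=
  isSeqOfSeq L ∧ₒ (allN fun m => subC (rangeAt L m) (rangeAt L (m + 1))) ∧ₒ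
  exS fun U => allN fun x => x ∈ₒ U ↔ₒ exN fun m => rangeAt L m x

/-- `L` weakly converges to the infinite set `A`. -/
def weaklyConvTo (L A : SetB) : FmB :=
  isSeqOfSeq L ∧ₒ isInfinite (ofSet A) ∧ₒ
  allS fun B => isFinite (ofSet B) →ₒ exN fun i => allN fun j => i ≤ₒ j →ₒ
    eqC (interC (rangeAt L j) (ofSet B)) (interC (ofSet A) (ofSet B))

def weaklyConv (L : SetB) : FmB := exS fun A => weaklyConvTo L A

/-- `F` is extensional. -/
def extensional (F : SetB) : FmB :=
  allN fun l => allN fun l' => isSeq l →ₒ isSeq l' →ₒ eqC (range l) (range l') →ₒ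
    exN fun y => val F l y ∧ₒ val F l' y

/-- `∃ i, ∀ j ≥ i, F(l_i) = F(l_j)`. -/
def stabilizes (F L : SetB) : FmB :=
  exN fun i => allN fun j => i ≤ₒ j →ₒ exN fun a => exN fun b => exN fun y =>
    val L i a ∧ₒ val L j b ∧ₒ val F a y ∧ₒ val F b y

/-- `F` is asymptotically stable. -/
def inAS (F : SetB) : FmB :=
  isFun univC univC F ∧ₒ extensional F ∧ₒ allS fun L => isNested L →ₒ stabilizes F L

/-- `F` is asymptotically stable near infinite sets. -/
def inASNIS (F : SetB) : FmB :=
  isFun univC univC F ∧ₒ extensional F ∧ₒ allS fun L => weaklyConv L →ₒ stabilizes F L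

/-- `|A_l| > F(l)`. -/
def isBig (F : SetB) (l : NumB) : FmB := exN fun y => val F l y ∧ₒ cardGt (range l) y

/-- `f` is constant on `A`. -/
def constantOn (f : SetB) (A : Cls) : FmB :=
  allN fun x => allN fun y => A x →ₒ A y →ₒ exN fun c => val f x c ∧ₒ val f y c

/-- The infinite pigeonhole principle. -/
def IPP : Fm :=
  (allN fun n => allS fun f => isFun univC (seg n) f →ₒ
    exN fun c => c ≤ₒ n ∧ₒ exS fun A => eqC (ofSet A) (fiber f c) ∧ₒ isInfinite (ofSet A)).close

/-- The second finitary infinite pigeonhole principle. -/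
def FIPP2 : Fm :=
  (allN fun n => allS fun F => inAS F →ₒ exN fun k => allS fun f =>
    isFun (seg k) (seg n) f →ₒ exN fun l => isSeq l ∧ₒ
      subC (range l) (seg k) ∧ₒ isBig F l ∧ₒ constantOn f (range l)).close

/-- The third finitary infinite pigeonhole principle. -/
def FIPP3 : Fm :=
  (allN fun n => allS fun F => inASNIS F →ₒ exN fun k => allS fun f =>
    isFun (seg k) (seg n) f →ₒ exN fun l => isSeq l ∧ₒ
      exN fun c => c ≤ₒ n ∧ₒ eqC (range l) (fiber f c) ∧ₒ isBig F l).close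

end SecondOrderArithmetic

/-!
The proof is semantic. By the completeness theorem for the two-sorted calculus
(`completeness`, a Henkin construction), a sentence is provable from axioms `T` as soon as it holds
in every structure, possibly nonstandard, whose second sort consists of subsets of its first
sort and which satisfies `T`. A model of `RCA₀` is an ordered semiring, and its sets are closed
under recursive definitions. The classes `Rec` and `RecFun` express that a predicate or a function
is given by a set of the model; instances for connectives, bounded quantifiers, arithmetic and
composition derive this from the form of a definition. On this basis codes of finite sets and
sequences, enumerations and the finite pigeonhole principle are developed inside a model.

`FIPP₂ → IPP` (`satIPP_of_satFIPP2`): let all color classes be bounded. Let `F(l)` be a bound for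
`A_l` if `A_l` is homogeneous, and `0` otherwise. Along a nested sequence `F` is eventually
constant: if the union is homogeneous, it is bounded and so reached at some stage; if not, `F` is
eventually `0`. But a homogeneous set has no more elements than a bound for it.

`IPP → FIPP₂` (`satFIPP2_of_satIPP`): if there are counterexamples on all segments `[k]`, weak
König's lemma, applied to the tree of their characteristic functions, yields a coloring of all
numbers that is constant on no set `A_l` with more than `F(l)` elements
(`exists_coloring_of_satWKL`). By `IPP` it has an infinite color class; this is the union of its
finite parts, along which `F` is eventually constant, so that a sufficiently long part has more
than `F` elements (`exists_large_of_inAS`).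

In `ACA₀` both sides of the second equivalence are true. For `FIPP₃`, counterexamples on `[k]` have
an accumulation point, a coloring found as leftmost path (`exists_accumulation`). The color classes
of a subsequence of the counterexamples converge weakly to an infinite color class of the limit, and
again the eventual constancy of `F` makes one of them too large (`exists_not_counterexample`).
-/

namespace SecondOrderArithmetic

/-! ### Substitution -/

namespace Tm

theorem subst_subst (t : Tm) (σ τ : ℕ → Tm) :
    (t.subst σ).subst τ = t.subst (fun i => (σ i).subst τ) := by
  induction t with
  | var i => rfl
  | zero => rfl
  | one => rfl
  | add s t hs ht => simp only [subst, hs, ht]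
  | mul s t hs ht => simp only [subst, hs, ht]

theorem subst_var (t : Tm) : t.subst var = t := by
  induction t with
  | var i => rfl
  | zero => rfl
  | one => rfl
  | add s t hs ht => simp only [subst, hs, ht]
  | mul s t hs ht => simp only [subst, hs, ht]

theorem shift_subst_up (t : Tm) (σ : ℕ → Tm) : t.shift.subst (up σ) = (t.subst σ).shift := by
  simp only [shift, subst_subst]
  rfl

theorem up_var : up var = var := by
  funext i
  cases i <;> rfl

theorem up_subst_up (σ τ : ℕ → Tm) :
    (fun i => (up σ i).subst (up τ)) = up (fun i => (σ i).subst τ) := by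
  funext i
  cases i with
  | zero => rfl
  | succ i => exact shift_subst_up _ _

theorem shift_subst_inst (t s : Tm) : t.shift.subst (inst s) = t := by
  simp only [shift, subst_subst]
  exact subst_var t

/-- A term for the variable `0`, and the substitution `σ` for the remaining ones. -/
def cons (t : Tm) (σ : ℕ → Tm) : ℕ → Tm
  | 0 => t
  | i + 1 => σ i

theorem up_subst_inst (σ : ℕ → Tm) (t : Tm) :
    (fun i => (up σ i).subst (inst t)) = cons t σ := by
  funext i
  cases i with
  | zero => rfl
  | succ i => exact shift_subst_inst _ _

theorem inst_subst (σ : ℕ → Tm) (t : Tm) :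
    (fun i => (inst t i).subst σ) = cons (t.subst σ) σ := by
  funext i
  cases i <;> rfl

/-- Only finitely many variables occur in a term. -/
theorem exists_bound (t : Tm) :
    ∃ N, ∀ σ τ : ℕ → Tm, (∀ i < N, σ i = τ i) → t.subst σ = t.subst τ := by
  induction t with
  | var i => exact ⟨i + 1, fun σ τ h => h i (Nat.lt_succ_self i)⟩
  | zero => exact ⟨0, fun _ _ _ => rfl⟩
  | one => exact ⟨0, fun _ _ _ => rfl⟩
  | add s t hs ht =>
    obtain ⟨N, hN⟩ := hs
    obtain ⟨K, hK⟩ := ht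
    exact ⟨max N K, fun σ τ h => congrArg₂ add
      (hN σ τ fun i hi => h i (lt_max_of_lt_left hi))
      (hK σ τ fun i hi => h i (lt_max_of_lt_right hi))⟩
  | mul s t hs ht =>
    obtain ⟨N, hN⟩ := hs
    obtain ⟨K, hK⟩ := ht
    exact ⟨max N K, fun σ τ h => congrArg₂ mul
      (hN σ τ fun i hi => h i (lt_max_of_lt_left hi))
      (hK σ τ fun i hi => h i (lt_max_of_lt_right hi))⟩

end Tm

theorem upS_comp (ρ π : ℕ → ℕ) : upS π ∘ upS ρ = upS (π ∘ ρ) := by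
  funext i
  cases i <;> rfl

theorem upS_id : upS id = id := by
  funext i
  cases i <;> rfl

/-- A set variable for the variable `0`, and the renaming `ρ` for the remaining ones. -/
def consS (X : ℕ) (ρ : ℕ → ℕ) : ℕ → ℕ
  | 0 => X
  | i + 1 => ρ i

theorem instVarS_comp_upS (ρ : ℕ → ℕ) (X : ℕ) : instVarS X ∘ upS ρ = consS X ρ := by
  funext i
  cases i <;> rfl

theorem comp_instVarS (ρ : ℕ → ℕ) (X : ℕ) : ρ ∘ instVarS X = consS (ρ X) ρ := by
  funext i
  cases i <;> rfl

namespace Fm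

theorem subst_subst (φ : Fm) (σ τ : ℕ → Tm) (ρ π : ℕ → ℕ) :
    (φ.subst σ ρ).subst τ π = φ.subst (fun i => (σ i).subst τ) (π ∘ ρ) := by
  induction φ generalizing σ τ ρ π with
  | eq s t => simp only [subst, Tm.subst_subst]
  | lt s t => simp only [subst, Tm.subst_subst]
  | mem t X => simp only [subst, Tm.subst_subst, Function.comp]
  | bot => rfl
  | imp φ ψ hφ hψ => simp only [subst, hφ, hψ]
  | allN φ h => simp only [subst, h, Tm.up_subst_up]
  | allS φ h => simp only [subst, h, upS_comp]

theorem subst_var (φ : Fm) : φ.subst Tm.var id = φ := by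
  induction φ with
  | eq s t => simp only [subst, Tm.subst_var]
  | lt s t => simp only [subst, Tm.subst_var]
  | mem t X => simp only [subst, Tm.subst_var, id]
  | bot => rfl
  | imp φ ψ hφ hψ => simp only [subst, hφ, hψ]
  | allN φ h => simp only [subst, h, Tm.up_var]
  | allS φ h => simp only [subst, h, upS_id]

theorem shiftN_subst_up (φ : Fm) (σ : ℕ → Tm) (ρ : ℕ → ℕ) :
    φ.shiftN.subst (Tm.up σ) ρ = (φ.subst σ ρ).shiftN := by
  simp only [shiftN, subst_subst]
  rfl

theorem shiftS_subst_upS (φ : Fm) (σ : ℕ → Tm) (ρ : ℕ → ℕ) :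
    φ.shiftS.subst σ (upS ρ) = (φ.subst σ ρ).shiftS := by
  simp only [shiftS, subst_subst, Tm.subst_var]
  rfl

theorem subst_up_instN (φ : Fm) (σ : ℕ → Tm) (ρ : ℕ → ℕ) (t : Tm) :
    (φ.subst (Tm.up σ) ρ).instN t = φ.subst (Tm.cons t σ) ρ := by
  simp only [instN, subst_subst, Tm.up_subst_inst]
  rfl

theorem instN_subst (φ : Fm) (σ : ℕ → Tm) (ρ : ℕ → ℕ) (t : Tm) :
    (φ.instN t).subst σ ρ = φ.subst (Tm.cons (t.subst σ) σ) ρ := by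
  simp only [instN, subst_subst, Tm.inst_subst]
  rfl

theorem subst_upS_instS (φ : Fm) (σ : ℕ → Tm) (ρ : ℕ → ℕ) (X : ℕ) :
    (φ.subst σ (upS ρ)).instS X = φ.subst σ (consS X ρ) := by
  simp only [instS, subst_subst, Tm.subst_var, instVarS_comp_upS]

theorem instS_subst (φ : Fm) (σ : ℕ → Tm) (ρ : ℕ → ℕ) (X : ℕ) :
    (φ.instS X).subst σ ρ = φ.subst σ (consS (ρ X) ρ) := by
  simp only [instS, subst_subst, comp_instVarS]
  rfl

/-- Only finitely many variables are free in a formula. -/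
theorem exists_bound (φ : Fm) :
    ∃ N, ∀ (σ τ : ℕ → Tm) (ρ π : ℕ → ℕ), (∀ i < N, σ i = τ i) → (∀ i < N, ρ i = π i) →
      φ.subst σ ρ = φ.subst τ π := by
  induction φ with
  | eq s t =>
    obtain ⟨N, hN⟩ := s.exists_bound
    obtain ⟨K, hK⟩ := t.exists_bound
    exact ⟨max N K, fun σ τ _ _ h _ => congrArg₂ eq
      (hN σ τ fun i hi => h i (lt_max_of_lt_left hi))
      (hK σ τ fun i hi => h i (lt_max_of_lt_right hi))⟩
  | lt s t =>
    obtain ⟨N, hN⟩ := s.exists_bound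
    obtain ⟨K, hK⟩ := t.exists_bound
    exact ⟨max N K, fun σ τ _ _ h _ => congrArg₂ lt
      (hN σ τ fun i hi => h i (lt_max_of_lt_left hi))
      (hK σ τ fun i hi => h i (lt_max_of_lt_right hi))⟩
  | mem t X =>
    obtain ⟨N, hN⟩ := t.exists_bound
    exact ⟨max N (X + 1), fun σ τ _ _ h h' => congrArg₂ mem
      (hN σ τ fun i hi => h i (lt_max_of_lt_left hi))
      (h' X (lt_max_of_lt_right (Nat.lt_succ_self X)))⟩
  | bot => exact ⟨0, fun _ _ _ _ _ _ => rfl⟩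
  | imp φ ψ hφ hψ =>
    obtain ⟨N, hN⟩ := hφ
    obtain ⟨K, hK⟩ := hψ
    exact ⟨max N K, fun σ τ ρ π h h' => congrArg₂ imp
      (hN σ τ ρ π (fun i hi => h i (lt_max_of_lt_left hi))
        fun i hi => h' i (lt_max_of_lt_left hi))
      (hK σ τ ρ π (fun i hi => h i (lt_max_of_lt_right hi))
        fun i hi => h' i (lt_max_of_lt_right hi))⟩
  | allN φ hφ =>
    obtain ⟨N, hN⟩ := hφ
    refine ⟨N, fun σ τ ρ π h h' => congrArg allN (hN _ _ _ _ (fun i hi => ?_) h')⟩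
    cases i with
    | zero => rfl
    | succ i => exact congrArg Tm.shift (h i (Nat.lt_of_succ_lt hi))
  | allS φ hφ =>
    obtain ⟨N, hN⟩ := hφ
    refine ⟨N, fun σ τ ρ π h h' => congrArg allS (hN _ _ _ _ h fun i hi => ?_)⟩
    cases i with
    | zero => rfl
    | succ i => exact congrArg Nat.succ (h' i (Nat.lt_of_succ_lt hi))

end Fm

/-! ### Derivations -/

namespace Derivation

variable {T : Set Fm} {Γ Δ : List Fm} {φ ψ : Fm}

theorem weaken (h : Derivation T Γ φ) : ∀ {Δ}, Γ ⊆ Δ → Derivation T Δ φ := by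
  induction h with
  | axm h => exact fun _ => axm h
  | hyp h => exact fun hs => hyp (hs h)
  | impI _ ih => exact fun hs => impI (ih (List.cons_subset_cons _ hs))
  | impE _ _ ih₁ ih₂ => exact fun hs => impE (ih₁ hs) (ih₂ hs)
  | raa _ ih => exact fun hs => raa (ih (List.cons_subset_cons _ hs))
  | allNI _ ih => exact fun hs => allNI (ih (List.map_subset _ hs))
  | allNE t _ ih => exact fun hs => allNE t (ih hs)
  | allSI _ ih => exact fun hs => allSI (ih (List.map_subset _ hs))
  | allSE X _ ih => exact fun hs => allSE X (ih hs)
  | eqRefl t => exact fun _ => eqRefl t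
  | eqSubst φ _ _ ih₁ ih₂ => exact fun hs => eqSubst φ (ih₁ hs) (ih₂ hs)

/-- Alternating generalization and instantiation `N` times replaces the first `N` number variables
of a derivable formula, and lowers the remaining ones by `N`. -/
theorem subst_numbers_aux (N : ℕ) : ∀ (φ : Fm), (∀ Γ, Derivation T Γ φ) → ∀ (σ : ℕ → Tm) (Γ),
    Derivation T Γ (φ.subst (fun i => if i < N then σ i else Tm.var (i - N)) id) := by
  induction N with
  | zero =>
    intro φ h σ Γ
    have : (fun i => if i < 0 then σ i else Tm.var (i - 0)) = Tm.var := by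
      funext i
      simp
    rw [this, Fm.subst_var]
    exact h Γ
  | succ N ih =>
    intro φ h σ Γ
    have := allNE (σ 0) (ih φ.allN (fun Γ => allNI (h _)) (fun i => σ (i + 1)) Γ)
    rw [Fm.subst_up_instN] at this
    convert this using 2
    funext i
    cases i with
    | zero => rfl
    | succ i => simp [Tm.cons]

/-- The analogue of `subst_numbers_aux` for set variables. -/
theorem subst_sets_aux (N : ℕ) : ∀ (φ : Fm), (∀ Γ, Derivation T Γ φ) → ∀ (ρ : ℕ → ℕ) (Γ),
    Derivation T Γ (φ.subst Tm.var (fun i => if i < N then ρ i else i - N)) := by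
  induction N with
  | zero =>
    intro φ h σ Γ
    have : (fun i => if i < 0 then σ i else i - 0) = id := by
      funext i
      simp
    rw [this, Fm.subst_var]
    exact h Γ
  | succ N ih =>
    intro φ h ρ Γ
    have := allSE (ρ 0) (ih φ.allS (fun Γ => allSI (h _)) (fun i => ρ (i + 1)) Γ)
    rw [Fm.subst_upS_instS] at this
    convert this using 2
    funext i
    cases i with
    | zero => rfl
    | succ i => simp [consS]

/-- Axioms stand for their universal closures, so all their substitution instances follow. -/
theorem subst_axm (h : φ ∈ T) (σ : ℕ → Tm) (ρ : ℕ → ℕ) : Derivation T Γ (φ.subst σ ρ) := by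
  obtain ⟨N, hN⟩ := φ.exists_bound
  have h₁ : ∀ Γ, Derivation T Γ (φ.subst σ id) := fun Γ => by
    have := subst_numbers_aux N φ (fun Γ => axm h) σ Γ
    rwa [hN _ σ _ id (fun i hi => if_pos hi) fun _ _ => rfl] at this
  obtain ⟨K, hK⟩ := (φ.subst σ id).exists_bound
  have h₂ := subst_sets_aux K _ h₁ ρ Γ
  rw [hK _ Tm.var _ ρ (fun _ _ => rfl) fun i hi => if_pos hi, Fm.subst_subst] at h₂
  simp only [Tm.subst_var] at h₂
  exact h₂

theorem subst (h : Derivation T Γ φ) : ∀ (σ : ℕ → Tm) (ρ : ℕ → ℕ),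
    Derivation T (Γ.map fun ψ => ψ.subst σ ρ) (φ.subst σ ρ) := by
  induction h with
  | axm h => exact fun σ ρ => subst_axm h σ ρ
  | hyp h => exact fun σ ρ => hyp (List.mem_map_of_mem h)
  | impI _ ih => exact fun σ ρ => impI (ih σ ρ)
  | impE _ _ ih₁ ih₂ => exact fun σ ρ => impE (ih₁ σ ρ) (ih₂ σ ρ)
  | raa _ ih => exact fun σ ρ => raa (ih σ ρ)
  | @allNI Γ φ _ ih =>
    refine fun σ ρ => allNI ?_
    have := ih (Tm.up σ) ρ
    simp only [List.map_map, Function.comp_def, Fm.shiftN_subst_up] at this ⊢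
    exact this
  | allNE t _ ih =>
    intro σ ρ
    have := allNE (t.subst σ) (ih σ ρ)
    rwa [Fm.subst_up_instN, ← Fm.instN_subst] at this
  | @allSI Γ φ _ ih =>
    refine fun σ ρ => allSI ?_
    have := ih σ (upS ρ)
    simp only [List.map_map, Function.comp_def, Fm.shiftS_subst_upS] at this ⊢
    exact this
  | allSE X _ ih =>
    intro σ ρ
    have := allSE (ρ X) (ih σ ρ)
    rwa [Fm.subst_upS_instS, ← Fm.instS_subst] at this
  | eqRefl t => exact fun σ ρ => eqRefl _
  | eqSubst φ _ _ ih₁ ih₂ =>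
    intro σ ρ
    have h₂ := ih₂ σ ρ
    rw [Fm.instN_subst, ← Fm.subst_up_instN] at h₂ ⊢
    exact eqSubst _ (ih₁ σ ρ) h₂

/-- Generalization on a number variable that is not free in the assumptions. -/
theorem allNI_of_fresh (x : ℕ) (hΓ : ∀ ψ ∈ Γ, ∀ σ τ : ℕ → Tm, (∀ i < x, σ i = τ i) →
      ψ.subst σ id = ψ.subst τ id)
    (hφ : ∀ σ τ : ℕ → Tm, (∀ i < x, σ i = τ i) → φ.allN.subst σ id = φ.allN.subst τ id)
    (h : Derivation T Γ (φ.instN (Tm.var x))) : Derivation T Γ φ.allN := by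
  -- Rename `x` to `0` and every other variable `i` to `i + 1`.
  let σ : ℕ → Tm := fun i => if i = x then Tm.var 0 else Tm.var (i + 1)
  have hσ : ∀ i < x, Tm.var (i + 1) = σ i := fun i hi => by simp [σ, hi.ne]
  have h' := h.subst σ id
  rw [Fm.instN_subst] at h'
  have e₁ : φ.subst (Tm.cons ((Tm.var x).subst σ) σ) id = φ := by
    -- `φ.allN` does not depend on `x`, and both sides instantiate it at the variable `0`.
    have h₂ := hφ (fun i => Tm.var (i + 1)) σ hσ
    simp only [Fm.subst] at h₂
    injection h₂ with h₂
    have h₃ := congrArg (fun χ => Fm.instN χ (Tm.var 0)) h₂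
    simp only [Fm.subst_up_instN] at h₃
    have e : (Tm.var x).subst σ = Tm.var 0 := by simp [Tm.subst, σ]
    rw [e, ← h₃]
    have : Tm.cons (Tm.var 0) (fun i => Tm.var (i + 1)) = Tm.var := by
      funext i
      cases i <;> rfl
    rw [this, Fm.subst_var]
  rw [e₁] at h'
  refine allNI (h'.weaken fun χ hχ => ?_)
  obtain ⟨ψ, hψ, rfl⟩ := List.mem_map.1 hχ
  exact List.mem_map.2 ⟨ψ, hψ, hΓ ψ hψ _ _ hσ⟩

/-- Generalization on a set variable that is not free in the assumptions. -/
theorem allSI_of_fresh (x : ℕ) (hΓ : ∀ ψ ∈ Γ, ∀ ρ π : ℕ → ℕ, (∀ i < x, ρ i = π i) →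
      ψ.subst Tm.var ρ = ψ.subst Tm.var π)
    (hφ : ∀ ρ π : ℕ → ℕ, (∀ i < x, ρ i = π i) →
      φ.allS.subst Tm.var ρ = φ.allS.subst Tm.var π)
    (h : Derivation T Γ (φ.instS x)) : Derivation T Γ φ.allS := by
  let ρ : ℕ → ℕ := fun i => if i = x then 0 else i + 1
  have hρ : ∀ i < x, i + 1 = ρ i := fun i hi => by simp [ρ, hi.ne]
  have h' := h.subst Tm.var ρ
  rw [Fm.instS_subst] at h'
  have e₁ : φ.subst Tm.var (consS (ρ x) ρ) = φ := by
    have h₂ := hφ (fun i => i + 1) ρ hρ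
    simp only [Fm.subst] at h₂
    injection h₂ with h₂
    have h₃ := congrArg (fun χ => Fm.instS χ 0) h₂
    simp only [Fm.subst_upS_instS] at h₃
    have e : ρ x = 0 := by simp [ρ]
    rw [e, ← h₃]
    have : consS 0 (fun i => i + 1) = id := by
      funext i
      cases i <;> rfl
    rw [this, Fm.subst_var]
  rw [e₁] at h'
  refine allSI (h'.weaken fun χ hχ => ?_)
  obtain ⟨ψ, hψ, rfl⟩ := List.mem_map.1 hχ
  exact List.mem_map.2 ⟨ψ, hψ, hΓ ψ hψ _ _ hρ⟩

theorem botE (h : Derivation T Γ Fm.bot) : Derivation T Γ φ :=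
  raa (h.weaken (List.subset_cons_self _ _))

end Derivation

end SecondOrderArithmetic

namespace SecondOrderArithmetic

/-! ### Semantics -/

section Semantics

variable {M : Type} [Zero M] [One M] [Add M] [Mul M]

/-- The value of a term under an assignment of the variables. -/
def Tm.val (e : ℕ → M) : Tm → M
  | var i => e i
  | zero => 0
  | one => 1
  | add s t => s.val e + t.val e
  | mul s t => s.val e * t.val e

/-- An element for the variable `0`, and the assignment `e` for the remaining ones. -/
def push {A : Type} (a : A) (e : ℕ → A) : ℕ → A
  | 0 => a
  | i + 1 => e i

theorem Tm.val_subst (e : ℕ → M) (σ : ℕ → Tm) (t : Tm) :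
    (t.subst σ).val e = t.val fun i => (σ i).val e := by
  induction t with
  | var i => rfl
  | zero => rfl
  | one => rfl
  | add s t hs ht => simp only [subst, val, hs, ht]
  | mul s t hs ht => simp only [subst, val, hs, ht]

theorem Tm.val_shift (e : ℕ → M) (a : M) (t : Tm) : t.shift.val (push a e) = t.val e :=
  Tm.val_subst _ _ t

variable [LT M]

/-- Truth of a formula in the structure with numbers `M` and sets `𝒮`, under an assignment `e` of
the number variables and an assignment `s` of the set variables. -/
def Fm.Holds (𝒮 : Set (Set M)) : Fm → (ℕ → M) → (ℕ → Set M) → Prop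
  | eq t u, e, _ => t.val e = u.val e
  | lt t u, e, _ => t.val e < u.val e
  | mem t X, e, s => t.val e ∈ s X
  | bot, _, _ => False
  | imp φ ψ, e, s => φ.Holds 𝒮 e s → ψ.Holds 𝒮 e s
  | allN φ, e, s => ∀ a, φ.Holds 𝒮 (push a e) s
  | allS φ, e, s => ∀ A ∈ 𝒮, φ.Holds 𝒮 e (push A s)

theorem Fm.holds_subst {𝒮 : Set (Set M)} (φ : Fm) (σ : ℕ → Tm) (ρ : ℕ → ℕ) (e : ℕ → M)
    (s : ℕ → Set M) : (φ.subst σ ρ).Holds 𝒮 e s ↔ φ.Holds 𝒮 (fun i => (σ i).val e) (s ∘ ρ) := by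
  induction φ generalizing σ ρ e s with
  | eq t u => simp only [subst, Holds, Tm.val_subst]
  | lt t u => simp only [subst, Holds, Tm.val_subst]
  | mem t X => simp only [subst, Holds, Tm.val_subst, Function.comp]
  | bot => rfl
  | imp φ ψ hφ hψ => simp only [subst, Holds, hφ, hψ]
  | allN φ h =>
    simp only [subst, Holds, h]
    refine forall_congr' fun a => ?_
    have : (fun i => (Tm.up σ i).val (push a e)) = push a fun i => (σ i).val e := by
      funext i
      cases i with
      | zero => rfl
      | succ i => exact Tm.val_shift _ _ _
    rw [this]
  | allS φ h =>
    simp only [subst, Holds, h]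
    refine forall_congr' fun A => forall_congr' fun _ => ?_
    have : push A s ∘ upS ρ = push A (s ∘ ρ) := by
      funext i
      cases i <;> rfl
    rw [this]

end Semantics

/-! ### Completeness -/

/-- An injective code of terms by natural numbers. -/
def Tm.code : Tm → ℕ
  | var i => Nat.pair 0 i
  | zero => Nat.pair 1 0
  | one => Nat.pair 2 0
  | add s t => Nat.pair 3 (Nat.pair s.code t.code)
  | mul s t => Nat.pair 4 (Nat.pair s.code t.code)

theorem Tm.code_injective : Function.Injective Tm.code := by
  intro s
  induction s with
  | var i => intro t h; cases t <;> simp_all [code]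
  | zero => intro t h; cases t <;> simp_all [code]
  | one => intro t h; cases t <;> simp_all [code]
  | add a b ha hb =>
    intro t h
    cases t <;> simp [code] at h
    rw [ha h.1, hb h.2]
  | mul a b ha hb =>
    intro t h
    cases t <;> simp [code] at h
    rw [ha h.1, hb h.2]

/-- An injective code of formulas by natural numbers. -/
def Fm.code : Fm → ℕ
  | eq s t => Nat.pair 0 (Nat.pair s.code t.code)
  | lt s t => Nat.pair 1 (Nat.pair s.code t.code)
  | mem t X => Nat.pair 2 (Nat.pair t.code X)
  | bot => Nat.pair 3 0
  | imp φ ψ => Nat.pair 4 (Nat.pair φ.code ψ.code)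
  | allN φ => Nat.pair 5 φ.code
  | allS φ => Nat.pair 6 φ.code

theorem Fm.code_injective : Function.Injective Fm.code := by
  intro φ
  induction φ with
  | eq s t =>
    intro χ h
    cases χ <;> simp_all [code]
    exact ⟨Tm.code_injective h.1, Tm.code_injective h.2⟩
  | lt s t =>
    intro χ h
    cases χ <;> simp_all [code]
    exact ⟨Tm.code_injective h.1, Tm.code_injective h.2⟩
  | mem t X =>
    intro χ h
    cases χ <;> simp_all [code]
    exact Tm.code_injective h.1
  | bot => intro χ h; cases χ <;> simp_all [code]
  | imp φ ψ hφ hψ =>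
    intro χ h
    cases χ <;> simp [code] at h
    rw [hφ h.1, hψ h.2]
  | allN φ hφ => intro χ h; cases χ <;> simp [code] at h; rw [hφ h]
  | allS φ hφ => intro χ h; cases χ <;> simp [code] at h; rw [hφ h]

section Henkin

variable {T : Set Fm}

instance : Inhabited Fm := ⟨Fm.bot⟩

/-- `Γ` is consistent with the axioms `T`. -/
def Con (T : Set Fm) (Γ : List Fm) : Prop := ¬ Derivation T Γ Fm.bot

theorem not_con_cons {Γ : List Fm} {φ : Fm} (h : ¬ Con T (φ :: Γ)) : Derivation T Γ φ.neg :=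
  Derivation.impI (not_not.1 h)

theorem con_cons_neg {Γ : List Fm} {φ : Fm} (h : ¬ Derivation T Γ φ) : Con T (φ.neg :: Γ) :=
  fun h' => h (Derivation.raa h')

/-- A common bound for the variables that are free in one of finitely many formulas. -/
theorem exists_bound_list (Γ : List Fm) :
    ∃ N, ∀ φ ∈ Γ, ∀ (σ τ : ℕ → Tm) (ρ π : ℕ → ℕ), (∀ i < N, σ i = τ i) →
      (∀ i < N, ρ i = π i) → φ.subst σ ρ = φ.subst τ π := by
  induction Γ with
  | nil => exact ⟨0, by simp⟩
  | cons φ Γ ih =>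
    obtain ⟨N, hN⟩ := ih
    obtain ⟨K, hK⟩ := φ.exists_bound
    refine ⟨max N K, fun ψ hψ σ τ ρ π h h' => ?_⟩
    rcases List.mem_cons.1 hψ with rfl | hψ
    · exact hK _ _ _ _ (fun i hi => h i (lt_max_of_lt_right hi))
        fun i hi => h' i (lt_max_of_lt_right hi)
    · exact hN _ hψ _ _ _ _ (fun i hi => h i (lt_max_of_lt_left hi))
        fun i hi => h' i (lt_max_of_lt_left hi)

/-- A finite consistent list can be extended so as to decide `ψ`; if `ψ` is a negated universal
formula that gets accepted, then a fresh variable serves as a counterexample. -/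
theorem henkin_step {Γ : List Fm} (hΓ : Con T Γ) (ψ : Fm) :
    ∃ Δ, Γ ⊆ Δ ∧ Con T Δ ∧ (ψ ∈ Δ ∨ ψ.neg ∈ Δ) ∧
      (∀ θ : Fm, ψ = θ.allN.neg → ψ ∈ Δ → ψ.neg ∈ Δ ∨ ∃ x, (θ.instN (Tm.var x)).neg ∈ Δ) ∧
      (∀ θ : Fm, ψ = θ.allS.neg → ψ ∈ Δ → ψ.neg ∈ Δ ∨ ∃ x, (θ.instS x).neg ∈ Δ) := by
  by_cases h : Con T (ψ :: Γ)
  · by_cases h₁ : ∃ θ : Fm, ψ = θ.allN.neg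
    · obtain ⟨θ, rfl⟩ := h₁
      obtain ⟨x, hx⟩ := exists_bound_list (θ.allN :: θ.allN.neg :: Γ)
      refine ⟨(θ.instN (Tm.var x)).neg :: θ.allN.neg :: Γ, by simp, con_cons_neg fun h' => h ?_,
        by simp, fun θ' h' _ => Or.inr ⟨x, ?_⟩, fun θ' h' _ => ?_⟩
      · have := Derivation.allNI_of_fresh x
          (fun ψ hψ σ τ h => hx ψ (List.mem_cons_of_mem _ hψ) σ τ _ _ h fun _ _ => rfl)
          (fun σ τ h => hx _ List.mem_cons_self σ τ _ _ h fun _ _ => rfl) h'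
        exact Derivation.impE (Derivation.hyp List.mem_cons_self) this
      · cases h'
        simp
      · cases h'
    · by_cases h₂ : ∃ θ : Fm, ψ = θ.allS.neg
      · obtain ⟨θ, rfl⟩ := h₂
        obtain ⟨x, hx⟩ := exists_bound_list (θ.allS :: θ.allS.neg :: Γ)
        refine ⟨(θ.instS x).neg :: θ.allS.neg :: Γ, by simp, con_cons_neg fun h' => h ?_,
          by simp, fun θ' h' _ => ?_, fun θ' h' _ => Or.inr ⟨x, ?_⟩⟩
        · have := Derivation.allSI_of_fresh x
            (fun ψ hψ ρ π h => hx ψ (List.mem_cons_of_mem _ hψ) _ _ ρ π (fun _ _ => rfl) h)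
            (fun ρ π h => hx _ List.mem_cons_self _ _ ρ π (fun _ _ => rfl) h) h'
          exact Derivation.impE (Derivation.hyp List.mem_cons_self) this
        · cases h'
        · cases h'
          simp
      · exact ⟨ψ :: Γ, by simp, h, by simp, fun θ h' => absurd ⟨θ, h'⟩ h₁,
          fun θ h' => absurd ⟨θ, h'⟩ h₂⟩
  · have h' := not_con_cons h
    refine ⟨ψ.neg :: Γ, by simp, fun h₁ => hΓ ?_, by simp, fun θ _ _ => by simp,
      fun θ _ _ => by simp⟩
    exact Derivation.impE (Derivation.impI h₁) h'

/-- A maximal consistent set of formulas, with variables as counterexamples to all universal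
formulas that it refutes. -/
structure IsHenkin (T : Set Fm) (H : Set Fm) : Prop where
  closed : ∀ {Γ : List Fm} {φ : Fm}, (∀ ψ ∈ Γ, ψ ∈ H) → Derivation T Γ φ → φ ∈ H
  bot : Fm.bot ∉ H
  decides : ∀ φ : Fm, φ ∈ H ∨ φ.neg ∈ H
  number : ∀ φ : Fm, φ.allN.neg ∈ H → ∃ x, (φ.instN (Tm.var x)).neg ∈ H
  set : ∀ φ : Fm, φ.allS.neg ∈ H → ∃ x, (φ.instS x).neg ∈ H

/-- Lindenbaum's lemma. -/
theorem exists_isHenkin {Γ : List Fm} (hΓ : Con T Γ) :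
    ∃ H : Set Fm, IsHenkin T H ∧ ∀ φ ∈ Γ, φ ∈ H := by
  choose next h₁ h₂ h₃ h₄ h₅ using fun (Δ : {Δ : List Fm // Con T Δ}) => henkin_step Δ.2
  let dec : ℕ → Fm := Function.invFun Fm.code
  have hdec : ∀ ψ, dec ψ.code = ψ := Function.leftInverse_invFun Fm.code_injective
  obtain ⟨L, hL₀, hL⟩ : ∃ L : ℕ → {Δ : List Fm // Con T Δ},
      (L 0).1 = Γ ∧ ∀ n, (L (n + 1)).1 = next (L n) (dec n) :=
    ⟨fun n => Nat.rec ⟨Γ, hΓ⟩ (fun n Δ => ⟨next Δ (dec n), h₂ Δ (dec n)⟩) n, rfl, fun _ => rfl⟩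
  have hmono : ∀ {m n}, m ≤ n → (L m).1 ⊆ (L n).1 := by
    intro m n h
    induction h with
    | refl => exact fun _ => id
    | step _ ih => exact fun _ hx => (hL _).symm ▸ h₁ _ _ (ih hx)
  have hfin : ∀ Δ : List Fm, (∀ ψ ∈ Δ, ∃ n, ψ ∈ (L n).1) → ∃ n, Δ ⊆ (L n).1 := by
    intro Δ
    induction Δ with
    | nil => exact fun _ => ⟨0, by simp⟩
    | cons ψ Δ ih =>
      intro h
      obtain ⟨n, hn⟩ := ih fun χ hχ => h χ (List.mem_cons_of_mem _ hχ)
      obtain ⟨m, hm⟩ := h ψ List.mem_cons_self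
      refine ⟨max m n, List.cons_subset.2 ⟨hmono (le_max_left _ _) hm, fun χ hχ =>
        hmono (le_max_right _ _) (hn hχ)⟩⟩
  have hcon : ∀ Δ : List Fm, (∀ ψ ∈ Δ, ∃ n, ψ ∈ (L n).1) → Con T Δ := fun Δ h => by
    obtain ⟨n, hn⟩ := hfin Δ h
    exact fun h' => (L n).2 (h'.weaken hn)
  have hneg : ∀ ψ : Fm, (∃ n, ψ ∈ (L n).1) → (∃ n, ψ.neg ∈ (L n).1) → False := by
    intro ψ h h'
    refine hcon [ψ, ψ.neg] (by simpa using ⟨h, h'⟩) ?_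
    exact Derivation.impE (Derivation.hyp (by simp) : Derivation T _ ψ.neg)
      (Derivation.hyp (by simp))
  have hdecides : ∀ ψ : Fm, ψ ∈ (L (ψ.code + 1)).1 ∨ ψ.neg ∈ (L (ψ.code + 1)).1 := fun ψ => by
    have := h₃ (L ψ.code) (dec ψ.code)
    rwa [← hL, hdec] at this
  refine ⟨{φ | ∃ n, φ ∈ (L n).1}, ⟨?_, ?_, ?_, ?_, ?_⟩, fun φ hφ => ⟨0, hL₀.symm ▸ hφ⟩⟩
  · intro Δ φ hΔ hφ
    rcases hdecides φ with h | h
    · exact ⟨_, h⟩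
    · refine absurd (Derivation.impE (Derivation.hyp (by simp) : Derivation T (φ.neg :: Δ) φ.neg)
        (hφ.weaken (by simp))) (hcon _ fun ψ hψ => ?_)
      rcases List.mem_cons.1 hψ with rfl | hψ
      · exact ⟨_, h⟩
      · exact hΔ ψ hψ
  · rintro ⟨n, hn⟩
    exact (L n).2 (Derivation.hyp hn)
  · exact fun φ => (hdecides φ).imp (fun h => ⟨_, h⟩) fun h => ⟨_, h⟩
  · intro φ h
    rcases hdecides φ.allN.neg with h' | h'
    · have := h₄ (L φ.allN.neg.code) (dec φ.allN.neg.code) φ (hdec _)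
      rw [← hL, hdec] at this
      rcases this h' with h' | ⟨x, hx⟩
      · exact (hneg _ h ⟨φ.allN.neg.code + 1, h'⟩).elim
      · exact ⟨x, φ.allN.neg.code + 1, hx⟩
    · exact (hneg _ h ⟨_, h'⟩).elim
  · intro φ h
    rcases hdecides φ.allS.neg with h' | h'
    · have := h₅ (L φ.allS.neg.code) (dec φ.allS.neg.code) φ (hdec _)
      rw [← hL, hdec] at this
      rcases this h' with h' | ⟨x, hx⟩
      · exact (hneg _ h ⟨φ.allS.neg.code + 1, h'⟩).elim
      · exact ⟨x, φ.allS.neg.code + 1, hx⟩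
    · exact (hneg _ h ⟨_, h'⟩).elim

namespace IsHenkin

variable {H : Set Fm}

theorem mem_neg (hH : IsHenkin T H) {φ : Fm} : φ.neg ∈ H ↔ φ ∉ H := by
  refine ⟨fun h h' => hH.bot (hH.closed (Γ := [φ.neg, φ]) (by simpa using ⟨h, h'⟩) ?_),
    fun h => (hH.decides φ).resolve_left h⟩
  exact Derivation.impE (Derivation.hyp (by simp) : Derivation T _ φ.neg)
    (Derivation.hyp (by simp))

theorem mem_imp (hH : IsHenkin T H) {φ ψ : Fm} : φ.imp ψ ∈ H ↔ (φ ∈ H → ψ ∈ H) := by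
  refine ⟨fun h h' => hH.closed (Γ := [φ.imp ψ, φ]) (by simpa using ⟨h, h'⟩) ?_, fun h => ?_⟩
  · exact Derivation.impE (Derivation.hyp (by simp) : Derivation T _ (φ.imp ψ))
      (Derivation.hyp (by simp))
  · by_cases hφ : φ ∈ H
    · exact hH.closed (Γ := [ψ]) (by simpa using h hφ)
        (Derivation.impI (Derivation.hyp (by simp)))
    · refine hH.closed (Γ := [φ.neg]) (by simpa using hH.mem_neg.2 hφ)
        (Derivation.impI (Derivation.botE ?_))
      exact Derivation.impE (Derivation.hyp (by simp) : Derivation T _ φ.neg)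
        (Derivation.hyp (by simp))

theorem mem_allN (hH : IsHenkin T H) {φ : Fm} : φ.allN ∈ H ↔ ∀ t, φ.instN t ∈ H := by
  refine ⟨fun h t => hH.closed (Γ := [φ.allN]) (by simpa using h)
    (Derivation.allNE t (Derivation.hyp (by simp))), fun h => ?_⟩
  by_contra hφ
  obtain ⟨x, hx⟩ := hH.number φ (hH.mem_neg.2 hφ)
  exact hH.mem_neg.1 hx (h _)

theorem mem_allS (hH : IsHenkin T H) {φ : Fm} : φ.allS ∈ H ↔ ∀ X, φ.instS X ∈ H := by
  refine ⟨fun h t => hH.closed (Γ := [φ.allS]) (by simpa using h)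
    (Derivation.allSE t (Derivation.hyp (by simp))), fun h => ?_⟩
  by_contra hφ
  obtain ⟨x, hx⟩ := hH.set φ (hH.mem_neg.2 hφ)
  exact hH.mem_neg.1 hx (h _)

theorem eq_refl (hH : IsHenkin T H) (t : Tm) : Fm.eq t t ∈ H :=
  hH.closed (Γ := []) (by simp) (Derivation.eqRefl t)

/-- Leibniz' law, for the terms `s` and `t` substituted for the variable `0`. -/
theorem rewrite (hH : IsHenkin T H) {s t : Tm} (h : Fm.eq s t ∈ H) (φ : Fm)
    (hs : φ.instN s ∈ H) : φ.instN t ∈ H :=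
  hH.closed (Γ := [Fm.eq s t, φ.instN s]) (by simpa using ⟨h, hs⟩)
    (Derivation.eqSubst (s := s) φ (Derivation.hyp (by simp)) (Derivation.hyp (by simp)))

theorem eq_symm (hH : IsHenkin T H) {s t : Tm} (h : Fm.eq s t ∈ H) : Fm.eq t s ∈ H := by
  have := hH.rewrite h (Fm.eq (Tm.var 0) s.shift)
  simp only [Fm.instN, Fm.subst, Tm.shift_subst_inst] at this
  exact this (hH.eq_refl s)

theorem eq_trans (hH : IsHenkin T H) {s t u : Tm} (h : Fm.eq s t ∈ H) (h' : Fm.eq t u ∈ H) :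
    Fm.eq s u ∈ H := by
  have := hH.rewrite h' (Fm.eq s.shift (Tm.var 0))
  simp only [Fm.instN, Fm.subst, Tm.shift_subst_inst] at this
  exact this h

/-- Equal terms as elements of the term model. -/
def setoid (hH : IsHenkin T H) : Setoid Tm where
  r s t := Fm.eq s t ∈ H
  iseqv := ⟨hH.eq_refl, hH.eq_symm, hH.eq_trans⟩

theorem congr_add (hH : IsHenkin T H) {s s' t t' : Tm} (h : Fm.eq s s' ∈ H) (h' : Fm.eq t t' ∈ H) :
    Fm.eq (s.add t) (s'.add t') ∈ H := by
  have h₁ := hH.rewrite h (Fm.eq (Tm.add s t).shift (Tm.add (Tm.var 0) t.shift))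
  have h₂ := hH.rewrite h' (Fm.eq (Tm.add s t).shift (Tm.add s'.shift (Tm.var 0)))
  simp only [Fm.instN, Fm.subst, Tm.shift_subst_inst, Tm.subst] at h₁ h₂
  exact h₂ (h₁ (hH.eq_refl _))

theorem congr_mul (hH : IsHenkin T H) {s s' t t' : Tm} (h : Fm.eq s s' ∈ H) (h' : Fm.eq t t' ∈ H) :
    Fm.eq (s.mul t) (s'.mul t') ∈ H := by
  have h₁ := hH.rewrite h (Fm.eq (Tm.mul s t).shift (Tm.mul (Tm.var 0) t.shift))
  have h₂ := hH.rewrite h' (Fm.eq (Tm.mul s t).shift (Tm.mul s'.shift (Tm.var 0)))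
  simp only [Fm.instN, Fm.subst, Tm.shift_subst_inst, Tm.subst] at h₁ h₂
  exact h₂ (h₁ (hH.eq_refl _))

theorem congr_lt (hH : IsHenkin T H) {s s' t t' : Tm} (h : Fm.eq s s' ∈ H) (h' : Fm.eq t t' ∈ H)
    (hst : Fm.lt s t ∈ H) : Fm.lt s' t' ∈ H := by
  have h₁ := hH.rewrite h (Fm.lt (Tm.var 0) t.shift)
  have h₂ := hH.rewrite h' (Fm.lt s'.shift (Tm.var 0))
  simp only [Fm.instN, Fm.subst, Tm.shift_subst_inst, Tm.subst] at h₁ h₂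
  exact h₂ (h₁ hst)

theorem congr_mem (hH : IsHenkin T H) {s s' : Tm} {X : ℕ} (h : Fm.eq s s' ∈ H)
    (hs : Fm.mem s X ∈ H) : Fm.mem s' X ∈ H := by
  have h₁ := hH.rewrite h (Fm.mem (Tm.var 0) X)
  simp only [Fm.instN, Fm.subst, Tm.subst] at h₁
  exact h₁ hs

end IsHenkin

/-- Gödel's completeness theorem: what holds in all models of `T` is derivable from `T`. -/
theorem completeness {φ : Fm}
    (h : ∀ (M : Type) [Zero M] [One M] [Add M] [Mul M] [LT M] (𝒮 : Set (Set M)),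
      (∀ χ ∈ T, ∀ (e : ℕ → M) (s : ℕ → Set M), (∀ i, s i ∈ 𝒮) → χ.Holds 𝒮 e s) →
        ∀ (e : ℕ → M) (s : ℕ → Set M), (∀ i, s i ∈ 𝒮) → φ.Holds 𝒮 e s) : Proves T φ := by
  by_contra hφ
  obtain ⟨H, hH, hφH⟩ := exists_isHenkin (con_cons_neg hφ)
  let M := Quotient hH.setoid
  let _ : Zero M := ⟨Quotient.mk _ Tm.zero⟩
  let _ : One M := ⟨Quotient.mk _ Tm.one⟩
  let _ : Add M := ⟨Quotient.map₂ Tm.add fun _ _ h _ _ h' => hH.congr_add h h'⟩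
  let _ : Mul M := ⟨Quotient.map₂ Tm.mul fun _ _ h _ _ h' => hH.congr_mul h h'⟩
  let _ : LT M := ⟨Quotient.lift₂ (fun s t => Fm.lt s t ∈ H) fun _ _ _ _ h h' => propext
    ⟨hH.congr_lt h h', hH.congr_lt (hH.eq_symm h) (hH.eq_symm h')⟩⟩
  -- The set variables name the sets of the term model.
  let D : ℕ → Set M := fun X => {a | Quotient.lift (fun t => Fm.mem t X ∈ H)
    (fun _ _ h => propext ⟨hH.congr_mem h, hH.congr_mem (hH.eq_symm h)⟩) a}
  have hval : ∀ (σ : ℕ → Tm) (t : Tm),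
      t.val (fun i => (Quotient.mk _ (σ i) : M)) = Quotient.mk _ (t.subst σ) := by
    intro σ t
    induction t with
    | var i => rfl
    | zero => rfl
    | one => rfl
    | add s t hs ht => simp only [Tm.val, hs, ht]; rfl
    | mul s t hs ht => simp only [Tm.val, hs, ht]; rfl
  have truth : ∀ (φ : Fm) (σ : ℕ → Tm) (ρ : ℕ → ℕ),
      φ.Holds (Set.range D) (fun i => (Quotient.mk _ (σ i) : M)) (fun i => D (ρ i)) ↔
        φ.subst σ ρ ∈ H := by
    intro φ
    induction φ with
    | eq s t =>
      intro σ ρ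
      simp only [Fm.Holds, hval]
      exact Quotient.eq
    | lt s t => intro σ ρ; simp only [Fm.Holds, hval]; rfl
    | mem t X => intro σ ρ; simp only [Fm.Holds, hval]; rfl
    | bot => exact fun σ ρ => iff_of_false id hH.bot
    | imp φ ψ hφ hψ =>
      intro σ ρ
      simp only [Fm.Holds, Fm.subst, hφ, hψ]
      exact hH.mem_imp.symm
    | allN φ ih =>
      intro σ ρ
      have e : ∀ t : Tm, push (Quotient.mk _ t : M) (fun i => (Quotient.mk _ (σ i) : M)) =
          fun i => Quotient.mk _ (Tm.cons t σ i) := by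
        intro t
        funext i
        cases i <;> rfl
      simp only [Fm.Holds, Fm.subst, hH.mem_allN, Fm.subst_up_instN, ← ih, ← e]
      exact ⟨fun h t => h _, fun h a => Quotient.inductionOn a h⟩
    | allS φ ih =>
      intro σ ρ
      have e : ∀ X : ℕ, push (D X) (fun i => D (ρ i)) = fun i => D (consS X ρ i) := by
        intro X
        funext i
        cases i <;> rfl
      simp only [Fm.Holds, Fm.subst, hH.mem_allS, Fm.subst_upS_instS, Set.forall_mem_range,
        e, ih]
  have hrep : ∀ e : ℕ → M, ∃ σ : ℕ → Tm, e = fun i => Quotient.mk _ (σ i) := fun e =>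
    ⟨fun i => (e i).out, funext fun i => (Quotient.out_eq _).symm⟩
  have hT : ∀ χ ∈ T, ∀ (e : ℕ → M) (s : ℕ → Set M), (∀ i, s i ∈ Set.range D) →
      χ.Holds (Set.range D) e s := by
    intro χ hχ e s hs
    obtain ⟨σ, rfl⟩ := hrep e
    choose ρ hρ using hs
    obtain rfl := funext hρ
    exact (truth χ σ ρ).2 (hH.closed (Γ := []) (by simp) (Derivation.subst_axm hχ σ ρ))
  have := (truth φ Tm.var id).1 (h M _ hT _ _ fun i => ⟨i, rfl⟩)
  rw [Fm.subst_var] at this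
  exact hH.mem_neg.1 (hφH _ List.mem_cons_self) this

end Henkin

end SecondOrderArithmetic

namespace SecondOrderArithmetic

/-! ### Arithmetic in a model -/

theorem IsBounded.subst {φ : Fm} (h : IsBounded φ) (σ : ℕ → Tm) (ρ : ℕ → ℕ) :
    IsBounded (φ.subst σ ρ) := by
  induction h generalizing σ with
  | eq s t => exact .eq _ _
  | lt s t => exact .lt _ _
  | mem t X => exact .mem _ _
  | bot => exact .bot
  | imp _ _ h₁ h₂ => exact .imp (h₁ σ) (h₂ σ)
  | ball t _ h =>
    have := IsBounded.ball (t.subst σ) (h (Tm.up σ))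
    rwa [← Tm.shift_subst_up] at this

/-- The semantic content of the basic axioms, and induction for `∃ y, θ`, `θ` a bounded formula.
The order and semiring laws need induction only for formulas without set variables, so any
interpretation of these variables, which may depend on `θ`, will do. -/
structure WeakArithmetic (M : Type) [Zero M] [One M] [Add M] [Mul M] [LT M] : Prop where
  succ_ne_zero : ∀ n : M, n + 1 ≠ 0
  succ_inj : ∀ m n : M, m + 1 = n + 1 → m = n
  add_zero : ∀ m : M, m + 0 = m
  add_succ : ∀ m n : M, m + (n + 1) = (m + n) + 1
  mul_zero : ∀ m : M, m * 0 = 0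
  mul_succ : ∀ m n : M, m * (n + 1) = m * n + m
  not_lt_zero : ∀ m : M, ¬ m < 0
  lt_succ : ∀ m n : M, m < n + 1 ↔ m < n ∨ m = n
  induction_sigma : ∀ θ, IsBounded θ → ∃ (𝒮 : Set (Set M)) (s : ℕ → Set M), ∀ e : ℕ → M,
    (∃ y, θ.Holds 𝒮 (push y (push 0 e)) s) →
    (∀ a, (∃ y, θ.Holds 𝒮 (push y (push a e)) s) →
      ∃ y, θ.Holds 𝒮 (push y (push (a + 1) e)) s) →
    ∀ a, ∃ y, θ.Holds 𝒮 (push y (push a e)) s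

namespace WeakArithmetic

variable {M : Type} [Zero M] [One M] [Add M] [Mul M] [LT M]

theorem induction_eq (h : WeakArithmetic M) (t u : Tm) (e : ℕ → M)
    (h₀ : t.val (push 0 e) = u.val (push 0 e))
    (h₁ : ∀ a, t.val (push a e) = u.val (push a e) →
      t.val (push (a + 1) e) = u.val (push (a + 1) e)) (a : M) :
    t.val (push a e) = u.val (push a e) := by
  obtain ⟨𝒮, s, H⟩ := h.induction_sigma (.eq t.shift u.shift) (.eq _ _)
  have : Nonempty M := ⟨0⟩
  have := H e
  simp only [Fm.Holds, Tm.val_shift, exists_const] at this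
  exact this h₀ h₁ a

theorem zero_add (h : WeakArithmetic M) (a : M) : 0 + a = a :=
  h.induction_eq (.add .zero (.var 0)) (.var 0) (fun _ => 0) (h.add_zero 0)
    (fun a (ih : 0 + a = a) => show 0 + (a + 1) = a + 1 by rw [h.add_succ, ih]) a

theorem succ_add (h : WeakArithmetic M) (b a : M) : (b + 1) + a = (b + a) + 1 :=
  h.induction_eq (.add (.add (.var 1) .one) (.var 0)) (.add (.add (.var 1) (.var 0)) .one)
    (fun _ => b) (show (b + 1) + 0 = (b + 0) + 1 by rw [h.add_zero, h.add_zero])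
    (fun a (ih : (b + 1) + a = (b + a) + 1) => show (b + 1) + (a + 1) = (b + (a + 1)) + 1 by
      rw [h.add_succ, ih, h.add_succ]) a

theorem add_comm (h : WeakArithmetic M) (b a : M) : b + a = a + b :=
  h.induction_eq (.add (.var 1) (.var 0)) (.add (.var 0) (.var 1)) (fun _ => b)
    (show b + 0 = 0 + b by rw [h.add_zero, h.zero_add])
    (fun a (ih : b + a = a + b) => show b + (a + 1) = (a + 1) + b by
      rw [h.add_succ, ih, h.succ_add]) a

theorem add_assoc (h : WeakArithmetic M) (b c a : M) : b + c + a = b + (c + a) :=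
  h.induction_eq (.add (.add (.var 1) (.var 2)) (.var 0)) (.add (.var 1) (.add (.var 2) (.var 0)))
    (push b fun _ => c) (show b + c + 0 = b + (c + 0) by rw [h.add_zero, h.add_zero])
    (fun a (ih : b + c + a = b + (c + a)) => show b + c + (a + 1) = b + (c + (a + 1)) by
      rw [h.add_succ, ih, h.add_succ, h.add_succ]) a

theorem zero_mul (h : WeakArithmetic M) (a : M) : 0 * a = 0 :=
  h.induction_eq (.mul .zero (.var 0)) .zero (fun _ => 0) (h.mul_zero 0)
    (fun a (ih : 0 * a = 0) => show 0 * (a + 1) = 0 by rw [h.mul_succ, ih, h.add_zero]) a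

theorem succ_mul (h : WeakArithmetic M) (b a : M) : (b + 1) * a = b * a + a :=
  h.induction_eq (.mul (.add (.var 1) .one) (.var 0)) (.add (.mul (.var 1) (.var 0)) (.var 0))
    (fun _ => b) (show (b + 1) * 0 = b * 0 + 0 by rw [h.mul_zero, h.mul_zero, h.add_zero])
    (fun a (ih : (b + 1) * a = b * a + a) => show (b + 1) * (a + 1) = b * (a + 1) + (a + 1) by
      rw [h.mul_succ, ih, h.mul_succ, h.add_assoc, h.add_assoc, ← h.add_assoc a b 1,
        ← h.add_assoc b a 1, h.add_comm a b]) a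

theorem mul_comm (h : WeakArithmetic M) (b a : M) : b * a = a * b :=
  h.induction_eq (.mul (.var 1) (.var 0)) (.mul (.var 0) (.var 1)) (fun _ => b)
    (show b * 0 = 0 * b by rw [h.mul_zero, h.zero_mul])
    (fun a (ih : b * a = a * b) => show b * (a + 1) = (a + 1) * b by
      rw [h.mul_succ, ih, h.succ_mul]) a

theorem mul_add (h : WeakArithmetic M) (b c a : M) : b * (c + a) = b * c + b * a :=
  h.induction_eq (.mul (.var 1) (.add (.var 2) (.var 0)))
    (.add (.mul (.var 1) (.var 2)) (.mul (.var 1) (.var 0))) (push b fun _ => c)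
    (show b * (c + 0) = b * c + b * 0 by rw [h.add_zero, h.mul_zero, h.add_zero])
    (fun a (ih : b * (c + a) = b * c + b * a) =>
      show b * (c + (a + 1)) = b * c + b * (a + 1) by
        rw [h.add_succ, h.mul_succ, ih, h.mul_succ, h.add_assoc]) a

theorem mul_assoc (h : WeakArithmetic M) (b c a : M) : b * c * a = b * (c * a) :=
  h.induction_eq (.mul (.mul (.var 1) (.var 2)) (.var 0)) (.mul (.var 1) (.mul (.var 2) (.var 0)))
    (push b fun _ => c) (show b * c * 0 = b * (c * 0) by simp only [h.mul_zero])
    (fun a (ih : b * c * a = b * (c * a)) => show b * c * (a + 1) = b * (c * (a + 1)) by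
      rw [h.mul_succ, ih, h.mul_succ, h.mul_add]) a

theorem mul_one (h : WeakArithmetic M) (a : M) : a * 1 = a := by
  rw [← h.zero_add 1, h.mul_succ, h.mul_zero, h.zero_add]

theorem add_right_cancel (h : WeakArithmetic M) (a b c : M) (hab : a + c = b + c) : a = b := by
  obtain ⟨𝒮, s, H⟩ := h.induction_sigma
    (.imp (.eq (.add (.var 2) (.var 1)) (.add (.var 3) (.var 1))) (.eq (.var 2) (.var 3)))
    (.imp (.eq _ _) (.eq _ _))
  have : Nonempty M := ⟨0⟩
  have := H (push a fun _ => b)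
  simp only [Fm.Holds, Tm.val, push, exists_const, h.add_zero] at this
  refine this id (fun c ih hc => ih ?_) c hab
  rw [h.add_succ, h.add_succ] at hc
  exact h.succ_inj _ _ hc

theorem lt_iff (h : WeakArithmetic M) (a b : M) : a < b ↔ ∃ c, a + c + 1 = b := by
  constructor
  · obtain ⟨𝒮, s, H⟩ := h.induction_sigma
      (.imp (.lt (.var 2) (.var 1)) (.eq (.add (.add (.var 2) (.var 0)) .one) (.var 1)))
      (.imp (.lt _ _) (.eq _ _))
    have := H (fun _ => a)
    simp only [Fm.Holds, Tm.val, push] at this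
    intro hab
    refine (this ⟨0, fun h' => (h.not_lt_zero _ h').elim⟩ (fun c ih => ?_) b).imp fun c hc => hc hab
    obtain ⟨d, hd⟩ := ih
    by_cases hac : a < c
    · exact ⟨d + 1, fun _ => by rw [h.add_succ, hd hac]⟩
    · refine ⟨0, fun h' => ?_⟩
      rw [((h.lt_succ _ _).1 h').resolve_left hac, h.add_zero]
  · rintro ⟨c, rfl⟩
    obtain ⟨𝒮, s, H⟩ := h.induction_sigma
      (.lt (.var 2) (.add (.add (.var 2) (.var 1)) .one)) (.lt _ _)
    have : Nonempty M := ⟨0⟩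
    have := H (fun _ => a)
    simp only [Fm.Holds, Tm.val, push, exists_const, h.add_zero] at this
    refine this ((h.lt_succ _ _).2 (Or.inr rfl)) (fun c ih => (h.lt_succ _ _).2 (Or.inl ?_)) c
    rwa [h.add_succ]

theorem zero_or_succ (h : WeakArithmetic M) (a : M) : a = 0 ∨ ∃ b, a = b + 1 := by
  obtain ⟨𝒮, s, H⟩ := h.induction_sigma
    (.imp (.imp (.eq (.var 1) .zero) .bot) (.eq (.var 1) (.add (.var 0) .one)))
    (.imp (.imp (.eq _ _) .bot) (.eq _ _))
  have := H (fun _ => a)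
  simp only [Fm.Holds, Tm.val, push] at this
  obtain ⟨b, hb⟩ := this ⟨0, fun h' => (h' trivial).elim⟩ (fun c ih => ⟨c, fun _ => rfl⟩) a
  exact or_iff_not_imp_left.2 fun ha => ⟨b, hb ha⟩

theorem lt_trans (h : WeakArithmetic M) (a b c : M) (hab : a < b) (hbc : b < c) : a < c := by
  obtain ⟨d, rfl⟩ := (h.lt_iff _ _).1 hab
  obtain ⟨e, rfl⟩ := (h.lt_iff _ _).1 hbc
  refine (h.lt_iff _ _).2 ⟨d + 1 + e, ?_⟩
  simp only [h.add_assoc]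

theorem lt_irrefl (h : WeakArithmetic M) (a : M) : ¬ a < a := by
  intro ha
  obtain ⟨d, hd⟩ := (h.lt_iff _ _).1 ha
  refine h.succ_ne_zero d (h.add_right_cancel _ _ a ?_)
  rw [h.add_comm, ← h.add_assoc, hd, h.zero_add]

theorem add_lt_add_right (h : WeakArithmetic M) (a b c : M) (hab : a < b) : a + c < b + c := by
  obtain ⟨d, rfl⟩ := (h.lt_iff _ _).1 hab
  refine (h.lt_iff _ _).2 ⟨d, ?_⟩
  simp only [h.add_assoc, h.add_comm c]

theorem lt_trichotomy (h : WeakArithmetic M) (a b : M) : a < b ∨ a = b ∨ b < a := by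
  obtain ⟨𝒮, s, H⟩ := h.induction_sigma
    (.imp (.imp (.lt (.var 1) (.var 2)) .bot)
      (.imp (.imp (.eq (.var 1) (.var 2)) .bot) (.lt (.var 2) (.var 1))))
    (.imp (.imp (.lt _ _) .bot) (.imp (.imp (.eq _ _) .bot) (.lt _ _)))
  have : Nonempty M := ⟨0⟩
  have := H (fun _ => b)
  simp only [Fm.Holds, Tm.val, push, exists_const] at this
  have key := this (fun h₁ h₂ => ?_) (fun a ih h₁ h₂ => ?_) a
  · by_cases h₁ : a < b
    · exact Or.inl h₁
    · by_cases h₂ : a = b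
      · exact Or.inr (Or.inl h₂)
      · exact Or.inr (Or.inr (key h₁ h₂))
  · rcases h.zero_or_succ b with rfl | ⟨c, rfl⟩
    · exact (h₂ rfl).elim
    · exact (h₁ ((h.lt_iff _ _).2 ⟨c, by rw [h.zero_add]⟩)).elim
  · by_cases h₃ : a < b
    · obtain ⟨c, rfl⟩ := (h.lt_iff _ _).1 h₃
      rcases h.zero_or_succ c with rfl | ⟨c, rfl⟩
      · exact (h₂ (by rw [h.add_zero])).elim
      · exact (h₁ ((h.lt_iff _ _).2 ⟨c, by rw [h.add_succ, h.succ_add]⟩)).elim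
    · by_cases h₄ : a = b
      · exact (h.lt_succ _ _).2 (Or.inr h₄.symm)
      · exact (h.lt_succ _ _).2 (Or.inl (ih h₃ h₄))

theorem mul_lt_mul_left (h : WeakArithmetic M) (a b c : M) (hc : 0 < c) (hab : a < b) :
    c * a < c * b := by
  obtain ⟨d, rfl⟩ := (h.lt_iff _ _).1 hab
  obtain ⟨k, rfl⟩ := (h.lt_iff _ _).1 hc
  refine (h.lt_iff _ _).2 ⟨(0 + k + 1) * d + k, ?_⟩
  simp only [h.mul_add, h.mul_one, h.add_assoc, h.zero_add]

/-- A model of the basic axioms with induction is a commutative semiring. -/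
@[reducible] noncomputable def commSemiring (h : WeakArithmetic M) : CommSemiring M where
  add := (· + ·)
  zero := 0
  mul := (· * ·)
  one := 1
  add_assoc a b c := h.add_assoc a b c
  zero_add := h.zero_add
  add_zero := h.add_zero
  add_comm := h.add_comm
  left_distrib a b c := h.mul_add a b c
  right_distrib a b c := by
    change (a + b) * c = a * c + b * c
    rw [h.mul_comm, h.mul_add, h.mul_comm a, h.mul_comm b]
  zero_mul := h.zero_mul
  mul_zero := h.mul_zero
  mul_assoc a b c := h.mul_assoc a b c
  one_mul a := by
    change 1 * a = a
    rw [h.mul_comm, h.mul_one]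
  mul_one := h.mul_one
  mul_comm := h.mul_comm
  nsmul := nsmulRec
  npow := @npowRec M ⟨1⟩ ⟨(· * ·)⟩
  npow_zero _ := rfl
  npow_succ _ _ := rfl

/-- A model of the basic axioms with induction is linearly ordered. -/
@[reducible] noncomputable def linearOrder (h : WeakArithmetic M) : LinearOrder M where
  lt := (· < ·)
  le a b := a < b ∨ a = b
  le_refl _ := Or.inr rfl
  le_trans a b c hab hbc := by
    rcases hab with hab | rfl
    · rcases hbc with hbc | rfl
      · exact Or.inl (h.lt_trans _ _ _ hab hbc)
      · exact Or.inl hab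
    · exact hbc
  lt_iff_le_not_ge a b := by
    refine ⟨fun hab => ⟨Or.inl hab, fun hba => ?_⟩, fun ⟨h₁, h₂⟩ => ?_⟩
    · rcases hba with hba | rfl
      · exact h.lt_irrefl _ (h.lt_trans _ _ _ hab hba)
      · exact h.lt_irrefl _ hab
    · exact h₁.resolve_right fun h' => h₂ (Or.inr h'.symm)
  le_antisymm a b hab hba := by
    rcases hab with hab | rfl
    · rcases hba with hba | rfl
      · exact (h.lt_irrefl _ (h.lt_trans _ _ _ hab hba)).elim
      · rfl
    · rfl
  le_total a b := by
    rcases h.lt_trichotomy a b with h' | h' | h'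
    · exact Or.inl (Or.inl h')
    · exact Or.inl (Or.inr h')
    · exact Or.inr (Or.inl h')
  toDecidableLE := Classical.decRel _

end WeakArithmetic

end SecondOrderArithmetic

namespace SecondOrderArithmetic

/-- A model of `RCA₀`, with the order and the semiring laws that follow from the axioms.
The second sort consists of genuine subsets of `M`. -/
class RCAModel (M : Type) extends CommSemiring M, LinearOrder M where
  /-- The sets of the model. -/
  sets : Set (Set M)
  lt_iff_exists : ∀ a b : M, a < b ↔ ∃ c, a + c + 1 = b
  nonneg : ∀ a : M, 0 ≤ a
  add_lt_add : ∀ a b c : M, a < b → a + c < b + c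
  mul_lt_mul : ∀ a b c : M, 0 < c → a < b → c * a < c * b
  induction_sigma : ∀ θ, IsBounded θ → ∀ (e : ℕ → M) (s : ℕ → Set M), (∀ i, s i ∈ sets) →
    (∃ y, θ.Holds sets (push y (push 0 e)) s) →
    (∀ a, (∃ y, θ.Holds sets (push y (push a e)) s) →
      ∃ y, θ.Holds sets (push y (push (a + 1) e)) s) →
    ∀ a, ∃ y, θ.Holds sets (push y (push a e)) s
  comprehension_delta : ∀ θ ψ, IsBounded θ → IsBounded ψ → ∀ (e : ℕ → M) (s : ℕ → Set M),
    (∀ i, s i ∈ sets) →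
    (∀ a, (∃ y, θ.Holds sets (push y (push a e)) s) ↔ ∀ y, ψ.Holds sets (push y (push a e)) s) →
    {a | ∃ y, θ.Holds sets (push y (push a e)) s} ∈ sets
  sets_nonempty : sets.Nonempty

namespace RCAModel

variable {M : Type} [RCAModel M]

theorem lt_succ_self (a : M) : a < a + 1 := (lt_iff_exists _ _).2 ⟨0, by rw [add_zero]⟩

instance : IsStrictOrderedRing M where
  add_le_add_left a b h c := by
    rcases h.lt_or_eq with h | rfl
    · exact (add_lt_add _ _ _ h).le
    · exact le_rfl
  le_of_add_le_add_left a b c h := by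
    by_contra h'
    have := add_lt_add _ _ a (not_le.1 h')
    rw [add_comm c, add_comm b] at this
    exact absurd h (not_le.2 this)
  zero_le_one := nonneg 1
  exists_pair_ne := ⟨0, 1, by simpa using (lt_succ_self (0 : M)).ne⟩
  mul_lt_mul_of_pos_left c hc a b h := mul_lt_mul a b c hc h
  mul_lt_mul_of_pos_right c hc a b h := by
    rw [mul_comm a, mul_comm b]
    exact mul_lt_mul a b c hc h

instance : CanonicallyOrderedAdd M where
  exists_add_of_le {a b} h := by
    rcases h.lt_or_eq with h | rfl
    · obtain ⟨c, rfl⟩ := (lt_iff_exists _ _).1 h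
      exact ⟨c + 1, by rw [add_assoc]⟩
    · exact ⟨0, by rw [add_zero]⟩
  le_add_self a b := le_add_of_nonneg_left (nonneg b)
  le_self_add a b := le_add_of_nonneg_right (nonneg b)

theorem lt_add_one_iff {a b : M} : a < b + 1 ↔ a ≤ b := by
  refine ⟨fun h => ?_, fun h => h.trans_lt (lt_succ_self b)⟩
  obtain ⟨c, hc⟩ := (lt_iff_exists _ _).1 h
  rw [← add_right_cancel hc]
  exact le_self_add

theorem add_one_le_iff {a b : M} : a + 1 ≤ b ↔ a < b := by
  rw [← lt_add_one_iff, add_lt_add_iff_right]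

theorem eq_zero_or_eq_add_one (a : M) : a = 0 ∨ ∃ b, a = b + 1 := by
  rcases (nonneg a).eq_or_lt with h | h
  · exact Or.inl h.symm
  · obtain ⟨c, hc⟩ := (lt_iff_exists _ _).1 h
    exact Or.inr ⟨c, by rw [← hc, zero_add]⟩

theorem le_mul_self (a : M) : a ≤ a * a := by
  rcases eq_zero_or_eq_add_one a with rfl | ⟨b, rfl⟩
  · simp
  · exact le_mul_of_one_le_left (nonneg _) le_add_self

/-! ### Pairs -/

/-- The pairing function. -/
def pr (a b : M) : M := (a + b) * (a + b) + a

theorem le_pr_left (a b : M) : a ≤ pr a b := le_add_self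

theorem le_pr_right (a b : M) : b ≤ pr a b :=
  le_add_self.trans ((le_mul_self (a + b)).trans le_self_add)

theorem pr_le_pr {a b c d : M} (h : a ≤ c) (h' : b ≤ d) : pr a b ≤ pr c d := by
  have := add_le_add h h'
  exact add_le_add (mul_le_mul' this this) h

theorem pr_lt_of_sum_lt {a b c d : M} (h : a + b < c + d) : pr a b < pr c d := by
  have h₁ : a + b + 1 ≤ c + d := add_one_le_iff.2 h
  calc pr a b ≤ (a + b) * (a + b) + (a + b) := add_le_add le_rfl le_self_add
    _ < (a + b + 1) * (a + b + 1) := by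
      have : (a + b + 1) * (a + b + 1) = (a + b) * (a + b) + (a + b) + (a + b) + 1 := by ring
      rw [this]
      exact lt_add_one_iff.2 le_self_add
    _ ≤ (c + d) * (c + d) := mul_le_mul' h₁ h₁
    _ ≤ pr c d := le_self_add

theorem pr_inj {a b c d : M} : pr a b = pr c d ↔ a = c ∧ b = d := by
  refine ⟨fun h => ?_, by rintro ⟨rfl, rfl⟩; rfl⟩
  have hs : a + b = c + d := by
    rcases lt_trichotomy (a + b) (c + d) with h' | h' | h'
    · exact absurd h (pr_lt_of_sum_lt h').ne
    · exact h'
    · exact absurd h (pr_lt_of_sum_lt h').ne'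
  unfold pr at h
  rw [hs] at h
  obtain rfl := add_left_cancel h
  exact ⟨rfl, add_left_cancel hs⟩

open Classical in
/-- The first component of a pair, and `0` for numbers that are no pairs. -/
noncomputable def fst (z : M) : M := if h : ∃ a b, z = pr a b then h.choose else 0

open Classical in
/-- The second component of a pair, and `0` for numbers that are no pairs. -/
noncomputable def snd (z : M) : M :=
  if h : ∃ a b, z = pr a b then h.choose_spec.choose else 0

theorem pr_fst_snd {z : M} (h : ∃ a b, z = pr a b) : pr (fst z) (snd z) = z := by
  unfold fst snd
  rw [dif_pos h, dif_pos h]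
  exact h.choose_spec.choose_spec.symm

@[simp] theorem fst_pr (a b : M) : fst (pr a b) = a :=
  (pr_inj.1 (pr_fst_snd ⟨a, b, rfl⟩)).1

@[simp] theorem snd_pr (a b : M) : snd (pr a b) = b :=
  (pr_inj.1 (pr_fst_snd ⟨a, b, rfl⟩)).2

theorem fst_of_not {z : M} (h : ¬ ∃ a b, z = pr a b) : fst z = 0 := dif_neg h

theorem snd_of_not {z : M} (h : ¬ ∃ a b, z = pr a b) : snd z = 0 := dif_neg h

theorem exists_pr_bounded {z : M} {P : M → M → Prop} :
    (∃ a < z + 1, ∃ b < z + 1, z = pr a b ∧ P a b) ↔ (∃ a b, z = pr a b) ∧ P (fst z) (snd z) := by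
  constructor
  · rintro ⟨a, -, b, -, rfl, h⟩
    exact ⟨⟨a, b, rfl⟩, by simpa using h⟩
  · rintro ⟨⟨a, b, rfl⟩, h⟩
    exact ⟨a, lt_add_one_iff.2 (le_pr_left _ _), b, lt_add_one_iff.2 (le_pr_right _ _), rfl,
      by simpa using h⟩

end RCAModel

open RCAModel

/-! ### Formulas for pairs -/

section

variable {M : Type} [Zero M] [One M] [Add M] [Mul M] [LT M] {𝒮 : Set (Set M)} {φ ψ : Fm}
  {e : ℕ → M} {s : ℕ → Set M}

theorem holds_neg : φ.neg.Holds 𝒮 e s ↔ ¬ φ.Holds 𝒮 e s := Iff.rfl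

theorem holds_and : (φ.and ψ).Holds 𝒮 e s ↔ φ.Holds 𝒮 e s ∧ ψ.Holds 𝒮 e s := by
  simp only [Fm.and, Fm.neg, Fm.Holds]
  tauto

theorem holds_or : (φ.or ψ).Holds 𝒮 e s ↔ φ.Holds 𝒮 e s ∨ ψ.Holds 𝒮 e s := by
  simp only [Fm.or, Fm.neg, Fm.Holds]
  tauto

theorem holds_iff : (φ.iff ψ).Holds 𝒮 e s ↔ (φ.Holds 𝒮 e s ↔ ψ.Holds 𝒮 e s) := by
  simp only [Fm.iff, holds_and, Fm.Holds]
  tauto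

theorem holds_exN : φ.exN.Holds 𝒮 e s ↔ ∃ a, φ.Holds 𝒮 (push a e) s := by
  simp only [Fm.exN, Fm.neg, Fm.Holds]
  exact (not_congr (forall_congr' fun _ => Iff.rfl)).trans not_forall_not

theorem holds_exS : φ.exS.Holds 𝒮 e s ↔ ∃ A ∈ 𝒮, φ.Holds 𝒮 e (push A s) := by
  simp only [Fm.exS, Fm.neg, Fm.Holds]
  exact ⟨fun h => by_contra fun h' => h fun A hA hφ => h' ⟨A, hA, hφ⟩,
    fun ⟨A, hA, hφ⟩ h => h A hA hφ⟩

/-- The bounded quantifier `∃ x < t`. -/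
def Fm.bex (t : Tm) (φ : Fm) : Fm := (Fm.allN ((Fm.lt (Tm.var 0) t.shift).imp φ.neg)).neg

theorem holds_bex {t : Tm} : (Fm.bex t φ).Holds 𝒮 e s ↔
    ∃ a < t.val e, φ.Holds 𝒮 (push a e) s := by
  simp only [Fm.bex, Fm.neg, Fm.Holds, Tm.val_shift]
  exact ⟨fun h => by_contra fun h' => h fun A hA hφ => h' ⟨A, hA, hφ⟩,
    fun ⟨A, hA, hφ⟩ h => h A hA hφ⟩

theorem IsBounded.neg (h : IsBounded φ) : IsBounded φ.neg := h.imp .bot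

theorem IsBounded.and (h : IsBounded φ) (h' : IsBounded ψ) : IsBounded (φ.and ψ) :=
  (h.imp h'.neg).neg

theorem IsBounded.or (h : IsBounded φ) (h' : IsBounded ψ) : IsBounded (φ.or ψ) :=
  h.neg.imp h'

theorem IsBounded.bex (t : Tm) (h : IsBounded φ) : IsBounded (Fm.bex t φ) := (h.neg.ball t).neg

/-- The pair of two terms. -/
def Tm.pr (s t : Tm) : Tm := ((s.add t).mul (s.add t)).add s

/-- `x` is a pair `(a, b)` with `φ`, where `a` and `b` are the variables `1` and `0` of `φ`. -/
def Fm.splits (x : ℕ) (φ : Fm) : Fm :=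
  Fm.bex ((Tm.var x).add .one) (Fm.bex ((Tm.var (x + 1)).add .one)
    ((Fm.eq (Tm.var (x + 2)) ((Tm.var 1).pr (Tm.var 0))).and φ))

theorem IsBounded.splits (x : ℕ) (h : IsBounded φ) : IsBounded (Fm.splits x φ) :=
  .bex _ (.bex _ (.and (.eq _ _) h))

end

namespace RCAModel

variable {M : Type} [RCAModel M] {e : ℕ → M} {s : ℕ → Set M}

theorem val_pr (t u : Tm) : (t.pr u).val e = pr (t.val e) (u.val e) := rfl

theorem holds_splits {𝒮 : Set (Set M)} {x : ℕ} {φ : Fm} : (Fm.splits x φ).Holds 𝒮 e s ↔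
    (∃ a b, e x = pr a b) ∧ φ.Holds 𝒮 (push (snd (e x)) (push (fst (e x)) e)) s := by
  simp only [Fm.splits, holds_bex, holds_and]
  exact exists_pr_bounded (P := fun a b => φ.Holds 𝒮 (push b (push a e)) s)

end RCAModel

/-! ### Recursive predicates and functions

Predicates are unary; contexts with several variables are coded by pairs. -/

/-- `P` is recursive in the model, i.e., one of its sets. -/
class Rec {M : Type} [RCAModel M] (P : M → Prop) : Prop where
  mem_sets : {x | P x} ∈ sets (M := M)

/-- `f` is recursive in the model: its graph is one of the sets of the model. -/
class RecFun {M : Type} [RCAModel M] (f : M → M) : Prop where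
  graph : ∃ X ∈ sets (M := M), ∀ x y, pr x y ∈ X ↔ y = f x

variable {M : Type} [RCAModel M]

theorem bounded_mem_sets {φ : Fm} (hφ : IsBounded φ) (e : ℕ → M) {s : ℕ → Set M}
    (hs : ∀ i, s i ∈ sets) : {a | φ.Holds sets (push a e) s} ∈ sets := by
  have h := comprehension_delta φ.shiftN φ.shiftN (hφ.subst _ _) (hφ.subst _ _) e s hs
  simp only [Fm.shiftN, Fm.holds_subst, Tm.val, push, exists_const, forall_const] at h
  exact h

/-- A predicate with a bounded definition is recursive. Two set parameters suffice below: the set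
variable `0` stands for `X`, and all others for `Y`. -/
theorem Rec.of_bounded {P : M → Prop} (φ : Fm) (hφ : IsBounded φ) (e : ℕ → M) {X Y : Set M}
    (hX : X ∈ sets) (hY : Y ∈ sets)
    (h : ∀ a, P a ↔ φ.Holds sets (push a e) (push X fun _ => Y)) : Rec P := by
  refine ⟨?_⟩
  simp only [h]
  refine bounded_mem_sets hφ e fun i => ?_
  cases i
  · exact hX
  · exact hY

/-- The same for functions; the variables `0` and `1` stand for the value and the argument, and the
variable `2` for their pair. -/
theorem RecFun.of_bounded {f : M → M} (φ : Fm) (hφ : IsBounded φ) (e : ℕ → M) {X Y : Set M}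
    (hX : X ∈ sets) (hY : Y ∈ sets)
    (h : ∀ a b z, b = f a ↔ φ.Holds sets (push b (push a (push z e))) (push X fun _ => Y)) :
    RecFun f := by
  refine ⟨_, bounded_mem_sets (hφ.splits 0) e (s := push X fun _ => Y) (fun i => ?_),
    fun x y => ?_⟩
  · cases i
    · exact hX
    · exact hY
  · simp only [Set.mem_ofPred_eq, holds_splits, push, fst_pr, snd_pr, h x y (pr x y)]
    exact and_iff_right ⟨x, y, rfl⟩

/-- `Δ⁰₁` comprehension. -/
theorem Rec.of_delta {P : M → Prop} (θ ψ : Fm) (hθ : IsBounded θ) (hψ : IsBounded ψ)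
    (e : ℕ → M) {X Y : Set M} (hX : X ∈ sets) (hY : Y ∈ sets)
    (h₁ : ∀ a, P a ↔ ∃ y, θ.Holds sets (push y (push a e)) (push X fun _ => Y))
    (h₂ : ∀ a, P a ↔ ∀ y, ψ.Holds sets (push y (push a e)) (push X fun _ => Y)) : Rec P := by
  have := comprehension_delta θ ψ hθ hψ e (push X fun _ => Y)
    (fun i => by
      cases i
      · exact hX
      · exact hY) fun a => (h₁ a).symm.trans (h₂ a)
  simp only [← h₁] at this
  exact ⟨this⟩

variable {P Q : M → Prop} {f g : M → M}

theorem Rec.congr (h : Rec P) (h' : ∀ x, Q x ↔ P x) : Rec Q := by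
  rwa [show Q = P from funext fun x => propext (h' x)]

theorem RecFun.congr (h : RecFun f) (h' : ∀ x, g x = f x) : RecFun g := by
  rwa [show g = f from funext h']

instance Rec.imp [hP : Rec P] [hQ : Rec Q] : Rec fun x => P x → Q x :=
  .of_bounded (.imp (.mem (.var 0) 0) (.mem (.var 0) 1)) (.imp (.mem _ _) (.mem _ _)) (fun _ => 0)
    hP.1 hQ.1 fun _ => Iff.rfl

theorem empty_mem_sets : (∅ : Set M) ∈ sets := by
  obtain ⟨X, hX⟩ := sets_nonempty (M := M)
  exact bounded_mem_sets (.bot) (fun _ => 0) fun _ => hX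

instance (priority := 2000) Rec.const (p : Prop) : Rec fun _ : M => p := by
  by_cases hp : p
  · exact .of_bounded (.imp .bot .bot) (.imp .bot .bot) (fun _ => 0) empty_mem_sets empty_mem_sets
      fun _ => iff_of_true hp id
  · exact .of_bounded .bot .bot (fun _ => 0) empty_mem_sets empty_mem_sets
      fun _ => iff_of_false hp id

instance Rec.not [Rec P] : Rec fun x => ¬ P x := inferInstanceAs (Rec fun x => P x → False)

instance Rec.and [Rec P] [Rec Q] : Rec fun x => P x ∧ Q x :=
  Rec.congr (P := fun x => ¬ (P x → ¬ Q x)) inferInstance fun x => by tauto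

instance Rec.or [Rec P] [Rec Q] : Rec fun x => P x ∨ Q x :=
  Rec.congr (P := fun x => ¬ P x → Q x) inferInstance fun x => by tauto

instance Rec.iff [Rec P] [Rec Q] : Rec fun x => P x ↔ Q x :=
  Rec.congr (P := fun x => (P x → Q x) ∧ (Q x → P x)) inferInstance fun x => by tauto

/-- Composition of a recursive predicate with a recursive function. -/
theorem Rec.comp (hP : Rec P) (hf : RecFun f) : Rec fun x => P (f x) := by
  obtain ⟨F, hF, hFf⟩ := hf.graph
  refine .of_delta (.and (.mem ((Tm.var 1).pr (.var 0)) 0) (.mem (.var 0) 1))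
    (.imp (.mem ((Tm.var 1).pr (.var 0)) 0) (.mem (.var 0) 1))
    (.and (.mem _ _) (.mem _ _)) (.imp (.mem _ _) (.mem _ _)) (fun _ => 0) hF hP.1 ?_ ?_
  · intro a
    simp [holds_and, Fm.Holds, val_pr, Tm.val, push, hFf]
  · intro a
    simp [Fm.Holds, val_pr, Tm.val, push, hFf]

theorem RecFun.comp (hg : RecFun g) (hf : RecFun f) : RecFun fun x => g (f x) := by
  obtain ⟨F, hF, hFf⟩ := hf.graph
  obtain ⟨G, hG, hGg⟩ := hg.graph
  have : Rec fun z : M => (∃ a b, z = pr a b) ∧ snd z = g (f (fst z)) := by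
    refine .of_delta
      (.splits 1 (.and (.mem ((Tm.var 1).pr (.var 2)) 0) (.mem ((Tm.var 2).pr (.var 0)) 1)))
      (.splits 1 (.imp (.mem ((Tm.var 1).pr (.var 2)) 0) (.mem ((Tm.var 2).pr (.var 0)) 1)))
      (.splits _ (.and (.mem _ _) (.mem _ _))) (.splits _ (.imp (.mem _ _) (.mem _ _)))
      (fun _ => 0) hF hG ?_ ?_
    · intro a
      simp [holds_splits, holds_and, Fm.Holds, val_pr, Tm.val, push, hFf, hGg]
    · intro a
      simp only [holds_splits, Fm.Holds, val_pr, Tm.val, push, hFf, hGg]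
      exact ⟨fun h y => ⟨h.1, fun hy => hy ▸ h.2⟩, fun h => ⟨(h 0).1, (h _).2 rfl⟩⟩
  refine ⟨_, this.1, fun x y => ?_⟩
  simp only [Set.mem_ofPred_eq, fst_pr, snd_pr]
  exact and_iff_right ⟨x, y, rfl⟩

instance (priority := 2000) RecFun.const (c : M) : RecFun fun _ : M => c :=
  .of_bounded (.eq (.var 0) (.var 3)) (.eq _ _) (fun _ => c) empty_mem_sets empty_mem_sets
    fun _ _ _ => Iff.rfl

instance (priority := 2000) RecFun.id : RecFun fun x : M => x :=
  .of_bounded (.eq (.var 0) (.var 1)) (.eq _ _) (fun _ => 0) empty_mem_sets empty_mem_sets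
    fun _ _ _ => Iff.rfl

instance RecFun.mk_pr [hf : RecFun f] [hg : RecFun g] : RecFun fun x => pr (f x) (g x) := by
  obtain ⟨F, hF, hFf⟩ := hf.graph
  obtain ⟨G, hG, hGg⟩ := hg.graph
  refine .of_bounded
    (.splits 0 (.and (.mem ((Tm.var 3).pr (.var 1)) 0) (.mem ((Tm.var 3).pr (.var 0)) 1)))
    (.splits _ (.and (.mem _ _) (.mem _ _))) (fun _ => 0) hF hG fun a b z => ?_
  simp only [holds_splits, holds_and, Fm.Holds, val_pr, Tm.val, push, hFf, hGg]
  constructor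
  · rintro rfl
    simp
  · rintro ⟨h, h₁, h₂⟩
    rw [← h₁, ← h₂, pr_fst_snd h]

/-- Functions given by terms in the two components of a pair. -/
theorem RecFun.of_term (t : Tm) : RecFun fun z : M => t.val (push (snd z) fun _ => fst z) := by
  obtain ⟨N, hN⟩ := t.exists_bound
  let σ : ℕ → Tm := fun i => if i = 0 then .var 0 else .var 1
  refine .of_bounded (.or (.splits 1 (.eq (.var 2) (t.subst σ)))
    (.and (Fm.neg (.splits 1 (.imp .bot .bot))) (.eq (.var 0) (t.subst fun _ => .zero))))
    (.or (.splits _ (.eq _ _)) (.and (.neg (.splits _ (.imp .bot .bot))) (.eq _ _)))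
    (fun _ => 0) empty_mem_sets empty_mem_sets fun a b z => ?_
  have e₁ : ∀ (e : ℕ → M) u v,
      (fun i => (σ i).val (push u (push v e))) = push u (fun _ => v) := by
    intro e u v
    funext i
    cases i <;> rfl
  have e₂ : (push 0 fun _ => 0) = fun _ => (0 : M) := by
    funext i
    cases i <;> rfl
  simp only [holds_splits, holds_or, holds_and, holds_neg, Fm.Holds, Tm.val_subst, e₁]
  simp only [push, Tm.val]
  by_cases h : ∃ u v, a = pr u v
  · simp only [h, true_and, not_true_eq_false, imp_self, and_true, false_and, or_false]
  · simp only [h, fst_of_not h, snd_of_not h, e₂, false_and, false_or, not_false_eq_true, true_and]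

instance RecFun.comp_fst [hf : RecFun f] : RecFun fun x => fst (f x) :=
  (RecFun.of_term (.var 1)).comp hf

instance RecFun.comp_snd [hf : RecFun f] : RecFun fun x => snd (f x) :=
  (RecFun.of_term (.var 0)).comp hf

instance RecFun.fst_self : RecFun (fst : M → M) := RecFun.comp_fst (f := fun x => x)

instance RecFun.snd_self : RecFun (snd : M → M) := RecFun.comp_snd (f := fun x => x)

instance (priority := 100) RecFun.comp_apply [hf : RecFun f] [hg : RecFun g] :
    RecFun fun x => f (g x) := hf.comp hg

instance RecFun.add [RecFun f] [RecFun g] : RecFun fun x => f x + g x :=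
  ((RecFun.of_term (.add (.var 1) (.var 0))).comp
    (RecFun.mk_pr (f := f) (g := g))).congr
    fun x => by simp [Tm.val, push]

instance RecFun.mul [RecFun f] [RecFun g] : RecFun fun x => f x * g x :=
  ((RecFun.of_term (.mul (.var 1) (.var 0))).comp
    (RecFun.mk_pr (f := f) (g := g))).congr
    fun x => by simp [Tm.val, push]

instance Rec.lt [RecFun f] [RecFun g] : Rec fun x => f x < g x := by
  have h : Rec fun z : M => (∃ a b, z = pr a b) ∧ fst z < snd z :=
    .of_bounded (.splits 0 (.lt (.var 1) (.var 0))) (.splits _ (.lt _ _)) (fun _ => 0)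
      empty_mem_sets empty_mem_sets fun a => by
      simp only [holds_splits, Fm.Holds, Tm.val, push]
  refine (h.comp (RecFun.mk_pr (f := f) (g := g))).congr fun x => ?_
  simp only [fst_pr, snd_pr]
  exact (and_iff_right ⟨_, _, rfl⟩).symm

instance Rec.le [RecFun f] [RecFun g] : Rec fun x => f x ≤ g x :=
  Rec.congr (P := fun x => ¬ g x < f x) inferInstance fun _ => not_lt.symm

instance Rec.eq [RecFun f] [RecFun g] : Rec fun x => f x = g x :=
  Rec.congr (P := fun x => f x ≤ g x ∧ g x ≤ f x) inferInstance fun _ => le_antisymm_iff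

/-! Type class search meets predicates and functions in `η`-reduced form as well. -/

instance RecFun.add_self (a : M) : RecFun (HAdd.hAdd a) := RecFun.add (f := fun _ => a)

instance RecFun.mk_pr_self (a : M) : RecFun (pr a) := RecFun.mk_pr (f := fun _ => a)

instance Rec.le_self (a : M) : Rec (LE.le a) := Rec.le (f := fun _ => a) (g := fun x => x)

/-- `X` is a set of the model. -/
class IsSet (X : Set M) : Prop where
  mem_sets : X ∈ sets

instance Rec.mem {X : Set M} [hX : IsSet X] [hf : RecFun f] : Rec fun x => f x ∈ X :=
  Rec.comp (P := fun x => x ∈ X) ⟨hX.1⟩ hf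

instance Rec.mem_self {X : Set M} [IsSet X] : Rec (Membership.mem X) := Rec.mem (f := fun x => x)

instance (priority := 100) Rec.comp_apply [hP : Rec P] [hf : RecFun f] : Rec fun x => P (f x) :=
  hP.comp hf

/-- Bounded quantifiers. -/
instance Rec.ball {R : M → M → Prop} [hf : RecFun f] [hR : Rec fun z => R (fst z) (snd z)] :
    Rec fun x => ∀ y, y < f x → R x y := by
  have h : Rec fun z : M => ¬ ((∃ a b, z = pr a b) ∧
      ∃ y < snd z, ¬ R (fst z) y) := by
    refine .of_bounded (.neg (.splits 0 (.bex (.var 0) (.neg (.mem ((Tm.var 2).pr (.var 0)) 0)))))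
      (.neg (.splits _ (.bex _ (.neg (.mem _ _))))) (fun _ => 0) hR.1 empty_mem_sets fun z => ?_
    simp [holds_splits, holds_neg, holds_bex, Fm.Holds, Tm.val, val_pr, push]
  refine (h.comp (RecFun.mk_pr (f := fun x => x) (g := f))).congr fun x => ?_
  simp only [fst_pr, snd_pr, not_and, not_exists, not_not]
  exact ⟨fun h _ => h, fun h => h ⟨_, _, rfl⟩⟩

instance Rec.bex {R : M → M → Prop} [RecFun f] [Rec fun z => R (fst z) (snd z)] :
    Rec fun x => ∃ y, y < f x ∧ R x y :=
  Rec.congr (P := fun x => ¬ ∀ y, y < f x → ¬ R x y) inferInstance fun x => by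
    simp only [not_forall, not_not, exists_prop]

instance Rec.bex_le {R : M → M → Prop} [RecFun f] [Rec fun z => R (fst z) (snd z)] :
    Rec fun x => ∃ y, y ≤ f x ∧ R x y :=
  Rec.congr (P := fun x => ∃ y, y < f x + 1 ∧ R x y) inferInstance fun x => by
    simp only [lt_add_one_iff]

/-- A total function with recursive graph is recursive. -/
theorem RecFun.of_graph (h : Rec fun z => snd z = f (fst z)) : RecFun f :=
  ⟨_, h.1, fun x y => by simp⟩

/-- `Σ⁰₁` induction. -/
theorem induction_exists (R : M → M → Prop) [hR : Rec fun z => R (fst z) (snd z)]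
    (h₀ : ∃ y, R 0 y) (h₁ : ∀ a, (∃ y, R a y) → ∃ y, R (a + 1) y) (a : M) : ∃ y, R a y := by
  have := induction_sigma (.mem ((Tm.var 1).pr (.var 0)) 0) (.mem _ _) (fun _ => (0 : M))
    (fun _ => {z | R (fst z) (snd z)}) (fun _ => hR.1)
  simp only [Fm.Holds, Tm.val, val_pr, push, Set.mem_ofPred_eq, fst_pr, snd_pr] at this
  exact this h₀ h₁ a

/-- Induction for recursive predicates. -/
theorem induction_rec (P : M → Prop) [hP : Rec P] (h₀ : P 0) (h₁ : ∀ a, P a → P (a + 1)) (a : M) :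
    P a := by
  have : Rec fun z : M => P (fst z) := hP.comp inferInstance
  simpa using induction_exists (fun a _ => P a) ⟨0, h₀⟩ (fun a ⟨y, h⟩ => ⟨y, h₁ a h⟩) a

/-- The least number principle for recursive predicates. -/
theorem exists_least (P : M → Prop) [hP : Rec P] (h : ∃ a, P a) : ∃ a, P a ∧ ∀ b < a, ¬ P b := by
  by_contra hc
  have : Rec fun z : M => P (snd z) := hP.comp inferInstance
  have key : ∀ a, ∀ b, b < a → ¬ P b := by
    intro a
    refine induction_rec (fun a : M => ∀ b, b < a → ¬ P b)
      (fun b hb => absurd hb (not_lt.2 (nonneg b))) (fun a ih b hb hPb => ?_) a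
    rcases (lt_add_one_iff.1 hb).lt_or_eq with h' | rfl
    · exact ih b h' hPb
    · exact hc ⟨b, hPb, ih⟩
  obtain ⟨a, ha⟩ := h
  exact key (a + 1) a (lt_add_one a) ha

end SecondOrderArithmetic

namespace SecondOrderArithmetic

open RCAModel

-- Instances for composed predicates are found by long searches.
set_option synthInstance.maxSize 10000
set_option synthInstance.maxHeartbeats 400000

/-! ### Codes of finite sets -/

variable {M : Type} [RCAModel M] {P : M → Prop} {f g h : M → M}

instance RecFun.ite [∀ x, Decidable (P x)] [Rec P] [RecFun f] [RecFun g] :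
    RecFun fun x => if P x then f x else g x := by
  refine .of_graph (Rec.congr (show Rec fun z => P (fst z) ∧ snd z = f (fst z) ∨
    ¬ P (fst z) ∧ snd z = g (fst z) from inferInstance) fun z => ?_)
  by_cases hz : P (fst z) <;> simp [hz]

namespace RCAModel

theorem le_of_mul_eq {a q n : M} (ha : 0 < a) (h : a * q = n) : q ≤ n := by
  rw [← h]
  exact le_mul_of_one_le_left (nonneg q) (by rw [← zero_add (1 : M)]; exact add_one_le_iff.2 ha)

theorem dvd_of_dvd_add {a b c : M} (hb : a ∣ b) (h : a ∣ b + c) : a ∣ c := by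
  obtain ⟨u, rfl⟩ := hb
  obtain ⟨v, hv⟩ := h
  rcases (nonneg a).eq_or_lt with rfl | ha
  · rw [zero_mul, zero_add, zero_mul] at hv
    exact ⟨0, by rw [hv, zero_mul]⟩
  · have huv : u ≤ v := le_of_mul_le_mul_left (hv ▸ le_self_add) ha
    obtain ⟨w, rfl⟩ := exists_add_of_le huv
    rw [mul_add] at hv
    exact ⟨w, add_left_cancel hv⟩

/-- The moduli `m (i + 1) + 1` and `m (j + 1) + 1` are coprime if `i - j` divides `m`. -/
theorem dvd_of_dvd_mul_modulus {m i j n d : M} (hij : i = j + d ∨ j = i + d) (hd : d ∣ m)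
    (h : m * (i + 1) + 1 ∣ n * (m * (j + 1) + 1)) : m * (i + 1) + 1 ∣ n := by
  obtain ⟨q, rfl⟩ := hd
  have h' := h.mul_left ((i + 1) * q * (i + 1))
  rcases hij with rfl | rfl
  · refine dvd_of_dvd_add h' ⟨(j + d + 1) * q * (j + 1) * n + n, ?_⟩
    ring
  · have e : (d * q * (i + 1) + 1) * ((i + d + 1) * q * (i + 1) * n) + n =
        (i + 1) * q * (i + 1) * (n * (d * q * (i + d + 1) + 1)) + (d * q * (i + 1) + 1) * n := by
      ring
    exact dvd_of_dvd_add (dvd_mul_right _ _) (e ▸ dvd_add h' (dvd_mul_right _ _))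

instance Rec.dvd [RecFun f] [RecFun g] : Rec fun x => f x ∣ g x :=
  Rec.congr (show Rec fun x => ∃ q, q ≤ g x ∧ f x * q = g x from inferInstance) fun x => by
    constructor
    · rintro ⟨q, hq⟩
      rcases (nonneg (f x)).eq_or_lt with h0 | h0
      · exact ⟨0, nonneg _, by rw [hq, ← h0, mul_zero, zero_mul]⟩
      · exact ⟨q, le_of_mul_eq h0 hq.symm, hq.symm⟩
    · rintro ⟨q, -, hq⟩
      exact ⟨q, hq.symm⟩

/-- A positive common multiple of `1, …, b`. -/
theorem exists_common_multiple (b : M) : ∃ m : M, 0 < m ∧ ∀ i, i < b → i + 1 ∣ m := by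
  refine induction_exists (fun b m : M => 0 < m ∧ ∀ i, i < b → i + 1 ∣ m)
    ⟨1, zero_lt_one, fun i hi => absurd hi (not_lt.2 (nonneg i))⟩ (fun b ⟨m, h₀, h⟩ => ?_) b
  refine ⟨m * (b + 1), mul_pos h₀ (lt_of_le_of_lt (nonneg b) (lt_add_one b)), fun i hi => ?_⟩
  rcases (lt_add_one_iff.1 hi).lt_or_eq with h' | rfl
  · exact (h i h').mul_right _
  · exact dvd_mul_left _ _

/-- `c` is a triple `(k, (m, n))`. -/
def IsTriple (c : M) : Prop := ∃ k m n, c = pr k (pr m n)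

/-- `i` belongs to the finite set with the code `c`. -/
def InCode (i c : M) : Prop :=
  ∃ k m n, c = pr k (pr m n) ∧ i < k ∧ ∃ q, (m * (i + 1) + 1) * q = n

/-- `c` is the least code of its finite set. -/
def IsSetCode (c : M) : Prop :=
  IsTriple c ∧ ∀ c', c' < c → IsTriple c' → ¬ ∀ i, InCode i c' ↔ InCode i c

theorem inCode_pr {i k m n : M} : InCode i (pr k (pr m n)) ↔ i < k ∧ m * (i + 1) + 1 ∣ n := by
  constructor
  · rintro ⟨k', m', n', h, hk, q, hq⟩
    obtain ⟨rfl, h₁⟩ := pr_inj.1 h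
    obtain ⟨rfl, rfl⟩ := pr_inj.1 h₁
    exact ⟨hk, q, hq.symm⟩
  · rintro ⟨hk, q, hq⟩
    exact ⟨k, m, n, rfl, hk, q, hq.symm⟩

theorem InCode.lt {i c : M} (h : InCode i c) : i < c := by
  obtain ⟨k, m, n, rfl, h, -⟩ := h
  exact h.trans_le (le_pr_left _ _)

theorem isTriple_iff {c : M} :
    IsTriple c ↔ c = pr (fst c) (pr (fst (snd c)) (snd (snd c))) := by
  constructor
  · rintro ⟨k, m, n, rfl⟩
    simp
  · exact fun h => ⟨_, _, _, h⟩

instance Rec.isTriple [RecFun f] : Rec fun x => IsTriple (f x) :=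
  Rec.congr (show Rec fun x => f x = pr (fst (f x)) (pr (fst (snd (f x))) (snd (snd (f x))))
    from inferInstance) fun _ => isTriple_iff

instance Rec.isTriple_self : Rec (IsTriple (M := M)) := Rec.isTriple (f := fun x => x)

instance Rec.inCode [RecFun f] [RecFun g] :
    Rec fun x => InCode (f x) (g x) := by
  refine Rec.congr (show Rec fun x => IsTriple (g x) ∧ f x < fst (g x) ∧
    fst (snd (g x)) * (f x + 1) + 1 ∣ snd (snd (g x)) from inferInstance) fun x => ?_
  constructor
  · rintro ⟨k, m, n, h, hk, q, hq⟩
    rw [h]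
    simp only [fst_pr, snd_pr]
    exact ⟨⟨k, m, n, rfl⟩, hk, q, hq.symm⟩
  · rintro ⟨⟨k, m, n, h⟩, h'⟩
    rw [h] at h' ⊢
    simp only [fst_pr, snd_pr] at h'
    exact inCode_pr.2 h'

instance Rec.isSetCode [RecFun f] :
    Rec fun x => IsSetCode (f x) := by
  refine Rec.congr (show Rec fun x => IsTriple (f x) ∧ ∀ c', c' < f x → IsTriple c' →
    ¬ ∀ i, i < f x → (InCode i c' ↔ InCode i (f x)) from inferInstance) fun x => ?_
  refine and_congr_right fun _ => forall₃_congr fun c' hc' _ => not_congr ?_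
  refine ⟨fun h i _ => h i, fun h i => ?_⟩
  by_cases hi : i < f x
  · exact h i hi
  · exact iff_of_false (fun h' => hi (h'.lt.trans hc')) fun h' => hi h'.lt

theorem le_of_dvd {a b : M} (hb : 0 < b) (h : a ∣ b) : a ≤ b := by
  obtain ⟨q, rfl⟩ := h
  exact le_of_mul_eq (pos_of_mul_pos_right hb (nonneg _)) (mul_comm q a)

/-- Bounded recursive predicates have codes: `n` is the product of the moduli of the elements. -/
theorem exists_code (P : M → Prop) [Rec P] (b : M) :
    ∃ c, IsSetCode c ∧ ∀ i, InCode i c ↔ i < b ∧ P i := by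
  obtain ⟨m, hm, hdvd⟩ := exists_common_multiple b
  have key : ∀ j : M, ∃ n, ∀ i, i < b → (m * (i + 1) + 1 ∣ n ↔ i < j ∧ P i) := by
    refine induction_exists _ ⟨1, fun i _ => iff_of_false (fun h => ?_)
      fun h => absurd h.1 (not_lt.2 (nonneg i))⟩ fun j ⟨n, hn⟩ => ?_
    · have h₁ : m * (i + 1) + 1 ≤ 1 := le_of_dvd zero_lt_one h
      have h₂ : 0 < m * (i + 1) := mul_pos hm (lt_of_le_of_lt (nonneg i) (lt_add_one i))
      exact absurd h₁ (not_le.2 (lt_add_of_pos_left 1 h₂))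
    · by_cases hj : j < b ∧ P j
      · refine ⟨n * (m * (j + 1) + 1), fun i hi => ?_⟩
        rcases eq_or_ne i j with rfl | hij
        · exact iff_of_true (dvd_mul_left _ _) ⟨lt_add_one i, hj.2⟩
        · have h₁ : m * (i + 1) + 1 ∣ n * (m * (j + 1) + 1) ↔ m * (i + 1) + 1 ∣ n := by
            refine ⟨fun h => ?_, fun h => h.mul_right _⟩
            rcases lt_or_gt_of_ne hij with h' | h'
            · obtain ⟨d, rfl⟩ := exists_add_of_le h'.le
              refine dvd_of_dvd_mul_modulus (Or.inr rfl) ?_ h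
              rcases eq_zero_or_eq_add_one d with rfl | ⟨d, rfl⟩
              · simp at h'
              · exact hdvd d (lt_of_lt_of_le (lt_of_lt_of_le (lt_add_one d) le_add_self) hj.1.le)
            · obtain ⟨d, rfl⟩ := exists_add_of_le h'.le
              refine dvd_of_dvd_mul_modulus (Or.inl rfl) ?_ h
              rcases eq_zero_or_eq_add_one d with rfl | ⟨d, rfl⟩
              · simp at h'
              · exact hdvd d (lt_of_lt_of_le (lt_of_lt_of_le (lt_add_one d) le_add_self) hi.le)
          rw [h₁, hn i hi, lt_add_one_iff, hij.le_iff_lt]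
      · refine ⟨n, fun i hi => ?_⟩
        rw [hn i hi, lt_add_one_iff]
        refine ⟨fun h => ⟨h.1.le, h.2⟩, fun h => ⟨h.1.lt_of_ne ?_, h.2⟩⟩
        rintro rfl
        exact hj ⟨hi, h.2⟩
  obtain ⟨n, hn⟩ := key b
  have h : ∃ c, IsTriple c ∧ ∀ i, InCode i c ↔ i < b ∧ P i := by
    refine ⟨pr b (pr m n), ⟨_, _, _, rfl⟩, fun i => ?_⟩
    rw [inCode_pr]
    exact ⟨fun h => (hn i h.1).1 h.2, fun h => ⟨h.1, (hn i h.1).2 h⟩⟩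
  have : Rec fun c => IsTriple c ∧ ∀ i, InCode i c ↔ i < b ∧ P i := by
    refine Rec.congr (show Rec fun c => IsTriple c ∧ ∀ i, i < c + b →
      (InCode i c ↔ i < b ∧ P i) from inferInstance) fun c =>
        and_congr_right fun _ => ⟨fun h i _ => h i, fun h i => ?_⟩
    by_cases hi : i < c + b
    · exact h i hi
    · exact iff_of_false (fun h' => hi (h'.lt.trans_le le_self_add))
        fun h' => hi (h'.1.trans_le le_add_self)
  obtain ⟨c, ⟨hc, hcP⟩, hmin⟩ := exists_least _ h
  exact ⟨c, ⟨hc, fun c' hc' ht h' => hmin c' hc' ⟨ht, fun i => (h' i).trans (hcP i)⟩⟩, hcP⟩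

/-- Recursive functions are bounded on initial segments. -/
theorem exists_bound_of_recFun (f : M → M) [RecFun f] (m : M) : ∃ b, ∀ i, i < m → f i < b := by
  refine induction_exists (fun m b : M => ∀ i, i < m → f i < b)
    ⟨0, fun i hi => absurd hi (not_lt.2 (nonneg i))⟩ (fun m ⟨b, hb⟩ => ⟨b + f m + 1, ?_⟩) m
  intro i hi
  rcases (lt_add_one_iff.1 hi).lt_or_eq with h' | rfl
  · exact (hb i h').trans_le (le_self_add.trans le_self_add)
  · exact lt_add_one_iff.2 le_add_self

/-! ### Codes of finite sequences -/

/-- `s(i) = x`. -/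
def Entry (s i x : M) : Prop := InCode (pr i x) s

/-- The length of `s` is `m`. -/
def HasLength (s m : M) : Prop := ∀ i, i < m ↔ ∃ x, Entry s i x

/-- `s` is the code of a finite sequence. -/
def IsSeq (s : M) : Prop :=
  IsSetCode s ∧ (∀ p, InCode p s → ∃ i x, p = pr i x) ∧
  (∀ i x y, Entry s i x → Entry s i y → x = y) ∧ ∃ m, HasLength s m

/-- `x` is a value of the sequence `s`. -/
def Range (s x : M) : Prop := ∃ i, Entry s i x

instance Rec.entry [RecFun f] [RecFun g] [RecFun h] :
    Rec fun x => Entry (f x) (g x) (h x) :=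
  inferInstanceAs (Rec fun x => InCode (pr (g x) (h x)) (f x))

theorem Entry.index_lt {s i x : M} (h : Entry s i x) : i < s := (le_pr_left _ _).trans_lt h.lt

theorem Entry.value_lt {s i x : M} (h : Entry s i x) : x < s := (le_pr_right _ _).trans_lt h.lt

theorem Range.lt {s x : M} (h : Range s x) : x < s := by
  obtain ⟨i, h⟩ := h
  exact h.value_lt

instance Rec.range [RecFun f] [RecFun g] :
    Rec fun x => Range (f x) (g x) :=
  Rec.congr (show Rec fun x => ∃ i, i < f x ∧ Entry (f x) i (g x) from inferInstance) fun _ =>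
    ⟨fun ⟨i, h⟩ => ⟨i, h.index_lt, h⟩, fun ⟨i, _, h⟩ => ⟨i, h⟩⟩

theorem HasLength.le {s m : M} (h : HasLength s m) : m ≤ s := by
  by_contra h'
  obtain ⟨x, hx⟩ := (h s).1 (not_le.1 h')
  exact hx.index_lt.false

instance Rec.hasLength [RecFun f] [RecFun g] :
    Rec fun x => HasLength (f x) (g x) := by
  refine Rec.congr (show Rec fun x => ∀ i, i < f x + g x →
    (i < g x ↔ ∃ y, y < f x ∧ Entry (f x) i y) from inferInstance) fun x => ?_
  constructor
  · exact fun h i _ => (h i).trans ⟨fun ⟨y, hy⟩ => ⟨y, hy.value_lt, hy⟩, fun ⟨y, _, hy⟩ => ⟨y, hy⟩⟩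
  · intro h i
    by_cases hi : i < f x + g x
    · exact (h i hi).trans ⟨fun ⟨y, _, hy⟩ => ⟨y, hy⟩, fun ⟨y, hy⟩ => ⟨y, hy.value_lt, hy⟩⟩
    · exact iff_of_false (fun h' => hi (h'.trans_le le_add_self))
        fun ⟨y, hy⟩ => hi (hy.index_lt.trans_le le_self_add)

instance Rec.isSeq [RecFun f] : Rec fun x => IsSeq (f x) := by
  refine Rec.congr (show Rec fun x => IsSetCode (f x) ∧
    (∀ p, p < f x → InCode p (f x) → p = pr (fst p) (snd p)) ∧
    (∀ i, i < f x → ∀ a, a < f x → ∀ b, b < f x → Entry (f x) i a → Entry (f x) i b → a = b) ∧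
    ∃ m, m ≤ f x ∧ HasLength (f x) m from inferInstance) fun x => ?_
  refine and_congr_right fun _ => and_congr ⟨fun h p _ hp => ?_, fun h p hp => ?_⟩
    (and_congr ⟨fun h i _ a _ b _ => h i a b, fun h i a b ha hb => ?_⟩
    ⟨fun ⟨m, hm⟩ => ⟨m, hm.le, hm⟩, fun ⟨m, _, hm⟩ => ⟨m, hm⟩⟩)
  · exact (pr_fst_snd (h p hp)).symm
  · exact ⟨_, _, h p hp.lt hp⟩
  · exact h i ha.index_lt a ha.value_lt b hb.value_lt ha hb

instance Rec.isSeq_self : Rec (IsSeq (M := M)) := Rec.isSeq (f := fun x => x)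

/-- `s` is the code of `⟨g 0, …, g (m - 1)⟩`. -/
def Codes (s m : M) (g : M → M) : Prop := IsSeq s ∧ ∀ i x, Entry s i x ↔ i < m ∧ x = g i

theorem Codes.hasLength {s m : M} (h : Codes s m g) : HasLength s m := fun i => by
  simp [h.2]

theorem Codes.range_iff {s m x : M} (h : Codes s m g) : Range s x ↔ ∃ i < m, x = g i := by
  simp [Range, h.2]

theorem HasLength.unique {s m m' : M} (h : HasLength s m) (h' : HasLength s m') : m = m' := by
  refine le_antisymm (not_lt.1 fun hlt => ?_) (not_lt.1 fun hlt => ?_)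
  · exact ((h' m').2 ((h m').1 hlt)).false
  · exact ((h m).2 ((h' m).1 hlt)).false

theorem exists_codes (g : M → M) [RecFun g] (m : M) : ∃ s, Codes s m g := by
  obtain ⟨b, hb⟩ := exists_bound_of_recFun g m
  obtain ⟨s, hs, hsP⟩ := exists_code
    (fun p : M => p = pr (fst p) (snd p) ∧ fst p < m ∧ snd p = g (fst p)) (pr m b + 1)
  have key : ∀ i x, Entry s i x ↔ i < m ∧ x = g i := by
    intro i x
    rw [Entry, hsP]
    simp only [fst_pr, snd_pr, true_and]
    refine and_iff_right_of_imp ?_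
    rintro ⟨h, rfl⟩
    exact lt_add_one_iff.2 (pr_le_pr h.le (hb i h).le)
  refine ⟨s, ⟨hs, fun p hp => ⟨_, _, ((hsP p).1 hp).2.1⟩, fun i x y hx hy => ?_, m, fun i => ?_⟩,
    key⟩
  · rw [((key i x).1 hx).2, ((key i y).1 hy).2]
  · simp [key]

open Classical in
theorem IsSeq.exists_codes {s : M} (hs : IsSeq s) : ∃ m, ∃ g : M → M, RecFun g ∧ Codes s m g := by
  obtain ⟨m, hm⟩ := hs.2.2.2
  let g : M → M := fun i => if hi : ∃ x, Entry s i x then hi.choose else 0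
  have hg : ∀ i x, Entry s i x → x = g i := fun i x hx => by
    have hi : ∃ x, Entry s i x := ⟨x, hx⟩
    simp only [g, dif_pos hi]
    exact hs.2.2.1 i _ _ hx hi.choose_spec
  have hg₀ : ∀ i, (¬ ∃ x, Entry s i x) → g i = 0 := fun i hi => dif_neg hi
  refine ⟨m, g, .of_graph ?_, hs, fun i x => ⟨fun h => ⟨(hm i).2 ⟨x, h⟩, hg i x h⟩, ?_⟩⟩
  · refine Rec.congr (show Rec fun z => Entry s (fst z) (snd z) ∨
      (¬ ∃ x, x < s ∧ Entry s (fst z) x) ∧ snd z = 0 from inferInstance) fun z => ?_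
    by_cases hz : ∃ x, Entry s (fst z) x
    · obtain ⟨x, hx⟩ := hz
      have : ∃ x, x < s ∧ Entry s (fst z) x := ⟨x, hx.value_lt, hx⟩
      simp only [this, not_true_eq_false, false_and, or_false]
      exact ⟨fun h => by rw [h, ← hg _ _ hx]; exact hx, hg _ _⟩
    · have h' : ¬ ∃ x, x < s ∧ Entry s (fst z) x := fun ⟨x, _, hx⟩ => hz ⟨x, hx⟩
      rw [hg₀ _ hz]
      simp only [h', not_false_eq_true, true_and]
      exact ⟨Or.inr, fun h => h.resolve_left fun h => hz ⟨_, h⟩⟩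
  · rintro ⟨hi, rfl⟩
    obtain ⟨x, hx⟩ := (hm i).1 hi
    rwa [← hg _ _ hx]

/-- Bounded recursive predicates are ranges of finite sequences. -/
theorem exists_isSeq_range (P : M → Prop) [Rec P] (b : M) :
    ∃ l, IsSeq l ∧ ∀ x, Range l x ↔ x < b ∧ P x := by
  classical
  by_cases h : ∃ a < b, P a
  · obtain ⟨a, ha, haP⟩ := h
    obtain ⟨l, hl⟩ := RCAModel.exists_codes (fun i => if P i then i else a) b
    refine ⟨l, hl.1, fun x => ?_⟩
    rw [hl.range_iff]
    constructor
    · rintro ⟨i, hi, rfl⟩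
      by_cases hPi : P i
      · simpa [hPi] using hi
      · simpa [hPi] using ⟨ha, haP⟩
    · rintro ⟨hx, hxP⟩
      exact ⟨x, hx, by simp [hxP]⟩
  · obtain ⟨l, hl⟩ := RCAModel.exists_codes (fun i : M => i) 0
    refine ⟨l, hl.1, fun x => ?_⟩
    rw [hl.range_iff]
    exact iff_of_false (fun ⟨i, hi, _⟩ => absurd hi (not_lt.2 (nonneg i)))
      fun h' => h ⟨x, h'⟩

end RCAModel

end SecondOrderArithmetic

namespace SecondOrderArithmetic

open RCAModel

set_option synthInstance.maxSize 10000
set_option synthInstance.maxHeartbeats 400000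

variable {M : Type} [RCAModel M] {P : M → Prop} {f g h : M → M}

namespace RCAModel

/-! ### Enumerations without repetitions, and the finite pigeonhole principle -/

/-- The sequence `s` has no repetitions. -/
def Inj (s : M) : Prop := ∀ i j x, Entry s i x → Entry s j x → i = j

instance Rec.inj [RecFun f] : Rec fun x => Inj (f x) :=
  Rec.congr (show Rec fun x => ∀ i, i < f x → ∀ j, j < f x → ∀ a, a < f x →
    Entry (f x) i a → Entry (f x) j a → i = j from inferInstance) fun _ =>
    ⟨fun h i _ j _ a _ => h i j a,
      fun h i j a hi hj => h i hi.index_lt j hj.index_lt a hi.value_lt hi hj⟩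

instance Rec.inj_self : Rec (Inj (M := M)) := Rec.inj (f := fun x => x)

/-- `t` enumerates the elements of `P` below `b` without repetitions, and `y` is their number. -/
def Enum (P : M → Prop) (b y t : M) : Prop :=
  IsSeq t ∧ Inj t ∧ HasLength t y ∧ ∀ x, Range t x ↔ x < b ∧ P x

instance Rec.enum [Rec P] [RecFun f] [RecFun g] [RecFun h] :
    Rec fun x => Enum P (f x) (g x) (h x) := by
  refine Rec.congr (show Rec fun x => IsSeq (h x) ∧ Inj (h x) ∧ HasLength (h x) (g x) ∧
    ∀ y, y < h x + f x → (Range (h x) y ↔ y < f x ∧ P y) from inferInstance) fun x => ?_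
  refine and_congr_right fun _ => and_congr_right fun _ => and_congr_right fun _ =>
    ⟨fun h y _ => h y, fun h' y => ?_⟩
  by_cases hy : y < h x + f x
  · exact h' y hy
  · exact iff_of_false (fun h => hy (h.lt.trans_le le_self_add))
      fun h => hy (h.1.trans_le le_add_self)

theorem Enum.congr {P Q : M → Prop} {b y t : M} (h : Enum P b y t)
    (hPQ : ∀ x < b, (P x ↔ Q x)) : Enum Q b y t :=
  ⟨h.1, h.2.1, h.2.2.1, fun x => (h.2.2.2 x).trans (and_congr_right fun hx => hPQ x hx)⟩

theorem Enum.mono {b c y t : M} (h : Enum P b y t) (hbc : b ≤ c)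
    (hP : ∀ x, b ≤ x → x < c → ¬ P x) : Enum P c y t :=
  ⟨h.1, h.2.1, h.2.2.1, fun x => (h.2.2.2 x).trans ⟨fun hx => ⟨hx.1.trans_le hbc, hx.2⟩,
    fun hx => ⟨not_le.1 fun h' => hP x h' hx.1 hx.2, hx.2⟩⟩⟩

theorem exists_enum_zero (P : M → Prop) : ∃ t, Enum P 0 0 t := by
  obtain ⟨t, ht⟩ := exists_codes (fun x : M => x) 0
  have h₀ : ∀ i x, ¬ Entry t i x := fun i x h => absurd ((ht.2 i x).1 h).1 (not_lt.2 (nonneg i))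
  exact ⟨t, ht.1, fun i j x h => (h₀ _ _ h).elim, ht.hasLength, fun x =>
    iff_of_false (fun ⟨i, h⟩ => h₀ _ _ h) fun h => absurd h.1 (not_lt.2 (nonneg x))⟩

/-- An enumeration can be continued by the next element. -/
theorem Enum.append {b y t : M} (ht : Enum P b y t) (hb : P b) :
    ∃ t', Enum P (b + 1) (y + 1) t' := by
  classical
  obtain ⟨ht, hinj, hlen, hran⟩ := ht
  obtain ⟨m, g, hg, hm⟩ := ht.exists_codes
  obtain rfl := hm.hasLength.unique hlen
  obtain ⟨t', ht'⟩ := exists_codes (fun i => if i = m then b else g i) (m + 1)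
  have key : ∀ i x, Entry t' i x ↔ Entry t i x ∨ i = m ∧ x = b := by
    intro i x
    rw [ht'.2, hm.2, lt_add_one_iff, le_iff_lt_or_eq]
    by_cases hi : i = m
    · simp [hi]
    · simp [hi]
  have hlt : ∀ i, ¬ Entry t i b := fun i hi => ((hran b).1 ⟨i, hi⟩).1.false
  refine ⟨t', ht'.1, fun i j x hi hj => ?_, ht'.hasLength, fun x => ?_⟩
  · rcases (key i x).1 hi with hi | ⟨rfl, rfl⟩
    · rcases (key j x).1 hj with hj | ⟨rfl, rfl⟩
      · exact hinj i j x hi hj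
      · exact (hlt _ hi).elim
    · rcases (key j x).1 hj with hj | ⟨rfl, -⟩
      · exact (hlt _ hj).elim
      · rfl
  · have : Range t' x ↔ Range t x ∨ x = b := by
      simp only [Range, key]
      constructor
      · rintro ⟨i, hi | ⟨-, rfl⟩⟩
        · exact Or.inl ⟨i, hi⟩
        · exact Or.inr rfl
      · rintro (⟨i, hi⟩ | rfl)
        · exact ⟨i, Or.inl hi⟩
        · exact ⟨m, Or.inr ⟨rfl, rfl⟩⟩
    rw [this, hran, lt_add_one_iff, le_iff_lt_or_eq]
    constructor
    · rintro (h | rfl)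
      · exact ⟨Or.inl h.1, h.2⟩
      · exact ⟨Or.inr rfl, hb⟩
    · rintro ⟨h | rfl, hP⟩
      · exact Or.inl ⟨h, hP⟩
      · exact Or.inr rfl

theorem Enum.exists_of_le [Rec P] {b y t c : M} (ht : Enum P b y t) (hbc : b ≤ c) :
    ∃ y' t', y ≤ y' ∧ Enum P c y' t' := by
  obtain ⟨d, rfl⟩ := exists_add_of_le hbc
  have key := induction_exists (fun d w : M => y ≤ fst w ∧ Enum P (b + d) (fst w) (snd w))
    ⟨pr y t, by simpa using ht⟩ (fun d ⟨w, hw, hw'⟩ => ?_) d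
  · obtain ⟨w, hw⟩ := key
    exact ⟨_, _, hw⟩
  · rw [← add_assoc]
    by_cases h : P (b + d)
    · obtain ⟨t', ht'⟩ := hw'.append h
      exact ⟨pr (fst w + 1) t', by simpa using ⟨hw.trans le_self_add, ht'⟩⟩
    · refine ⟨w, hw, hw'.mono le_self_add fun x hx hx' hPx => h ?_⟩
      rwa [le_antisymm hx (lt_add_one_iff.1 hx')]

/-- An unbounded recursive predicate has finite parts of every size. -/
theorem exists_enum_of_unbounded (P : M → Prop) [Rec P] (hP : ∀ b, ∃ x, b ≤ x ∧ P x) (y : M) :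
    ∃ b t, Enum P b y t := by
  have key := induction_exists (fun y w : M => Enum P (fst w) y (snd w)) ?_ (fun y ⟨w, hw⟩ => ?_) y
  · obtain ⟨w, hw⟩ := key
    exact ⟨_, _, hw⟩
  · obtain ⟨t, ht⟩ := exists_enum_zero P
    exact ⟨pr 0 t, by simpa using ht⟩
  · obtain ⟨a, ⟨ha, haP⟩, hmin⟩ := exists_least (fun x => fst w ≤ x ∧ P x) (hP (fst w))
    obtain ⟨t, ht⟩ := (hw.mono ha fun x hx hx' hPx => hmin x hx' ⟨hx, hPx⟩).append haP
    exact ⟨pr (a + 1) t, by simpa using ht⟩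

/-- The finite pigeonhole principle. Sequences are shortened and their values are decreased
simultaneously. -/
theorem le_of_injective (g : M → M) [RecFun g] {m y : M} (hlt : ∀ i < m, g i < y)
    (hinj : ∀ i < m, ∀ j < m, g i = g j → i = j) : m ≤ y := by
  classical
  by_contra h
  have hym : ∀ i, i < y + 1 → i < m := fun i hi => (lt_add_one_iff.1 hi).trans_lt (not_le.1 h)
  have key := induction_exists (fun z s : M => z ≤ y → ∃ u, u ≤ y ∧ u + z = y ∧ IsSeq s ∧
    HasLength s (u + 1) ∧ Inj s ∧ ∀ x, x < s → Range s x → x < u) ?_ (fun z ⟨s, hs⟩ => ?_) y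
  · obtain ⟨s, hs⟩ := key
    obtain ⟨u, -, hu, -, hlen, -, hran⟩ := hs le_rfl
    obtain rfl : u = 0 := by
      have : u + y = 0 + y := by rw [hu, zero_add]
      exact add_right_cancel this
    obtain ⟨x, hx⟩ := (hlen 0).1 (by simp)
    exact absurd (hran x hx.value_lt ⟨_, hx⟩) (not_lt.2 (nonneg x))
  · obtain ⟨s, hs⟩ := exists_codes g (y + 1)
    refine ⟨s, fun _ => ⟨y, le_rfl, add_zero y, hs.1, hs.hasLength, fun i j x hi' hj' => ?_,
      fun x _ hx => ?_⟩⟩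
    · obtain ⟨hi, rfl⟩ := (hs.2 i x).1 hi'
      obtain ⟨hj, h'⟩ := (hs.2 j _).1 hj'
      exact hinj i (hym i hi) j (hym j hj) h'
    · obtain ⟨i, hi, rfl⟩ := hs.range_iff.1 hx
      exact hlt i (hym i hi)
  · by_cases hz : z + 1 ≤ y
    · obtain ⟨u, huy, hu, hs, hlen, hinj, hran⟩ := hs (le_self_add.trans hz)
      obtain ⟨v, rfl⟩ : ∃ v, u = v + 1 := by
        refine (eq_zero_or_eq_add_one u).resolve_left ?_
        rintro rfl
        rw [zero_add] at hu
        exact absurd hz (not_le.2 (hu ▸ lt_add_one z))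
      obtain ⟨m, g, hg, hm⟩ := hs.exists_codes
      obtain rfl := hm.hasLength.unique hlen
      have hlt : ∀ i < v + 1 + 1, g i < v + 1 := fun i hi => by
        have := (hm.2 i (g i)).2 ⟨hi, rfl⟩
        exact hran _ this.value_lt ⟨i, this⟩
      have hinj : ∀ i < v + 1 + 1, ∀ j < v + 1 + 1, g i = g j → i = j := fun i hi j hj h =>
        hinj i j (g i) ((hm.2 i (g i)).2 ⟨hi, rfl⟩) ((hm.2 j (g i)).2 ⟨hj, h⟩)
      -- The value `v` is replaced by the last value `g (v + 1)`, and the last entry is dropped.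
      obtain ⟨s', hs'⟩ := exists_codes (fun i => if g i = v then g (v + 1) else g i) (v + 1)
      have hne : ∀ i < v + 1, g i ≠ g (v + 1) := fun i hi h =>
        hi.ne (hinj i (hi.trans (lt_add_one _)) _ (lt_add_one _) h)
      refine ⟨s', fun _ => ⟨v, le_self_add.trans huy, ?_, hs'.1, hs'.hasLength,
        fun i j x hi' hj' => ?_, fun x _ hx => ?_⟩⟩
      · rw [← hu]
        ring
      · obtain ⟨hi, rfl⟩ := (hs'.2 i x).1 hi'
        obtain ⟨hj, h'⟩ := (hs'.2 j _).1 hj'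
        have hij := hinj i (hi.trans (lt_add_one _)) j (hj.trans (lt_add_one _))
        by_cases h₁ : g i = v
        · by_cases h₂ : g j = v
          · exact hij (h₁.trans h₂.symm)
          · simp only [h₁, h₂, if_true, if_false] at h'
            exact (hne j hj h'.symm).elim
        · by_cases h₂ : g j = v
          · simp only [h₁, h₂, if_true, if_false] at h'
            exact (hne i hi h').elim
          · simp only [h₁, h₂, if_false] at h'
            exact hij h'
      · obtain ⟨i, hi, rfl⟩ := hs'.range_iff.1 hx
        by_cases h₁ : g i = v
        · simp only [h₁, if_true]
          refine (lt_add_one_iff.1 (hlt _ (lt_add_one _))).lt_of_ne fun h₂ => ?_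
          exact hne i hi (h₁.trans h₂.symm)
        · simp only [h₁, if_false]
          exact (lt_add_one_iff.1 (hlt i (hi.trans (lt_add_one _)))).lt_of_ne h₁
    · exact ⟨0, fun h' => (hz h').elim⟩

end RCAModel

end SecondOrderArithmetic

namespace SecondOrderArithmetic

open RCAModel

set_option synthInstance.maxSize 10000
set_option synthInstance.maxHeartbeats 400000

namespace RCAModel

/-! ### The principles in a model -/

variable {M : Type} [RCAModel M]

/-- `f` is the graph of a function from `A` to `B`. -/
def IsFun (A B : M → Prop) (f : Set M) : Prop :=
  (∀ p, p ∈ f → ∃ x y, A x ∧ B y ∧ p = pr x y) ∧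
  ∀ x, A x → ∃ y, pr x y ∈ f ∧ ∀ z, pr x z ∈ f → z = y

/-- The model contains a bijection from `{j | j < m}` onto `A`. -/
def CardEq (A : M → Prop) (m : M) : Prop :=
  ∃ g ∈ sets (M := M), IsFun (fun x => x < m) A g ∧
    (∀ x y z, pr x z ∈ g → pr y z ∈ g → x = y) ∧ ∀ z, A z → ∃ x, pr x z ∈ g

/-- In the model, `A` has more than `m` elements. -/
def CardGt (A : M → Prop) (m : M) : Prop := ∃ m', CardEq A m' ∧ m < m'

/-- `x` is a value of the `m`-th member of the sequence `L`. -/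
def RangeAt (L : Set M) (m x : M) : Prop := ∃ l, pr m l ∈ L ∧ Range l x

/-- `L` is a sequence of codes of finite sequences. -/
def IsSeqOfSeq (L : Set M) : Prop :=
  IsFun (fun _ => True) (fun _ => True) L ∧ ∀ m l, pr m l ∈ L → IsSeq l

/-- `L` is a nested sequence with union. -/
def IsNested (L : Set M) : Prop :=
  IsSeqOfSeq L ∧ (∀ m x, RangeAt L m x → RangeAt L (m + 1) x) ∧
  ∃ U ∈ sets (M := M), ∀ x, x ∈ U ↔ ∃ m, RangeAt L m x

/-- `L` is weakly convergent. -/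
def WeaklyConv (L : Set M) : Prop :=
  ∃ A ∈ sets (M := M), IsSeqOfSeq L ∧ (¬ ∃ k, ∀ i, i ∈ A → i < k) ∧
    ∀ B ∈ sets (M := M), (∃ k, ∀ i, i ∈ B → i < k) →
      ∃ i, ∀ j, i ≤ j → ∀ x, RangeAt L j x ∧ x ∈ B ↔ x ∈ A ∧ x ∈ B

/-- `F` depends only on the range of its argument. -/
def Extensional (F : Set M) : Prop :=
  ∀ l l', IsSeq l → IsSeq l' → (∀ x, Range l x ↔ Range l' x) → ∃ y, pr l y ∈ F ∧ pr l' y ∈ F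

/-- `F` is eventually constant along `L`. -/
def Stabilizes (F L : Set M) : Prop :=
  ∃ i, ∀ j, i ≤ j → ∃ a b y, pr i a ∈ L ∧ pr j b ∈ L ∧ pr a y ∈ F ∧ pr b y ∈ F

/-- `F` is asymptotically stable. -/
def InAS (F : Set M) : Prop :=
  IsFun (fun _ => True) (fun _ => True) F ∧ Extensional F ∧
    ∀ L ∈ sets (M := M), IsNested L → Stabilizes F L

/-- `F` is asymptotically stable near infinite sets. -/
def InASNIS (F : Set M) : Prop :=
  IsFun (fun _ => True) (fun _ => True) F ∧ Extensional F ∧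
    ∀ L ∈ sets (M := M), WeaklyConv L → Stabilizes F L

/-- The range of `l` has more than `F(l)` elements. -/
def IsBig (F : Set M) (l : M) : Prop := ∃ y, pr l y ∈ F ∧ CardGt (Range l) y

variable (M)

/-- The infinite pigeonhole principle, in the model `M`. -/
def SatIPP : Prop :=
  ∀ n : M, ∀ f ∈ sets (M := M), IsFun (fun _ => True) (fun j => j ≤ n) f →
    ∃ c, c ≤ n ∧ ∃ A ∈ sets (M := M), (∀ x, x ∈ A ↔ pr x c ∈ f) ∧ ¬ ∃ k, ∀ i, i ∈ A → i < k

/-- The second finitary pigeonhole principle, in the model `M`. -/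
def SatFIPP2 : Prop :=
  ∀ n : M, ∀ F ∈ sets (M := M), InAS F → ∃ k, ∀ f ∈ sets (M := M),
    IsFun (fun j => j ≤ k) (fun j => j ≤ n) f → ∃ l, IsSeq l ∧
      (∀ x, Range l x → x ≤ k) ∧ IsBig F l ∧
      ∀ x y, Range l x → Range l y → ∃ c, pr x c ∈ f ∧ pr y c ∈ f

/-- The third finitary pigeonhole principle, in the model `M`. -/
def SatFIPP3 : Prop :=
  ∀ n : M, ∀ F ∈ sets (M := M), InASNIS F → ∃ k, ∀ f ∈ sets (M := M),
    IsFun (fun j => j ≤ k) (fun j => j ≤ n) f → ∃ l, IsSeq l ∧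
      ∃ c, c ≤ n ∧ (∀ x, Range l x ↔ pr x c ∈ f) ∧ IsBig F l

/-- Weak König's lemma, in the model `M`. -/
def SatWKL : Prop :=
  ∀ T ∈ sets (M := M),
    ((∀ s, s ∈ T → IsSeq s ∧ ∀ x, Range s x → x ≤ 1) ∧
      ∀ s t, s ∈ T → IsSeq t → (∀ i x, Entry t i x → Entry s i x) → t ∈ T) →
    (¬ ∃ k, ∀ i, i ∈ T → i < k) →
    ∃ g ∈ sets (M := M), IsFun (fun _ => True) (fun j => j ≤ 1) g ∧
      ∀ m, ∃ s, (IsSeq s ∧ HasLength s m ∧ ∀ i, i < m → ∃ x, Entry s i x ∧ pr i x ∈ g) ∧ s ∈ T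

end RCAModel

/-! ### The sentences and their meaning -/

section

variable {M : Type} [RCAModel M] {e : ℕ → M} {s : ℕ → Set M}

theorem push_zero {A : Type} (a : A) (e : ℕ → A) : push a e 0 = a := rfl

theorem push_succ {A : Type} (a : A) (e : ℕ → A) (i : ℕ) : push a e (i + 1) = e i := rfl

theorem NumB.zero_apply (d : ℕ) : (0 : NumB) d = Tm.zero := rfl

theorem NumB.one_apply (d : ℕ) : (1 : NumB) d = Tm.one := rfl

/-- The variables bound by `allN` and `exN` are functions on `ℕ` rather than `NumB`s, so `simp`
needs this and the following equations in this form. -/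
theorem pair_apply (t u : ℕ → Tm) (d : ℕ) : pair t u d = Tm.pr (t d) (u d) := rfl

theorem pair_pair_apply (t u v : ℕ → Tm) (d : ℕ) :
    pair t (pair u v) d = Tm.pr (t d) (Tm.pr (u d) (v d)) := rfl

theorem pair_add_one_apply (t v : ℕ → Tm) (d : ℕ) :
    pair (@HAdd.hAdd NumB NumB NumB _ t 1) v d = Tm.pr (Tm.add (t d) Tm.one) (v d) := rfl

/-! Unfolding all definitions on both sides yields the same statements. -/

theorem holds_IPP : IPP.Holds sets e s ↔ SatIPP M := by
  simp only [IPP, FmB.close, allN, exN, allS, exS, FmB.eq, FmB.lt, FmB.mem, FmB.neg, FmB.imp,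
    FmB.and, FmB.or, FmB.iff, FmB.le, isFun, isInfinite, isFinite, ofSet, fiber, val, seg, univC,
    eqC, holds_exN, holds_exS, holds_iff, holds_and, holds_or, holds_neg, Fm.Holds,
    Nat.reduceSub, Nat.reduceAdd, pair_apply, Tm.val, val_pr, push_zero, push_succ,
    SatIPP, IsFun, ← le_iff_lt_or_eq]

set_option maxHeartbeats 4000000 in
theorem holds_FIPP2 : FIPP2.Holds sets e s ↔ SatFIPP2 M := by
  simp only [FIPP2, FmB.close, allN, exN, allS, exS, FmB.eq, FmB.lt, FmB.mem, FmB.neg, FmB.imp,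
    FmB.and, FmB.or, FmB.iff, FmB.le, isFun, val, seg, univC, inAS, extensional,
    isNested, isSeqOfSeq, rangeAt, subC, stabilizes, isSeq, isSetCode, isTriple, inCode, lhEq,
    entry, range, isBig, cardGt, cardEq, below, constantOn,
    eqC, holds_exN, holds_exS, holds_iff, holds_and, holds_or, holds_neg, Fm.Holds,
    Nat.reduceSub, Nat.reduceAdd, pair_apply, pair_pair_apply, pair_add_one_apply, Tm.val,
    val_pr, push_zero, push_succ,
    SatFIPP2, IsFun, ← le_iff_lt_or_eq, InAS, Extensional, IsNested, IsSeqOfSeq, RangeAt,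
    Stabilizes, IsSeq, IsSetCode, IsTriple, InCode, HasLength, Entry, Range, IsBig, CardGt, CardEq]

set_option maxHeartbeats 4000000 in
theorem holds_FIPP3 : FIPP3.Holds sets e s ↔ SatFIPP3 M := by
  simp only [FIPP3, FmB.close, allN, exN, allS, exS, FmB.eq, FmB.lt, FmB.mem, FmB.neg, FmB.imp,
    FmB.and, FmB.or, FmB.iff, FmB.le, isFun, isInfinite, isFinite, ofSet, fiber, val, seg, univC,
    inASNIS, extensional, weaklyConv, weaklyConvTo, interC,
    isSeqOfSeq, rangeAt, stabilizes, isSeq, isSetCode, isTriple, inCode, lhEq,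
    entry, range, isBig, cardGt, cardEq, below,
    eqC, holds_exN, holds_exS, holds_iff, holds_and, holds_or, holds_neg, Fm.Holds,
    Nat.reduceSub, Nat.reduceAdd, pair_apply, pair_pair_apply, Tm.val, val_pr, push_zero, push_succ,
    SatFIPP3, IsFun, ← le_iff_lt_or_eq, InASNIS, Extensional, WeaklyConv, IsSeqOfSeq, RangeAt,
    Stabilizes, IsSeq, IsSetCode, IsTriple, InCode, HasLength, Entry, Range, IsBig, CardGt, CardEq]

set_option maxHeartbeats 4000000 in
theorem holds_WKL : WKL.Holds sets e s ↔ SatWKL M := by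
  simp only [WKL, FmB.close, allN, exN, allS, exS, FmB.eq, FmB.lt, FmB.mem, FmB.neg, FmB.imp,
    FmB.and, FmB.or, FmB.iff, FmB.le, isFun, isInfinite, isFinite, ofSet, val, seg, univC,
    isBinaryTree, isInitial, subC, isSeq, isSetCode, isTriple, inCode, lhEq,
    entry, range,
    holds_exN, holds_exS, holds_iff, holds_and, holds_or, holds_neg, Fm.Holds,
    Nat.reduceSub, Nat.reduceAdd, NumB.one_apply, pair_apply, pair_pair_apply, Tm.val, val_pr,
    push_zero, push_succ,
    SatWKL, IsFun, ← le_iff_lt_or_eq, IsSeq, IsSetCode, IsTriple, InCode, HasLength, Entry, Range]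

end

end SecondOrderArithmetic

namespace SecondOrderArithmetic

open RCAModel

set_option synthInstance.maxSize 10000
set_option synthInstance.maxHeartbeats 400000

variable {M : Type} [RCAModel M] {f g h : M → M}

namespace RCAModel

/-! ### Functions and cardinalities in a model -/

/-- The graph of the restriction of `g` to `A`. -/
def graphOn (A : M → Prop) (g : M → M) : Set M := {z | A (fst z) ∧ z = pr (fst z) (g (fst z))}

theorem mem_graphOn {A : M → Prop} {x y : M} : pr x y ∈ graphOn A g ↔ A x ∧ y = g x := by
  simp [graphOn, pr_inj]

theorem graphOn_mem_sets (A : M → Prop) [Rec A] (g : M → M) [RecFun g] :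
    graphOn A g ∈ sets (M := M) :=
  (inferInstance : Rec fun z => A (fst z) ∧ z = pr (fst z) (g (fst z))).1

theorem isFun_graphOn {A B : M → Prop} (h : ∀ x, A x → B (g x)) : IsFun A B (graphOn A g) := by
  refine ⟨fun p hp => ⟨fst p, g (fst p), hp.1, h _ hp.1, hp.2⟩, fun x hx => ⟨g x, ?_, ?_⟩⟩
  · exact mem_graphOn.2 ⟨hx, rfl⟩
  · exact fun z hz => (mem_graphOn.1 hz).2

open Classical in
/-- A function in the model is given by a recursive function. -/
theorem IsFun.exists_recFun {A B : M → Prop} [Rec A] {F : Set M} (h : IsFun A B F)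
    (hF : F ∈ sets (M := M)) :
    ∃ g : M → M, RecFun g ∧ (∀ x, A x → B (g x)) ∧ ∀ x y, pr x y ∈ F ↔ A x ∧ y = g x := by
  have : IsSet F := ⟨hF⟩
  choose g hg hg' using h.2
  let g' : M → M := fun x => if hx : A x then g x hx else 0
  have hg₁ : ∀ x (hx : A x), g' x = g x hx := fun x hx => dif_pos hx
  have hg₀ : ∀ x, ¬ A x → g' x = 0 := fun x hx => dif_neg hx
  have key : ∀ x y, pr x y ∈ F ↔ A x ∧ y = g' x := fun x y => by
    constructor
    · intro hxy
      obtain ⟨x', y', hx, hy, hp⟩ := h.1 _ hxy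
      obtain ⟨rfl, rfl⟩ := (pr_inj).1 hp
      exact ⟨hx, (hg' _ hx _ hxy).trans (hg₁ _ hx).symm⟩
    · rintro ⟨hx, rfl⟩
      rw [hg₁ x hx]
      exact hg x hx
  refine ⟨g', .of_graph ?_, fun x hx => ?_, key⟩
  · refine Rec.congr (show Rec fun z => pr (fst z) (snd z) ∈ F ∨ ¬ A (fst z) ∧ snd z = 0
      from inferInstance) fun z => ?_
    rw [key]
    by_cases hz : A (fst z)
    · simp [hz]
    · simp [hz, hg₀ _ hz]
  · obtain ⟨x', y', hx', hy, hp⟩ := h.1 _ ((key x _).2 ⟨hx, rfl⟩)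
    obtain ⟨rfl, hy'⟩ := (pr_inj).1 hp
    rwa [hy']

/-- Minimization. -/
theorem exists_recFun_least (R : M → M → Prop) [hR : Rec fun z => R (fst z) (snd z)]
    (h : ∀ x, ∃ y, R x y) :
    ∃ g : M → M, RecFun g ∧ ∀ x, R x (g x) ∧ ∀ y < g x, ¬ R x y := by
  have h' : ∀ x, ∃ y, R x y ∧ ∀ z < y, ¬ R x z := fun x => by
    have : Rec (R x) := Rec.congr (Rec.comp hR (RecFun.mk_pr (f := fun _ => x) (g := fun y => y)))
      fun y => by simp
    exact exists_least (R x) (h x)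
  choose g hg hg' using h'
  refine ⟨g, .of_graph ?_, fun x => ⟨hg x, hg' x⟩⟩
  have : Rec fun z : M => R (fst (fst z)) (snd z) :=
    Rec.congr (hR.comp (RecFun.mk_pr (f := fun z : M => fst (fst z)) (g := snd))) fun z => by simp
  refine Rec.congr (show Rec fun z => R (fst z) (snd z) ∧ ∀ y, y < snd z → ¬ R (fst z) y
    from inferInstance) fun z => ⟨fun hz => ?_, fun ⟨h₁, h₂⟩ => ?_⟩
  · rw [hz]
    exact ⟨hg _, hg' _⟩
  · refine le_antisymm (not_lt.1 fun hlt => h₂ _ hlt (hg _)) (not_lt.1 fun hlt => hg' _ _ hlt h₁)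

theorem CardEq.le_of_lt {A : M → Prop} {m b : M} (h : CardEq A m) (hA : ∀ x, A x → x < b) :
    m ≤ b := by
  obtain ⟨G, hG, hfun, hinj, -⟩ := h
  obtain ⟨g, hg, hgA, key⟩ := hfun.exists_recFun hG
  exact le_of_injective g (fun i hi => hA _ (hgA i hi)) fun i hi j hj hij =>
    hinj i j (g i) ((key _ _).2 ⟨hi, rfl⟩) ((key _ _).2 ⟨hj, hij⟩)

theorem cardEq_range {t m : M} (hinj : Inj t) (hseq : IsSeq t) (hm : HasLength t m) :
    CardEq (Range t) m := by
  obtain ⟨m', g, hg, hc⟩ := hseq.exists_codes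
  obtain rfl := hc.hasLength.unique hm
  refine ⟨_, graphOn_mem_sets (fun x => x < m') g, isFun_graphOn fun i hi => ⟨i, ?_⟩, ?_, ?_⟩
  · exact (hc.2 _ _).2 ⟨hi, rfl⟩
  · exact fun x y z hx hy => hinj x y z ((hc.2 _ _).2 (mem_graphOn.1 hx))
      ((hc.2 _ _).2 (mem_graphOn.1 hy))
  · rintro z ⟨i, hi⟩
    exact ⟨i, mem_graphOn.2 ((hc.2 _ _).1 hi)⟩

/-! ### From the finitary to the infinite principle -/

/-- If the infinite principle fails, then some coloring has only bounded color classes. -/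
theorem exists_bound_of_not_satIPP (h : ¬ SatIPP M) : ∃ (n : M) (g : M → M), RecFun g ∧
    (∀ x, g x ≤ n) ∧ ∀ c, ∃ b, ∀ x, g x = c → x < b := by
  simp only [SatIPP, not_forall] at h
  obtain ⟨n, G, hG, hfun, h⟩ := h
  obtain ⟨g, hg, hgn, key⟩ := hfun.exists_recFun hG
  refine ⟨n, g, hg, fun x => hgn x trivial, fun c => ?_⟩
  by_contra hc
  have hX : {x | g x = c} ∈ sets (M := M) := (inferInstance : Rec fun x => g x = c).1
  refine h ⟨c, ?_, _, hX, fun x => ?_, fun ⟨k, hk⟩ => hc ⟨k, hk⟩⟩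
  · by_contra hcn
    exact hc ⟨0, fun x hx => (hcn (hx ▸ hgn x trivial)).elim⟩
  · rw [key]
    simp [eq_comm]

theorem IsSeqOfSeq.exists_recFun {L : Set M} (hL : L ∈ sets (M := M)) (h : IsSeqOfSeq L) :
    ∃ g : M → M, RecFun g ∧ (∀ m, IsSeq (g m)) ∧ (∀ x y, pr x y ∈ L ↔ y = g x) ∧
      ∀ m x, RangeAt L m x ↔ Range (g m) x := by
  obtain ⟨g, hg, -, key⟩ := h.1.exists_recFun hL
  simp only [true_and] at key
  exact ⟨g, hg, fun m => h.2 m _ ((key _ _).2 rfl), key, fun m x => by simp [RangeAt, key]⟩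

/-- A nested sequence whose union is bounded is eventually constant. -/
theorem exists_range_iff_of_bounded {U : M → Prop} [Rec U] (g : M → M) [RecFun g]
    (hmono : ∀ i j x, i ≤ j → Range (g i) x → Range (g j) x)
    (hU : ∀ x, U x ↔ ∃ m, Range (g m) x) {b : M} (hb : ∀ x, U x → x < b) :
    ∃ i, ∀ j, i ≤ j → ∀ x, Range (g j) x ↔ U x := by
  obtain ⟨r, hr, hr'⟩ := exists_recFun_least (fun x m => U x → Range (g m) x) fun x => by
    by_cases hx : U x
    · obtain ⟨m, hm⟩ := (hU x).1 hx
      exact ⟨m, fun _ => hm⟩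
    · exact ⟨0, fun h => (hx h).elim⟩
  obtain ⟨i, hi⟩ := exists_bound_of_recFun r b
  exact ⟨i, fun j hj x => ⟨fun hx => (hU x).2 ⟨j, hx⟩, fun hx =>
    hmono _ _ _ ((hi x (hb x hx)).le.trans hj) ((hr' x).1 hx)⟩⟩

theorem range_mono (g : M → M) [RecFun g]
    (h : ∀ m x, Range (g m) x → Range (g (m + 1)) x) (i j x : M) (hij : i ≤ j)
    (hx : Range (g i) x) : Range (g j) x := by
  obtain ⟨d, rfl⟩ := exists_add_of_le hij
  refine induction_rec (fun d => Range (g (i + d)) x) (by rwa [add_zero]) (fun d hd => ?_) d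
  rw [← add_assoc]
  exact h _ _ hd

theorem stabilizes_iff {F L : Set M} (hF : ∀ x y, pr x y ∈ F ↔ y = f x)
    (hL : ∀ x y, pr x y ∈ L ↔ y = g x) :
    Stabilizes F L ↔ ∃ i, ∀ j, i ≤ j → f (g j) = f (g i) := by
  simp only [Stabilizes, hF, hL]
  refine exists_congr fun i => forall₂_congr fun j _ => ⟨?_, fun h => ⟨_, _, _, rfl, rfl, rfl, ?_⟩⟩
  · rintro ⟨a, b, y, rfl, rfl, rfl, h⟩
    exact h.symm
  · exact h.symm

open Classical in
/-- If all fibers of a coloring were bounded, then the function that assigns to each homogeneous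
set a bound, and `0` to every other finite set, would refute the finitary principle. -/
theorem satIPP_of_satFIPP2 (H : SatFIPP2 M) : SatIPP M := by
  by_contra hI
  obtain ⟨n, g, hg, hgn, hbound⟩ := exists_bound_of_not_satIPP hI
  obtain ⟨r, hr, hr'⟩ := exists_recFun_least (fun l y : M => ∀ x, x < l → Range l x → x < y)
    fun l => ⟨l, fun x hx _ => hx⟩
  let C : M → Prop := fun l => ∀ x, x < l → ∀ y, y < l → Range l x → Range l y → g x = g y
  have hC : Rec C := show Rec fun l => ∀ x, x < l → ∀ y, y < l → Range l x → Range l y → g x = g y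
    from inferInstance
  have hC' : ∀ l, C l ↔ ∀ x y, Range l x → Range l y → g x = g y := fun l =>
    ⟨fun h x y hx hy => h x hx.lt y hy.lt hx hy, fun h x _ y _ hx hy => h x y hx hy⟩
  let F : M → M := fun l => if C l then r l else 0
  have hF : RecFun F := show RecFun fun l => if C l then r l else 0 from inferInstance
  have hr₁ : ∀ l x, Range l x → x < r l := fun l x hx => (hr' l).1 x hx.lt hx
  have hext : ∀ l l', (∀ x, Range l x ↔ Range l' x) → F l = F l' := fun l l' hl => by
    have hr₂ : r l = r l' := le_antisymm
      (not_lt.1 fun hlt => (hr' l).2 _ hlt fun x _ hx => hr₁ l' x ((hl x).1 hx))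
      (not_lt.1 fun hlt => (hr' l').2 _ hlt fun x _ hx => hr₁ l x ((hl x).2 hx))
    have hC₂ : C l ↔ C l' := by simp only [hC', hl]
    simp only [F, hr₂, hC₂]
  have hFmem : ∀ x y, pr x y ∈ graphOn (fun _ => True) F ↔ y = F x := fun x y => by
    simp [mem_graphOn]
  have hAS : InAS (graphOn (fun _ => True) F) := by
    refine ⟨isFun_graphOn fun _ _ => trivial, fun l l' _ _ hl => ⟨F l, ?_, ?_⟩, fun L hL hn => ?_⟩
    · rw [hFmem]
    · rw [hFmem, hext l l' hl]
    obtain ⟨hseq, hsub, U, hU, hUL⟩ := hn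
    obtain ⟨e, he, -, heL, heR⟩ := hseq.exists_recFun hL
    simp only [heR] at hsub hUL
    have hmono := range_mono e hsub
    rw [stabilizes_iff hFmem heL]
    have : IsSet U := ⟨hU⟩
    by_cases hc : ∀ x y, x ∈ U → y ∈ U → g x = g y
    · have : ∃ b, ∀ x, x ∈ U → x < b := by
        by_cases hne : ∃ x₀, x₀ ∈ U
        · obtain ⟨x₀, hx₀⟩ := hne
          obtain ⟨b, hb⟩ := hbound (g x₀)
          exact ⟨b, fun x hx => hb x (hc _ _ hx hx₀)⟩
        · exact ⟨0, fun x hx => (hne ⟨x, hx⟩).elim⟩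
      obtain ⟨b, hb⟩ := this
      obtain ⟨i, hi⟩ := exists_range_iff_of_bounded (U := fun x => x ∈ U) e hmono hUL hb
      exact ⟨i, fun j hj => hext _ _ fun x => (hi j hj x).trans (hi i le_rfl x).symm⟩
    · push Not at hc
      obtain ⟨x, y, hx, hy, hxy⟩ := hc
      obtain ⟨i, hi⟩ := (hUL x).1 hx
      obtain ⟨j, hj⟩ := (hUL y).1 hy
      have h₀ : ∀ m, i + j ≤ m → F (e m) = 0 := fun m hm => if_neg fun h' =>
        hxy ((hC' _).1 h' x y (hmono _ _ _ (le_self_add.trans hm) hi)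
          (hmono _ _ _ (le_add_self.trans hm) hj))
      exact ⟨i + j, fun m hm => (h₀ m hm).trans (h₀ _ le_rfl).symm⟩
  obtain ⟨k, hk⟩ := H n _ (graphOn_mem_sets (fun _ => True) F) hAS
  obtain ⟨l, -, hlk, ⟨y, hy, m, hm, hym⟩, hconst⟩ := hk _ (graphOn_mem_sets (fun x => x ≤ k) g)
    (isFun_graphOn fun x _ => hgn x)
  have hl : C l := (hC' l).2 fun x y hx hy => by
    obtain ⟨c, h₁, h₂⟩ := hconst x y hx hy
    exact (mem_graphOn.1 h₁).2.symm.trans (mem_graphOn.1 h₂).2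
  rw [hFmem, show F l = r l from if_pos hl] at hy
  exact (hm.le_of_lt (hr₁ l)).not_gt (hy ▸ hym)

end RCAModel

end SecondOrderArithmetic

namespace SecondOrderArithmetic

open RCAModel

set_option synthInstance.maxSize 10000
set_option synthInstance.maxHeartbeats 400000

variable {M : Type} [RCAModel M] {P : M → Prop} {f g h : M → M}

namespace RCAModel

/-! ### From the infinite to the finitary principle, by weak König's lemma -/

/-- `t` enumerates, without repetitions, more than `f(t)` numbers. -/
def Large (f : M → M) (t : M) : Prop :=
  IsSeq t ∧ Inj t ∧ ∃ m, m ≤ t ∧ HasLength t m ∧ f t < m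

instance Rec.large [RecFun f] [RecFun g] : Rec fun x => Large f (g x) :=
  Rec.comp (P := fun t => IsSeq t ∧ Inj t ∧ ∃ m, m ≤ t ∧ HasLength t m ∧ f t < m)
    inferInstance inferInstance

instance Rec.large_self [RecFun f] : Rec (Large f) := Rec.large (g := fun x => x)

theorem Large.isBig {F : Set M} (hF : ∀ x y, pr x y ∈ F ↔ y = f x) {t : M} (ht : Large f t) :
    IsBig F t := by
  obtain ⟨hs, hi, m, -, hm, hlt⟩ := ht
  exact ⟨f t, (hF _ _).2 rfl, m, cardEq_range hi hs hm, hlt⟩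

/-- If `f` is eventually constant on the finite parts of an unbounded set, then one of these parts
is large. -/
theorem exists_large_of_stabilizes [Rec P] (hP : ∀ b, ∃ x, b ≤ x ∧ P x) {y i : M}
    (hf : ∀ j t, i ≤ j → IsSeq t → (∀ x, Range t x ↔ x < j ∧ P x) → f t = y) :
    ∃ t, Large f t ∧ ∀ x, Range t x → P x := by
  obtain ⟨b, t, ht⟩ := exists_enum_of_unbounded P hP (y + 1)
  obtain ⟨y', t', hy, ht'⟩ := ht.exists_of_le (c := b + i) le_self_add
  refine ⟨t', ⟨ht'.1, ht'.2.1, y', ht'.2.2.1.le, ht'.2.2.1, ?_⟩, fun x hx => ((ht'.2.2.2 x).1 hx).2⟩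
  rw [hf (b + i) t' le_add_self ht'.1 ht'.2.2.2]
  exact (lt_add_one y).trans_le hy

/-- A function yielding the finite parts of a recursive set. -/
theorem exists_recFun_parts (P : M → Prop) [Rec P] : ∃ e : M → M, RecFun e ∧
    ∀ m, IsSeq (e m) ∧ ∀ x, Range (e m) x ↔ x < m ∧ P x := by
  obtain ⟨e, he, hl⟩ := exists_recFun_least
    (fun m l : M => IsSeq l ∧ ∀ x, x < m + l → (Range l x ↔ x < m ∧ P x)) fun m => by
      obtain ⟨l, hl, hlP⟩ := exists_isSeq_range P m
      exact ⟨l, hl, fun x _ => hlP x⟩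
  refine ⟨e, he, fun m => ⟨(hl m).1.1, fun x => ?_⟩⟩
  by_cases hx : x < m + e m
  · exact (hl m).1.2 x hx
  · exact iff_of_false (fun h' => hx (h'.lt.trans_le le_add_self))
      fun h' => hx (h'.1.trans_le le_self_add)

/-- If the infinite pigeonhole principle holds, then every coloring is constant on a large set. -/
theorem exists_large_of_inAS (hI : SatIPP M) {F : Set M} (hF : InAS F)
    (hf : ∀ x y, pr x y ∈ F ↔ y = f x) (n : M) [RecFun g] (hg : ∀ x, g x ≤ n) :
    ∃ t, Large f t ∧ ∃ c, c ≤ n ∧ ∀ x, Range t x → g x = c := by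
  obtain ⟨c, hc, A, hA, hAf, hunb⟩ := hI n _ (graphOn_mem_sets (fun _ => True) g)
    (isFun_graphOn fun x _ => hg x)
  simp only [mem_graphOn, true_and] at hAf
  have hP : ∀ b, ∃ x, b ≤ x ∧ c = g x := fun b => by
    by_contra h'
    exact hunb ⟨b, fun x hx => not_le.1 fun hb => h' ⟨x, hb, (hAf x).1 hx⟩⟩
  obtain ⟨e, he, he'⟩ := exists_recFun_parts fun x => c = g x
  have hL : ∀ x y, pr x y ∈ graphOn (fun _ => True) e ↔ y = e x := fun x y => by
    simp [mem_graphOn]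
  have hR : ∀ m x, RangeAt (graphOn (fun _ => True) e) m x ↔ x < m ∧ c = g x := fun m x => by
    simp [RangeAt, hL, he']
  have hn : IsNested (graphOn (fun _ => True) e) := by
    refine ⟨⟨isFun_graphOn fun _ _ => trivial, fun m l hl => (hL m l).1 hl ▸ (he' m).1⟩,
      fun m x hx => ?_, A, hA, fun x => ?_⟩
    · rw [hR] at hx ⊢
      exact ⟨hx.1.trans (lt_add_one m), hx.2⟩
    · simp only [hAf, hR]
      exact ⟨fun hx => ⟨x + 1, lt_add_one x, hx⟩, fun ⟨_, hx⟩ => hx.2⟩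
  obtain ⟨i, hi⟩ := (stabilizes_iff hf hL).1 (hF.2.2 _ (graphOn_mem_sets (fun _ => True) e) hn)
  obtain ⟨t, ht, htc⟩ := exists_large_of_stabilizes (f := f) hP (y := f (e i)) (i := i)
    fun j t hj ht htj => by
      rw [← hi j hj]
      obtain ⟨y, h₁, h₂⟩ := hF.2.1 t (e j) ht (he' j).1 fun x => (htj x).trans ((he' j).2 x).symm
      exact ((hf _ _).1 h₁).symm.trans ((hf _ _).1 h₂)
  exact ⟨t, ht, c, hc, fun x hx => (htc x hx).symm⟩

/-- All `s(x, c)` with `x` in the range of `t` are `1`. -/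
def Homog (t s c : M) : Prop := ∀ x, x < t → Range t x → Entry s (pr x c) 1

instance Rec.homog [RecFun f] [RecFun g] [RecFun h] :
    Rec fun x => Homog (f x) (g x) (h x) :=
  inferInstanceAs (Rec fun x => ∀ y, y < f x → Range (f x) y → Entry (g x) (pr y (h x)) 1)

/-- Each `x` for which `s` decides this is related to some `c`. -/
def Total (n s h : M) : Prop := ∀ x, x < h → pr x n < h → ∃ c, c ≤ n ∧ Entry s (pr x c) 1

instance Rec.total {n : M} [RecFun f] [RecFun g] : Rec fun x => Total n (f x) (g x) :=
  inferInstanceAs (Rec fun x => ∀ y, y < g x → pr y n < g x → ∃ c, c ≤ n ∧ Entry (f x) (pr y c) 1)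

/-- No set in `G` for which `s` decides this is homogeneous. -/
def Avoids (n : M) (G : M → Prop) (s h : M) : Prop :=
  ∀ t, t < h → G t → (∀ x, x < t → Range t x → pr x n < h) → ¬ ∃ c, c ≤ n ∧ Homog t s c

instance Rec.avoids {n : M} [Rec P] [RecFun f] [RecFun g] : Rec fun x => Avoids n P (f x) (g x) :=
  inferInstanceAs (Rec fun x => ∀ t, t < g x → P t →
    (∀ y, y < t → Range t y → pr y n < g x) → ¬ ∃ c, c ≤ n ∧ Homog t (f x) c)

/-- The tree of attempts at a characteristic function of (the graph of) a coloring with colors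
`c ≤ n` which is constant on none of the sets in `G`. -/
def ColoringTree (n : M) (G : M → Prop) (s : M) : Prop :=
  IsSeq s ∧ (∀ x, x < s → Range s x → x ≤ 1) ∧
    ∃ h, h ≤ s ∧ HasLength s h ∧ Total n s h ∧ Avoids n G s h

instance Rec.coloringTree {n : M} [Rec P] : Rec fun s => ColoringTree n P s :=
  inferInstanceAs (Rec fun s => IsSeq s ∧ (∀ x, x < s → Range s x → x ≤ 1) ∧
    ∃ h, h ≤ s ∧ HasLength s h ∧ Total n s h ∧ Avoids n P s h)

theorem pr_lt_of_le {x c n h : M} (hx : pr x n < h) (hc : c ≤ n) : pr x c < h :=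
  (pr_le_pr le_rfl hc).trans_lt hx

theorem ColoringTree.of_initial {n s t : M} (hs : ColoringTree n P s) (ht : IsSeq t)
    (hts : ∀ i x, Entry t i x → Entry s i x) : ColoringTree n P t := by
  obtain ⟨hs, hbin, l, hls, hl, htot, hav⟩ := hs
  obtain ⟨m, hm⟩ := ht.2.2.2
  have hml : m ≤ l := not_lt.1 fun hlt => by
    obtain ⟨x, hx⟩ := (hm l).1 hlt
    exact ((hl l).2 ⟨x, hts _ _ hx⟩).false
  have hst : ∀ i x, i < m → Entry s i x → Entry t i x := fun i x hi hx => by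
    obtain ⟨y, hy⟩ := (hm i).1 hi
    rwa [hs.2.2.1 i x y hx (hts _ _ hy)]
  refine ⟨ht, fun x _ ⟨i, hi⟩ => hbin x (hts _ _ hi).value_lt ⟨i, hts _ _ hi⟩, m, hm.le, hm,
    fun x hx hxm => ?_, fun u hu hPu hran ⟨c, hc, hom⟩ => ?_⟩
  · obtain ⟨c, hc, he⟩ := htot x (hx.trans_le hml) (hxm.trans_le hml)
    exact ⟨c, hc, hst _ _ (pr_lt_of_le hxm hc) he⟩
  · exact hav u (hu.trans_le hml) hPu (fun x hx hr => (hran x hx hr).trans_le hml)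
      ⟨c, hc, fun x hx hr => hts _ _ (hom x hx hr)⟩

open Classical in
/-- A coloring of a sufficiently long initial segment gives an element of the tree. -/
theorem exists_coloringTree {n k : M} [RecFun g] (hg : ∀ x, x ≤ k → g x ≤ n)
    (hav : ∀ t, P t → (∀ x, Range t x → x ≤ k) → ¬ ∃ c, ∀ x, Range t x → g x = c) :
    ∃ s, k ≤ s ∧ ColoringTree n P s := by
  obtain ⟨s, hs⟩ := exists_codes (fun i => if snd i = g (fst i) then (1 : M) else 0) k
  have key : ∀ x c, Entry s (pr x c) 1 ↔ pr x c < k ∧ c = g x := fun x c => by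
    simp only [hs.2, fst_pr, snd_pr]
    by_cases hc : c = g x <;> simp [hc]
  refine ⟨s, hs.hasLength.le, hs.1, fun x _ ⟨i, hi⟩ => ?_, k, hs.hasLength.le, hs.hasLength,
    fun x hx hxk => ⟨g x, hg x hx.le, (key _ _).2 ⟨pr_lt_of_le hxk (hg x hx.le), rfl⟩⟩,
    fun t ht hPt hran ⟨c, _, hom⟩ => hav t hPt (fun x hx => ?_) ⟨c, fun x hx => ?_⟩⟩
  · rw [((hs.2 _ _).1 hi).2]
    dsimp only
    split_ifs
    · exact le_rfl
    · exact nonneg _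
  · exact (le_pr_left x n).trans (hran x hx.lt hx).le
  · exact ((key _ _).1 (hom x hx.lt hx)).2.symm

/-- A path through the tree yields a coloring which is constant on none of the sets in `P`. -/
theorem exists_coloring_of_satWKL (hW : SatWKL M) [Rec P] {n : M}
    (H : ∀ k, ∃ g : M → M, RecFun g ∧ (∀ x, x ≤ k → g x ≤ n) ∧
      ∀ t, P t → (∀ x, Range t x → x ≤ k) → ¬ ∃ c, ∀ x, Range t x → g x = c) :
    ∃ g : M → M, RecFun g ∧ (∀ x, g x ≤ n) ∧
      ∀ t, P t → ¬ ∃ c, c ≤ n ∧ ∀ x, Range t x → g x = c := by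
  obtain ⟨G, hG, hfun, hpath⟩ := hW {s | ColoringTree n P s} Rec.coloringTree.1
    ⟨fun s hs => ⟨hs.1, fun x hx => hs.2.1 x hx.lt hx⟩, fun s t hs ht hts => hs.of_initial ht hts⟩
    fun ⟨k, hk⟩ => by
      obtain ⟨g, hg, hgn, hav⟩ := H k
      obtain ⟨s, hks, hs⟩ := exists_coloringTree hgn hav
      exact (hk s hs).not_ge hks
  obtain ⟨γ, hγ, -, key⟩ := hfun.exists_recFun hG
  simp only [true_and] at key
  have hs : ∀ m, ∃ s, (∀ i x, Entry s i x ↔ i < m ∧ x = γ i) ∧ Total n s m ∧ Avoids n P s m := by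
    intro m
    obtain ⟨s, ⟨hs, hm, hi⟩, -, -, m', -, hm', hT, hA⟩ := hpath m
    obtain rfl := hm'.unique hm
    refine ⟨s, fun i x => ⟨fun hx => ?_, fun ⟨him, hx⟩ => ?_⟩, hT, hA⟩
    · have him := (hm i).2 ⟨x, hx⟩
      obtain ⟨y, hy, hyG⟩ := hi i him
      exact ⟨him, (hs.2.2.1 i x y hx hy).trans ((key _ _).1 hyG)⟩
    · obtain ⟨y, hy, hyG⟩ := hi i him
      rwa [hx, ← (key _ _).1 hyG]
  have hex : ∀ x, ∃ c, c ≤ n ∧ γ (pr x c) = 1 := fun x => by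
    obtain ⟨s, hs, hT, -⟩ := hs (pr x n + 1)
    obtain ⟨c, hc, he⟩ := hT x (lt_add_one_iff.2 (le_pr_left _ _)) (lt_add_one _)
    exact ⟨c, hc, ((hs _ _).1 he).2.symm⟩
  obtain ⟨φ, hφ, hφ'⟩ := exists_recFun_least (fun x c => c ≤ n ∧ γ (pr x c) = 1) hex
  refine ⟨φ, hφ, fun x => (hφ' x).1.1, fun t ht ⟨c, hc, hom⟩ => ?_⟩
  obtain ⟨s, hs, -, hA⟩ := hs (pr t n + 1)
  have hlt : ∀ x, x < t → pr x n < pr t n + 1 := fun x hx =>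
    lt_add_one_iff.2 (pr_le_pr hx.le le_rfl)
  refine hA t (lt_add_one_iff.2 (le_pr_left _ _)) ht (fun x hx _ => hlt x hx)
    ⟨c, hc, fun x hx hr => (hs _ _).2 ⟨pr_lt_of_le (hlt x hx) hc, ?_⟩⟩
  rw [← hom x hr]
  exact (hφ' x).1.2.symm

theorem satFIPP2_of_satIPP (hW : SatWKL M) (hI : SatIPP M) : SatFIPP2 M := by
  intro n F hFm hF
  obtain ⟨f, hf, -, key⟩ := hF.1.exists_recFun hFm
  simp only [true_and] at key
  by_contra hcon
  obtain ⟨g, hg, hgn, hav⟩ := exists_coloring_of_satWKL hW (P := Large f) (n := n) fun k => by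
    by_contra hk
    refine hcon ⟨k, fun G hG hfun => ?_⟩
    obtain ⟨g, hg, hgn, hgG⟩ := hfun.exists_recFun hG
    by_contra hl
    refine hk ⟨g, hg, hgn, fun t ht hran ⟨c, hc⟩ => hl ⟨t, ht.1, hran, ht.isBig key, ?_⟩⟩
    exact fun x y hx hy => ⟨c, (hgG _ _).2 ⟨hran x hx, (hc x hx).symm⟩,
      (hgG _ _).2 ⟨hran y hy, (hc y hy).symm⟩⟩
  obtain ⟨t, ht, hc⟩ := exists_large_of_inAS hI hF key n hgn
  exact hav t ht hc

end RCAModel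

end SecondOrderArithmetic

namespace SecondOrderArithmetic

open RCAModel

set_option synthInstance.maxSize 10000
set_option synthInstance.maxHeartbeats 400000

/-! ### Models of arithmetical comprehension -/

/-- A model of `ACA₀`: the sets of the model are closed under number quantification. -/
class ACAModel (M : Type) extends RCAModel M where
  all_mem_sets : ∀ X ∈ sets, {x : M | ∀ y, pr x y ∈ X} ∈ sets

variable {M : Type} [ACAModel M] {P : M → Prop} {f g h : M → M}

instance Rec.all {R : M → M → Prop} [hR : Rec fun z => R (fst z) (snd z)] :
    Rec fun x => ∀ y, R x y :=
  Rec.congr ⟨ACAModel.all_mem_sets _ hR.1⟩ fun x => by simp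

instance Rec.ex {R : M → M → Prop} [Rec fun z => R (fst z) (snd z)] :
    Rec fun x => ∃ y, R x y :=
  Rec.congr (show Rec fun x => ¬ ∀ y, ¬ R x y from inferInstance) fun x => by
    simp only [not_forall, not_not]

namespace RCAModel

/-- A bound for all the finitely many fibers would bound all numbers. -/
theorem satIPP_of_acaModel : SatIPP M := by
  by_contra hI
  obtain ⟨n, g, hg, hgn, hbound⟩ := exists_bound_of_not_satIPP hI
  obtain ⟨r, hr, hr'⟩ := exists_recFun_least (fun c b => ∀ x, g x = c → x < b) hbound
  obtain ⟨b, hb⟩ := exists_bound_of_recFun r (n + 1)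
  exact ((hr' (g b)).1 b rfl).not_gt (hb _ (lt_add_one_iff.2 (hgn b)))

/-- The sequence `⟨u(0), …, u(j - 1)⟩` is an initial segment of infinitely many of the functions
`x ↦ σ(k, x)`. -/
def Extendible (σ : M → M) (u j : M) : Prop :=
  ∀ m, ∃ k, m ≤ k ∧ ∀ i, i < j → Entry u i (σ (pr k i))

/-- The sequence `⟨u(0), …, u(j - 1), c⟩` is an initial segment of infinitely many of the functions
`x ↦ σ(k, x)`. -/
def ExtendibleBy (σ : M → M) (u j c : M) : Prop :=
  ∀ m, ∃ k, m ≤ k ∧ (∀ i, i < j → Entry u i (σ (pr k i))) ∧ σ (pr k j) = c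

instance Rec.extendibleBy {σ : M → M} [RecFun σ] [RecFun f] [RecFun g] [RecFun h] :
    Rec fun x => ExtendibleBy σ (f x) (g x) (h x) :=
  inferInstanceAs (Rec fun x => ∀ m, ∃ k, m ≤ k ∧
    (∀ i, i < g x → Entry (f x) i (σ (pr k i))) ∧ σ (pr k (g x)) = h x)

instance Rec.extendibleBy_self {σ : M → M} [RecFun σ] (u j : M) : Rec (ExtendibleBy σ u j) :=
  Rec.extendibleBy (f := fun _ => u) (g := fun _ => j) (h := fun x => x)

/-- The sequence `u` of length `m` is an initial segment of the leftmost path. -/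
def Leftmost (σ : M → M) (n m u : M) : Prop :=
  IsSeq u ∧ HasLength u m ∧ ∀ j, j < m → ∃ c, c ≤ n ∧ Entry u j c ∧ ExtendibleBy σ u j c ∧
    ∀ d, d < c → ¬ ExtendibleBy σ u j d

instance Rec.leftmost {σ : M → M} {n : M} [RecFun σ] [RecFun f] [RecFun g] :
    Rec fun x => Leftmost σ n (f x) (g x) :=
  inferInstanceAs (Rec fun x => IsSeq (g x) ∧ HasLength (g x) (f x) ∧ ∀ j, j < f x →
    ∃ c, c ≤ n ∧ Entry (g x) j c ∧ ExtendibleBy σ (g x) j c ∧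
      ∀ d, d < c → ¬ ExtendibleBy σ (g x) j d)

variable {σ : M → M} {n : M}

theorem Extendible.exists_extendibleBy [RecFun σ] (hσ : ∀ z, σ z ≤ n) {u j : M}
    (h : Extendible σ u j) : ∃ c, c ≤ n ∧ ExtendibleBy σ u j c := by
  by_contra hcon
  have key : ∀ c, ∃ m, c ≤ n → ∀ k, m ≤ k → ¬ ((∀ i, i < j → Entry u i (σ (pr k i))) ∧
      σ (pr k j) = c) := fun c => by
    by_cases hc : c ≤ n
    · by_contra hm
      refine hcon ⟨c, hc, fun m => ?_⟩
      by_contra hk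
      exact hm ⟨m, fun _ k hmk h' => hk ⟨k, hmk, h'⟩⟩
    · exact ⟨0, fun h => (hc h).elim⟩
  obtain ⟨r, hr, hr'⟩ := exists_recFun_least _ key
  obtain ⟨b, hb⟩ := exists_bound_of_recFun r (n + 1)
  obtain ⟨k, hk, hu⟩ := h b
  exact (hr' _).1 (hσ _) k ((hb _ (lt_add_one_iff.2 (hσ (pr k j)))).le.trans hk) ⟨hu, rfl⟩

theorem ExtendibleBy.congr {u v j c : M} (huv : ∀ i x, i < j → (Entry u i x ↔ Entry v i x)) :
    ExtendibleBy σ u j c ↔ ExtendibleBy σ v j c :=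
  forall_congr' fun _ => exists_congr fun _ => and_congr_right fun _ => and_congr_left fun _ =>
    forall₂_congr fun i hi => huv i _ hi

theorem ExtendibleBy.extendible {u j c : M} (h : ExtendibleBy σ u j c) (hc : Entry u j c) :
    Extendible σ u (j + 1) := fun m => by
  obtain ⟨k, hk, hu, rfl⟩ := h m
  refine ⟨k, hk, fun i hi => ?_⟩
  rcases (lt_add_one_iff.1 hi).lt_or_eq with h' | rfl
  · exact hu i h'
  · exact hc

theorem Leftmost.extendible {m u : M} (h : Leftmost σ n m u) : Extendible σ u m := by
  rcases eq_zero_or_eq_add_one m with rfl | ⟨j, rfl⟩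
  · exact fun m => ⟨m, le_rfl, fun i hi => absurd hi (not_lt.2 (nonneg i))⟩
  · obtain ⟨c, -, hc, hE, -⟩ := h.2.2 j (lt_add_one j)
    exact hE.extendible hc

open Classical in
theorem exists_leftmost [RecFun σ] (hσ : ∀ z, σ z ≤ n) (m : M) : ∃ u, Leftmost σ n m u := by
  refine induction_exists (fun m u => Leftmost σ n m u) ?_ (fun m ⟨u, hu⟩ => ?_) m
  · obtain ⟨u, hu⟩ := exists_codes (fun i : M => i) 0
    exact ⟨u, hu.1, hu.hasLength, fun i hi => absurd hi (not_lt.2 (nonneg i))⟩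
  · obtain ⟨c, ⟨hc, hE⟩, hmin⟩ := exists_least (fun c => c ≤ n ∧ ExtendibleBy σ u m c)
      (hu.extendible.exists_extendibleBy hσ)
    obtain ⟨m', g, hg, hcod⟩ := hu.1.exists_codes
    obtain rfl := hcod.hasLength.unique hu.2.1
    obtain ⟨v, hv⟩ := exists_codes (fun i => if i = m' then c else g i) (m' + 1)
    have huv : ∀ i x, i < m' → (Entry u i x ↔ Entry v i x) := fun i x hi => by
      simp only [hcod.2, hv.2, if_neg hi.ne]
      simp [hi, hi.trans (lt_add_one m')]
    refine ⟨v, hv.1, hv.hasLength, fun j hj => ?_⟩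
    rcases (lt_add_one_iff.1 hj).lt_or_eq with h' | rfl
    · obtain ⟨d, hd, he, hE', hmin'⟩ := hu.2.2 j h'
      have huv' : ∀ i x, i < j → (Entry u i x ↔ Entry v i x) := fun i x hi => huv i x (hi.trans h')
      exact ⟨d, hd, (huv _ _ h').1 he, (ExtendibleBy.congr huv').1 hE',
        fun d' hd' h'' => hmin' d' hd' ((ExtendibleBy.congr huv').2 h'')⟩
    · exact ⟨c, hc, (hv.2 _ _).2 ⟨lt_add_one j, (if_pos rfl).symm⟩,
        (ExtendibleBy.congr huv).1 hE, fun d hd h'' => hmin d hd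
          ⟨hd.le.trans hc, (ExtendibleBy.congr huv).2 h''⟩⟩

theorem Leftmost.entry_iff {m m' u v : M} (hu : Leftmost σ n m u) (hv : Leftmost σ n m' v) (j : M) :
    ∀ i, i < j → i < m → i < m' → ∀ x, x < u + v → (Entry u i x ↔ Entry v i x) := by
  have hfull : ∀ j, (∀ i, i < j → i < m → i < m' → ∀ x, x < u + v → (Entry u i x ↔ Entry v i x)) →
      j ≤ m → j ≤ m' → ∀ i x, i < j → (Entry u i x ↔ Entry v i x) := fun j h hj hj' i x hi => by
    by_cases hx : x < u + v
    · exact h i hi (hi.trans_le hj) (hi.trans_le hj') x hx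
    · exact iff_of_false (fun h' => hx (h'.value_lt.trans_le le_self_add))
        fun h' => hx (h'.value_lt.trans_le le_add_self)
  refine induction_rec (fun j => ∀ i, i < j → i < m → i < m' → ∀ x, x < u + v →
    (Entry u i x ↔ Entry v i x)) (fun i hi => absurd hi (not_lt.2 (nonneg i))) (fun j hj => ?_) j
  intro i hi him him' x hx
  rcases (lt_add_one_iff.1 hi).lt_or_eq with h' | rfl
  · exact hj i h' him him' x hx
  · obtain ⟨c, hc, hec, hE, hmin⟩ := hu.2.2 i him
    obtain ⟨d, hd, hed, hE', hmin'⟩ := hv.2.2 i him'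
    have huv := hfull i hj him.le him'.le
    obtain rfl : c = d := le_antisymm
      (not_lt.1 fun hlt => hmin d hlt ((ExtendibleBy.congr huv).2 hE'))
      (not_lt.1 fun hlt => hmin' c hlt ((ExtendibleBy.congr huv).1 hE))
    exact ⟨fun h' => hu.1.2.2.1 i x c h' hec ▸ hed, fun h' => hv.1.2.2.1 i x c h' hed ▸ hec⟩

/-- Sequential compactness of `{0, …, n}^ℕ`. -/
theorem exists_accumulation [RecFun σ] (hσ : ∀ z, σ z ≤ n) : ∃ g : M → M, RecFun g ∧
    (∀ x, g x ≤ n) ∧ ∀ m, ∃ k, m ≤ k ∧ ∀ x, x < m → σ (pr k x) = g x := by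
  obtain ⟨e, he, he'⟩ := exists_recFun_least (Leftmost σ n) (exists_leftmost hσ)
  have hL : ∀ m, Leftmost σ n m (e m) := fun m => (he' m).1
  obtain ⟨g, hg, hg'⟩ := exists_recFun_least (fun x c => Entry (e (x + 1)) x c)
    fun x => ((hL (x + 1)).2.1 x).1 (lt_add_one x)
  have hcoh : ∀ x m c, x < m → Entry (e m) x c → c = g x := fun x m c hx hc =>
    (hL (x + 1)).1.2.2.1 x c (g x) (((hL m).entry_iff (hL (x + 1)) (x + 1) x (lt_add_one x) hx
      (lt_add_one x) c (hc.value_lt.trans_le le_self_add)).1 hc) (hg' x).1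
  refine ⟨g, hg, fun x => ?_, fun m => ?_⟩
  · obtain ⟨c, hc, hcE, -⟩ := (hL (x + 1)).2.2 x (lt_add_one x)
    rwa [← hcoh x _ c (lt_add_one x) hcE]
  · obtain ⟨k, hk, hkE⟩ := (hL m).extendible m
    exact ⟨k, hk, fun x hx => hcoh x m _ hx (hkE x hx)⟩

/-- `s` codes a coloring of `{0, …, k}` none of whose color classes has a large enumeration. -/
def Counterexample (f : M → M) (n k s : M) : Prop :=
  IsSeq s ∧ (∀ x, x ≤ k → ∃ c, c ≤ n ∧ Entry s x c) ∧
    ∀ t, Large f t → ∀ c, c ≤ n → ∃ x, ¬ (Range t x ↔ x ≤ k ∧ Entry s x c)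

instance Rec.counterexample [RecFun f] [RecFun g] [RecFun h] :
    Rec fun x => Counterexample f n (g x) (h x) :=
  inferInstanceAs (Rec fun x => IsSeq (h x) ∧ (∀ y, y ≤ g x → ∃ c, c ≤ n ∧ Entry (h x) y c) ∧
    ∀ t, Large f t → ∀ c, c ≤ n → ∃ y, ¬ (Range t y ↔ y ≤ g x ∧ Entry (h x) y c))

/-- Counterexamples for all `k` accumulate at a coloring of all numbers. An infinite color class of
this coloring is the weak limit of color classes of the counterexamples, along which `f` is
eventually constant; so one of these color classes is large. -/
theorem exists_not_counterexample [RecFun f] {F : Set M} (hF : InASNIS F)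
    (hf : ∀ x y, pr x y ∈ F ↔ y = f x) (n : M) : ∃ k, ∀ s, ¬ Counterexample f n k s := by
  by_contra hcon
  obtain ⟨s, hs, hs'⟩ := exists_recFun_least (fun k s => Counterexample f n k s) fun k => by
    by_contra hk
    exact hcon ⟨k, fun s hs => hk ⟨s, hs⟩⟩
  have hs : ∀ k, Counterexample f n k (s k) := fun k => (hs' k).1
  obtain ⟨σ, hσ, hσ'⟩ := exists_recFun_least
    (fun z c : M => c ≤ n ∧ (fst z < snd z ∨ Entry (s (fst z)) (snd z) c)) fun z => by
      rcases lt_or_ge (fst z) (snd z) with hz | hz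
      · exact ⟨0, nonneg n, .inl hz⟩
      · obtain ⟨c, hc, he⟩ := (hs (fst z)).2.1 _ hz
        exact ⟨c, hc, .inr he⟩
  have hσn : ∀ z, σ z ≤ n := fun z => (hσ' z).1.1
  have hσs : ∀ k x c, x ≤ k → (Entry (s k) x c ↔ σ (pr k x) = c) := fun k x c hx => by
    have he := (hσ' (pr k x)).1.2
    rw [fst_pr, snd_pr] at he
    have he := he.resolve_left hx.not_gt
    exact ⟨fun h => (hs k).1.2.2.1 x _ _ he h, fun h => h ▸ he⟩
  obtain ⟨g, hg, hgn, hacc⟩ := exists_accumulation hσn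
  obtain ⟨κ, hκ, hκ'⟩ := exists_recFun_least
    (fun m k => m ≤ k ∧ ∀ x, x < m → σ (pr k x) = g x) hacc
  have hκ₁ : ∀ m, m ≤ κ m := fun m => (hκ' m).1.1
  have hκ₂ : ∀ m x, x < m → σ (pr (κ m) x) = g x := fun m => (hκ' m).1.2
  obtain ⟨c, hc, A, hA, hAf, hunb⟩ := satIPP_of_acaModel n _ (graphOn_mem_sets (fun _ => True) g)
    (isFun_graphOn fun x _ => hgn x)
  simp only [mem_graphOn, true_and] at hAf
  have hP : ∀ b, ∃ x, b ≤ x ∧ c = g x := fun b => by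
    by_contra h'
    exact hunb ⟨b, fun x hx => not_le.1 fun hb => h' ⟨x, hb, (hAf x).1 hx⟩⟩
  obtain ⟨e, he, he'⟩ := exists_recFun_least
    (fun m l : M => IsSeq l ∧ ∀ x, Range l x ↔ x < κ m + 1 ∧ σ (pr (κ m) x) = c)
    fun m => exists_isSeq_range (fun x => σ (pr (κ m) x) = c) (κ m + 1)
  have hseq : ∀ m, IsSeq (e m) := fun m => (he' m).1.1
  have hL : ∀ x y, pr x y ∈ graphOn (fun _ => True) e ↔ y = e x := fun x y => by
    simp [mem_graphOn]
  have hR : ∀ m x, RangeAt (graphOn (fun _ => True) e) m x ↔ x < κ m + 1 ∧ σ (pr (κ m) x) = c :=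
    fun m x => by simp [RangeAt, hL, (he' m).1.2]
  have hn : WeaklyConv (graphOn (fun _ => True) e) := by
    refine ⟨A, hA, ⟨isFun_graphOn fun _ _ => trivial, fun m l hl => (hL m l).1 hl ▸ hseq m⟩, hunb,
      fun B _ ⟨b, hb⟩ => ⟨b, fun j hj x => and_congr_left fun hx => ?_⟩⟩
    have hxj := (hb x hx).trans_le hj
    rw [hR, hAf, hκ₂ j x hxj, eq_comm (a := c)]
    exact and_iff_right (lt_add_one_iff.2 (hxj.le.trans (hκ₁ j)))
  obtain ⟨i, hi⟩ := (stabilizes_iff hf hL).1 (hF.2.2 _ (graphOn_mem_sets (fun _ => True) e) hn)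
  obtain ⟨b, t, ht⟩ := exists_enum_of_unbounded (fun x => c = g x) hP (f (e i) + 1)
  have ht₁ : Enum (fun x => σ (pr (κ (b + i)) x) = c) b (f (e i) + 1) t := ht.congr fun x hx => by
    rw [hκ₂ _ x (hx.trans_le le_self_add), eq_comm]
  obtain ⟨y, t', hy, ht'⟩ := ht₁.exists_of_le (c := κ (b + i) + 1)
    ((le_self_add.trans (hκ₁ _)).trans le_self_add)
  have hft : f t' = f (e i) := by
    rw [← hi (b + i) le_add_self]
    obtain ⟨z, h₁, h₂⟩ := hF.2.1 t' (e (b + i)) ht'.1 (hseq _) fun x =>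
      (ht'.2.2.2 x).trans ((he' (b + i)).1.2 x).symm
    exact ((hf _ _).1 h₁).symm.trans ((hf _ _).1 h₂)
  have hlarge : Large f t' :=
    ⟨ht'.1, ht'.2.1, y, ht'.2.2.1.le, ht'.2.2.1, hft ▸ (lt_add_one _).trans_le hy⟩
  obtain ⟨x, hx⟩ := (hs (κ (b + i))).2.2 t' hlarge c hc
  refine hx ((ht'.2.2.2 x).trans ?_)
  rw [lt_add_one_iff]
  exact and_congr_right fun h' => (hσs _ _ _ h').symm

theorem satFIPP3_of_acaModel : SatFIPP3 M := by
  intro n F hFm hF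
  obtain ⟨f, hf, -, key⟩ := hF.1.exists_recFun hFm
  simp only [true_and] at key
  obtain ⟨k, hk⟩ := exists_not_counterexample hF key n
  refine ⟨k, fun G hG hfun => ?_⟩
  obtain ⟨g, hg, hgn, hgG⟩ := hfun.exists_recFun hG
  obtain ⟨s, hs⟩ := exists_codes g (k + 1)
  have hsG : ∀ x c, x ≤ k ∧ Entry s x c ↔ pr x c ∈ G := fun x c => by
    rw [hgG, hs.2, lt_add_one_iff]
    tauto
  by_contra hcon
  refine hk s ⟨hs.1, fun x hx => ⟨g x, hgn x hx, (hs.2 _ _).2 ⟨lt_add_one_iff.2 hx, rfl⟩⟩,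
    fun t ht c hc => ?_⟩
  by_contra hx
  refine hcon ⟨t, ht.1, c, hc, fun x => ?_, ht.isBig key⟩
  rw [← hsG]
  by_contra hxt
  exact hx ⟨x, hxt⟩

end RCAModel

end SecondOrderArithmetic

namespace SecondOrderArithmetic

/-! ### Models of the axiom systems -/

section

variable {M : Type} [Zero M] [One M] [Add M] [Mul M] [LT M] {𝒮 : Set (Set M)} {φ : Fm}
  {e : ℕ → M} {s : ℕ → Set M}

theorem holds_inductionFor : (inductionFor φ).Holds 𝒮 e s ↔ (φ.Holds 𝒮 (push 0 e) s →
    (∀ a, φ.Holds 𝒮 (push a e) s → φ.Holds 𝒮 (push (a + 1) e) s) →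
      ∀ a, φ.Holds 𝒮 (push a e) s) := by
  have h₀ : (fun i => (Tm.inst Tm.zero i).val e) = push 0 e := by
    funext i
    cases i <;> rfl
  have h₁ : ∀ a, (fun i => (if i = 0 then Tm.add (Tm.var 0) Tm.one else Tm.var i).val
      (push a e)) = push (a + 1) e := fun a => by
    funext i
    cases i <;> rfl
  simp only [inductionFor, Fm.Holds, holds_and, Fm.instN, Fm.atSucc, Fm.holds_subst, h₀, h₁,
    Function.comp_id, and_imp]

theorem holds_comprehensionFor :
    (comprehensionFor φ).Holds 𝒮 e s ↔ {a | φ.Holds 𝒮 (push a e) s} ∈ 𝒮 := by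
  have h : ∀ A : Set M, (push A s ∘ fun i => i + 1) = s := fun A => rfl
  simp only [comprehensionFor, holds_exS, Fm.Holds, holds_iff, Fm.shiftS, Fm.holds_subst, Tm.val, h]
  refine ⟨fun ⟨A, hA, hφ⟩ => ?_, fun h => ⟨_, h, fun a => Iff.rfl⟩⟩
  rwa [show {a | φ.Holds 𝒮 (push a e) s} = A from Set.ext fun a => (hφ a).symm]

variable (𝒮) in
/-- `M` and `𝒮` satisfy the axioms in `T`. -/
def Models (T : Set Fm) : Prop := ∀ χ ∈ T, ∀ e s, (∀ i, s i ∈ 𝒮) → χ.Holds 𝒮 e s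

theorem Models.mono {T T' : Set Fm} (h : Models 𝒮 T) (hT : T' ⊆ T) : Models 𝒮 T' :=
  fun χ hχ => h χ (hT hχ)

variable (𝒮) in
/-- `Σ⁰₁` induction. -/
def SatInduction : Prop :=
  ∀ θ, IsBounded θ → ∀ (e : ℕ → M) (s : ℕ → Set M), (∀ i, s i ∈ 𝒮) →
    (∃ y, θ.Holds 𝒮 (push y (push 0 e)) s) →
    (∀ a, (∃ y, θ.Holds 𝒮 (push y (push a e)) s) →
      ∃ y, θ.Holds 𝒮 (push y (push (a + 1) e)) s) →
    ∀ a, ∃ y, θ.Holds 𝒮 (push y (push a e)) s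

variable (𝒮) in
/-- `Δ⁰₁` comprehension. -/
def SatComprehension : Prop :=
  ∀ θ ψ, IsBounded θ → IsBounded ψ → ∀ (e : ℕ → M) (s : ℕ → Set M), (∀ i, s i ∈ 𝒮) →
    (∀ a, (∃ y, θ.Holds 𝒮 (push y (push a e)) s) ↔ ∀ y, ψ.Holds 𝒮 (push y (push a e)) s) →
    {a | ∃ y, θ.Holds 𝒮 (push y (push a e)) s} ∈ 𝒮

theorem Models.weakArithmetic (h : Models 𝒮 basicAxioms) (hI : SatInduction 𝒮)
    (hne : 𝒮.Nonempty) : WeakArithmetic M := by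
  obtain ⟨A, hA⟩ := hne
  have h := fun χ hχ => h χ hχ (fun _ => (0 : M)) (fun _ => A) fun _ => hA
  simp only [basicAxioms, Set.mem_insert_iff, Set.mem_singleton_iff, forall_eq_or_imp, forall_eq,
    FmB.close, allN, FmB.eq, FmB.lt, FmB.neg, FmB.imp, FmB.or, FmB.iff, holds_neg, holds_or,
    holds_iff, Fm.Holds, NumB.zero_apply, Tm.val,
    Nat.reduceSub, Nat.reduceAdd, push_zero, push_succ] at h
  obtain ⟨h₁, h₂, h₃, h₄, h₅, h₆, h₇, h₈⟩ := h
  exact ⟨h₁, h₂, h₃, h₄, h₅, h₆, h₇, h₈,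
    fun θ hθ => ⟨𝒮, fun _ => A, fun e => hI θ hθ e _ fun _ => hA⟩⟩

theorem Models.satInduction (h : Models 𝒮 RCA0) : SatInduction 𝒮 := fun θ hθ e s hs => by
  have := h (inductionFor θ.exN) (.inl (.inr ⟨_, ⟨θ, hθ, rfl⟩, rfl⟩)) e s hs
  simpa only [holds_inductionFor, holds_exN] using this

theorem Models.satComprehension (h : Models 𝒮 RCA0) : SatComprehension 𝒮 :=
  fun θ ψ hθ hψ e s hs => by
    have := h _ (.inr ⟨θ.exN, ψ.allN, ⟨θ, hθ, rfl⟩, ⟨ψ, hψ, rfl⟩, rfl⟩) e s hs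
    simpa only [Fm.Holds, holds_comprehensionFor, holds_iff, holds_exN] using this

theorem IsBounded.isArithmetical (h : IsBounded φ) : IsArithmetical φ := by
  induction h with
  | eq s t => exact .eq s t
  | lt s t => exact .lt s t
  | mem t X => exact .mem t X
  | bot => exact .bot
  | imp _ _ h₁ h₂ => exact .imp h₁ h₂
  | ball t _ h => exact .allN (.imp (.lt _ _) h)

theorem Models.mem_of_isArithmetical (h : Models 𝒮 ACA0) (hφ : IsArithmetical φ)
    (hs : ∀ i, s i ∈ 𝒮) : {a | φ.Holds 𝒮 (push a e) s} ∈ 𝒮 :=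
  holds_comprehensionFor.1 (h _ (.inr ⟨φ, hφ, rfl⟩) e s hs)

theorem Models.mem_of_exists (h : Models 𝒮 ACA0) (hφ : IsBounded φ) (hs : ∀ i, s i ∈ 𝒮) :
    {a | ∃ y, φ.Holds 𝒮 (push y (push a e)) s} ∈ 𝒮 := by
  have := h.mem_of_isArithmetical (φ := φ.exN) (e := e)
    (.imp (.allN (.imp hφ.isArithmetical .bot)) .bot) hs
  simpa only [holds_exN] using this

theorem Models.induction_set (h : Models 𝒮 ACA0) {A : Set M} (hA : A ∈ 𝒮) (h₀ : 0 ∈ A)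
    (h₁ : ∀ a, a ∈ A → a + 1 ∈ A) (a : M) : a ∈ A := by
  have := h inductionAxiom (.inl (.inr rfl)) (fun _ => 0) (fun _ => A) fun _ => hA
  simp only [inductionAxiom, FmB.close, allS, allN, FmB.mem, FmB.imp, FmB.and, holds_and, Fm.Holds,
    NumB.zero_apply, Tm.val, Nat.reduceSub, Nat.reduceAdd, push_zero] at this
  exact this A hA ⟨h₀, h₁⟩ a

/-- `∃ y, θ` defines a set, to which the induction axiom applies. -/
theorem Models.satInduction_of_aca (h : Models 𝒮 ACA0) : SatInduction 𝒮 :=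
  fun _ hθ _ _ hs h₀ h₁ a => h.induction_set (h.mem_of_exists hθ hs) h₀ h₁ a

theorem Models.satComprehension_of_aca (h : Models 𝒮 ACA0) : SatComprehension 𝒮 :=
  fun _ _ hθ _ _ _ hs _ => h.mem_of_exists hθ hs

/-- The semiring and the order of a model are determined by its operations. -/
@[reducible] noncomputable def rcaModel (h : Models 𝒮 basicAxioms) (hI : SatInduction 𝒮)
    (hC : SatComprehension 𝒮) (hne : 𝒮.Nonempty) : RCAModel M :=
  let w := h.weakArithmetic hI hne
  { w.commSemiring, w.linearOrder with
    sets := 𝒮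
    lt_iff_exists := w.lt_iff
    nonneg := fun a => by
      rcases w.zero_or_succ a with h | ⟨b, h⟩
      · exact .inr h.symm
      · exact .inl ((w.lt_iff _ _).2 ⟨b, by rw [w.zero_add, h]⟩)
    add_lt_add := w.add_lt_add_right
    mul_lt_mul := w.mul_lt_mul_left
    induction_sigma := hI
    comprehension_delta := hC
    sets_nonempty := hne }

/-- A model of `ACA₀`. -/
@[reducible] noncomputable def acaModel (h : Models 𝒮 ACA0) (hne : 𝒮.Nonempty) : ACAModel M :=
  { rcaModel (h.mono fun _ hχ => .inl (.inl hχ)) h.satInduction_of_aca h.satComprehension_of_aca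
      hne with
    all_mem_sets := fun X hX => by
      have := h.mem_of_isArithmetical (φ := .allN (.mem ((Tm.var 1).pr (.var 0)) 0))
        (e := fun _ => 0) (s := fun _ => X) (.allN (.mem _ _)) fun _ => hX
      exact this }

end

theorem holds_iff_FIPP2 {M : Type} [RCAModel M] {e : ℕ → M} {s : ℕ → Set M}
    (hW : WKL.Holds RCAModel.sets e s) : (IPP.iff FIPP2).Holds RCAModel.sets e s := by
  rw [holds_iff, holds_IPP, holds_FIPP2]
  exact ⟨RCAModel.satFIPP2_of_satIPP (holds_WKL.1 hW), RCAModel.satIPP_of_satFIPP2⟩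

theorem holds_iff_FIPP3 {M : Type} [ACAModel M] {e : ℕ → M} {s : ℕ → Set M} :
    (IPP.iff FIPP3).Holds RCAModel.sets e s := by
  rw [holds_iff, holds_IPP, holds_FIPP3]
  exact iff_of_true RCAModel.satIPP_of_acaModel RCAModel.satFIPP3_of_acaModel

end SecondOrderArithmetic

theorem corollary2 :
    SecondOrderArithmetic.Proves SecondOrderArithmetic.WKL0
        (SecondOrderArithmetic.Fm.iff SecondOrderArithmetic.IPP SecondOrderArithmetic.FIPP2) ∧
      SecondOrderArithmetic.Proves SecondOrderArithmetic.ACA0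
        (SecondOrderArithmetic.Fm.iff SecondOrderArithmetic.IPP SecondOrderArithmetic.FIPP3) := by
  open SecondOrderArithmetic in
  refine ⟨completeness fun M _ _ _ _ _ 𝒮 (h : Models 𝒮 WKL0) e s hs => ?_,
    completeness fun M _ _ _ _ _ 𝒮 (h : Models 𝒮 ACA0) e s hs => ?_⟩
  · have h' : Models 𝒮 RCA0 := h.mono fun _ hχ => .inl hχ
    let m := rcaModel (h'.mono fun _ hχ => .inl (.inl hχ)) h'.satInduction h'.satComprehension
      ⟨s 0, hs 0⟩
    exact @holds_iff_FIPP2 M m e s (h _ (.inr rfl) e s hs)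
  · exact @holds_iff_FIPP3 M (acaModel h ⟨s 0, hs 0⟩) e s
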